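/- **Setting.** Let $G'\subset G$ be Lie groups together with an isomorphism of pairs of complexified Lie algebras $(\mathfrak g_{\mathbb C},\mathfrak g'_{\mathbb C})\simeq(\mathfrak o(4,\mathbb C),\mathfrak o(3,\mathbb C))$, where $\mathfrak o(3,\mathbb C)\subset\mathfrak o(4,\mathbb C)$ is the stabilizer of the last standard basis vector $f_0$ of $\mathbb C^4$ (in particular, $(G,G')$ may be any pair of real reductive Lie groups with this property). Write $\mathfrak Z(\mathfrak h)$ for the center of the enveloping algebra $U(\mathfrak h)$. By the Harish-Chandra isomorphisms, in standard coordinates, characters of $\mathfrak Z(\mathfrak o(4,\mathbb C))$ are parametrized by $\mathbb C^2/W(D_2)$ and those of $\mathfrak Z(\mathfrak o(3,\mathbb C))$ by $\mathbb C/W(B_1)$: the parameter $\mu$ corresponds to the character on the Verma module of highest weight $\mu-\rho$, with $\rho=(1,0)$ and $\rho=\tfrac12$, respectively. Let $e_1=(1,0)$ and $e_2=(0,1)$. Let $\Pi_\lambda$ and $\pi_\nu$ be smooth representations of $G$ and $G'$ on complex Fréchet spaces (for example, smooth admissible representations of finite length and moderate growth) with infinitesimal characters $\lambda=(\lambda_1,\lambda_2)\in\mathbb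 C^2$ and $\nu\in\mathbb C$; that is, $\mathfrak Z(\mathfrak g_{\mathbb C})$ and $\mathfrak Z(\mathfrak g'_{\mathbb C})$ act by the scalars of the corresponding characters. Let $\mathfrak g_{\mathbb C}\simeq\mathfrak o(4,\mathbb C)$ act diagonally on $\Pi_\lambda\otimes\mathbb C^4$. For a character $\tau$ of $\mathfrak Z(\mathfrak g_{\mathbb C})$ the $\tau$-primary component of $\Pi_\lambda\otimes\mathbb C^4$ is $$P_\tau=\bigcup_{k}\ \bigcap_{z\in\mathfrak Z(\mathfrak g_{\mathbb C})}\ker\,(z-\tau(z))^k .$$ Let $\operatorname{pr}:\mathbb C^4=\mathbb C f_0\oplus\mathbb C^3\to\mathbb C f_0\simeq\mathbb C$ be the projection. **Theorem.** Assume that $\lambda_1\neq\pm\lambda_2$ and that $\mathfrak Z(\mathfrak g_{\mathbb C})$ acts by scalars on every primary component of $\Pi_\lambda\otimes\mathbb C^4$. Let $i\in\{1,2\}$ and $\delta\in\{+1,-1\}$. Then the primary component of $\Pi_\lambda\otimes\mathbb C^4$ for the character with parameter $\lambda+\delta e_i$ is complementary to the sum of all the other primary components. Let $\operatorname{pr}_{\lambda\to\lambda+\delta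 e_i}$ denote the projection of $\Pi_\lambda\otimes\mathbb C^4$ onto it along that sum. For every symmetry breaking operator $T:\Pi_\lambda\to\pi_\nu$ (a continuous $G'$-intertwining linear map) and every $u\in\Pi_\lambda$, $$(T\otimes\operatorname{pr})\circ\operatorname{pr}_{\lambda\to\lambda+\delta e_i}(u\otimes f_0)=C_{i,\delta}(\lambda_1,\lambda_2;\nu)\,Tu,$$ where $C_{i,\delta}$ is the rational function $$C_{i,\delta}(\lambda_1,\lambda_2;\nu)=(-1)^{i-1}\,\frac{\bigl(\lambda_i+\nu+\tfrac12\delta\bigr)\bigl(\lambda_i-\nu+\tfrac12\delta\bigr)}{2(\lambda_1^2-\lambda_2^2)} .$$ In particular, the coefficient is universal: it depends only on $\lambda_1,\lambda_2,\nu$ (and $i,\delta$), and not on the real forms $(G,G')$ or on the representations $\Pi_\lambda$ and $\pi_\nu$. -/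

import Mathlib

open scoped TensorProduct Manifold ContDiff Topology

attribute [local instance 100] LieRing.ofAssociativeRing

noncomputable section
set_option linter.unusedSectionVars false

/-- Complex Frechet spaces: complete, Hausdorff, locally convex topological vector spaces whose
uniformity is countably generated (equivalently, which are metrizable). -/
class FrechetSpace (V : Type*) [AddCommGroup V] [Module ℂ V] [UniformSpace V] : Prop extends
  IsUniformAddGroup V, ContinuousSMul ℂ V, LocallyConvexSpace ℝ V, CompleteSpace V, T2Space V,
  (uniformity V).IsCountablyGenerated

instance FrechetSpace.continuousSMul_real (V : Type*) [AddCommGroup V] [Module ℂ V]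
    [UniformSpace V] [FrechetSpace V] : ContinuousSMul ℝ V :=
  IsScalarTower.continuousSMul ℂ

/-- `f` is of class `C^k` on the (open) set `U` of the finite-dimensional space `E`, with values in
a topological vector space: `f` is differentiable at the points of `U` and all its directional
derivatives are of class `C^(k-1)`. -/
def SmoothOfOrderOn {E V : Type*} [NormedAddCommGroup E] [NormedSpace ℝ E]
    [AddCommGroup V] [Module ℝ V] [TopologicalSpace V] : ℕ → (E → V) → Set E → Prop
  | 0, f, U => ContinuousOn f U
  | k + 1, f, U => ∃ f' : E → E →L[ℝ] V, (∀ x ∈ U, HasFDerivAt f (f' x) x) ∧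
      ∀ w : E, SmoothOfOrderOn k (fun x => f' x w) U

theorem HasFDerivAt.clm_comp_tvs {E V W : Type*} [NormedAddCommGroup E] [NormedSpace ℝ E]
    [AddCommGroup V] [Module ℝ V] [TopologicalSpace V]
    [AddCommGroup W] [Module ℝ W] [TopologicalSpace W]
    (A : V →L[ℝ] W) {f : E → V} {f' : E →L[ℝ] V} {x : E} (h : HasFDerivAt f f' x) :
    HasFDerivAt (fun y => A (f y)) (A.comp f') x := by
  rw [hasFDerivAt_iff_isLittleOTVS] at h ⊢
  refine ((A.isBigOTVS_fun_comp).trans_isLittleOTVS h).congr_left fun y => ?_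
  simp

theorem SmoothOfOrderOn.contDiffOn {E V : Type*} [NormedAddCommGroup E] [NormedSpace ℝ E]
    [FiniteDimensional ℝ E] [AddCommGroup V] [Module ℝ V] [TopologicalSpace V]
    {U : Set E} (hU : IsOpen U) (φ : V →L[ℝ] ℝ) (k : ℕ) :
    ∀ {f : E → V}, SmoothOfOrderOn k f U → ContDiffOn ℝ k (fun x => φ (f x)) U := by
  induction k with
  | zero =>
    intro f h
    have h' : ContinuousOn f U := h
    have h3 : ContinuousOn (fun x => φ (f x)) U := φ.continuous.comp_continuousOn h'
    simpa using h3
  | succ k ih =>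
    rintro f ⟨f', h1, h2⟩
    have key : ∀ x ∈ U, HasFDerivAt (fun x => φ (f x)) (φ.comp (f' x)) x :=
      fun x hx => (h1 x hx).clm_comp_tvs φ
    have : ContDiffOn ℝ ((k : ℕ∞ω) + 1) (fun x => φ (f x)) U := by
      rw [contDiffOn_succ_iff_fderiv_of_isOpen hU]
      refine ⟨fun x hx => (key x hx).differentiableAt.differentiableWithinAt, by simp, ?_⟩
      have : ContDiffOn ℝ k (fun x => φ.comp (f' x)) U := by
        rw [contDiffOn_clm_apply]
        intro w
        exact ih (h2 w)
      exact this.congr fun x hx => (key x hx).fderiv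
    exact_mod_cast this

/-- A smooth representation of the Lie group `G` (modelled on `E`) on the complex Frechet space `V`:
a homomorphism to the continuous linear operators, jointly continuous, all of whose orbit maps
`g ↦ g • u` are of class `C^k` for every `k` (read in the charts of `G`). -/
structure SmoothRep (E G V : Type*) [NormedAddCommGroup E] [NormedSpace ℝ E]
    [Group G] [TopologicalSpace G] [ChartedSpace E G]
    [AddCommGroup V] [Module ℂ V] [UniformSpace V] where
  toHom : G →* (V →L[ℂ] V)
  continuous_action : Continuous fun p : G × V => toHom p.1 p.2
  smooth_orbit : ∀ (u : V) (g : G) (k : ℕ),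
    SmoothOfOrderOn k (fun x : E => toHom ((chartAt E g).symm x) u) (chartAt E g).target

instance lieGroup_minSmoothness {E G : Type*} [NormedAddCommGroup E] [NormedSpace ℝ E]
    [Group G] [TopologicalSpace G] [ChartedSpace E G] [LieGroup 𝓘(ℝ, E) ∞ G] :
    LieGroup 𝓘(ℝ, E) (minSmoothness ℝ 3) G := by
  rw [minSmoothness_of_isRCLikeNormedField]; infer_instance

namespace SmoothRep

variable {E G V : Type*} [NormedAddCommGroup E] [NormedSpace ℝ E]
    [FiniteDimensional ℝ E] [CompleteSpace E]
    [Group G] [TopologicalSpace G] [ChartedSpace E G] [LieGroup 𝓘(ℝ, E) ∞ G]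
    [AddCommGroup V] [Module ℂ V] [UniformSpace V] [FrechetSpace V]
    (ρ : SmoothRep E G V)

/-- The derivative of the orbit map `g ↦ ρ g u` at the identity, in the direction `X`
(`T_1 G` is identified with the model space by the chart at `1`). -/
def diff (X : GroupLieAlgebra 𝓘(ℝ, E) G) (u : V) : V :=
  fderiv ℝ (fun x : E => ρ.toHom ((chartAt E (1 : G)).symm x) u) (chartAt E (1 : G) 1) X

theorem hasFDerivAt_orbit (u : V) :
    HasFDerivAt (fun x : E => ρ.toHom ((chartAt E (1 : G)).symm x) u)
      (fderiv ℝ (fun x : E => ρ.toHom ((chartAt E (1 : G)).symm x) u) (chartAt E (1 : G) 1))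
      (chartAt E (1 : G) 1) := by
  obtain ⟨f', h, -⟩ := ρ.smooth_orbit u 1 1
  exact (h _ (mem_chart_target E (1 : G))).differentiableAt.hasFDerivAt

/-- Matrix coefficient. -/
def coeff (φ : V →L[ℝ] ℝ) (u : V) (g : G) : ℝ := φ (ρ.toHom g u)

theorem contMDiff_coeff (φ : V →L[ℝ] ℝ) (u : V) :
    ContMDiff 𝓘(ℝ, E) 𝓘(ℝ, ℝ) 2 (ρ.coeff φ u) := by
  intro g
  have h1 := (ρ.smooth_orbit u g 2).contDiffOn (chartAt E g).open_target φ
  have h2 : ContMDiffAt 𝓘(ℝ, E) 𝓘(ℝ, ℝ) 2 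
      (fun x : E => φ (ρ.toHom ((chartAt E g).symm x) u)) (chartAt E g g) :=
    (h1.contDiffAt ((chartAt E g).open_target.mem_nhds (mem_chart_target E g))).contMDiffAt
  have h3 : ContMDiffAt 𝓘(ℝ, E) 𝓘(ℝ, E) 2 (chartAt E g) g := by
    have := contMDiffAt_extChartAt (I := 𝓘(ℝ, E)) (n := 2) (x := g)
    simpa using this
  refine (h2.comp g h3).congr_of_eventuallyEq ?_
  filter_upwards [(chartAt E g).open_source.mem_nhds (mem_chart_source E g)] with y hy
  simp [coeff, (chartAt E g).left_inv hy]

theorem mfderiv_coeff_one (φ : V →L[ℝ] ℝ) (u : V) (X : GroupLieAlgebra 𝓘(ℝ, E) G) :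
    (mfderiv 𝓘(ℝ, E) 𝓘(ℝ, ℝ) (ρ.coeff φ u) 1 X : ℝ) = φ (ρ.diff X u) := by
  have h := ((ρ.contMDiff_coeff φ u) 1).mdifferentiableAt (by norm_num)
  have h2 := (ρ.hasFDerivAt_orbit u).clm_comp_tvs φ
  have h3 : HasMFDerivAt 𝓘(ℝ, E) 𝓘(ℝ, ℝ) (ρ.coeff φ u) 1
      (φ.comp (fderiv ℝ (fun x : E => ρ.toHom ((chartAt E (1 : G)).symm x) u)
        (chartAt E (1 : G) 1))) := by
    refine ⟨h.continuousAt, ?_⟩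
    simp only [mfld_simps]
    exact hasFDerivWithinAt_univ.mpr h2
  rw [h3.mfderiv]
  rfl

theorem mfderiv_coeff_invariant (φ : V →L[ℝ] ℝ) (u : V) (X : GroupLieAlgebra 𝓘(ℝ, E) G) (g : G) :
    (mfderiv 𝓘(ℝ, E) 𝓘(ℝ, ℝ) (ρ.coeff φ u) g (mulInvariantVectorField X g) : ℝ)
      = ρ.coeff φ (ρ.diff X u) g := by
  have h := ((ρ.contMDiff_coeff φ u) (g * 1)).mdifferentiableAt (by norm_num)
  have hL : MDifferentiableAt 𝓘(ℝ, E) 𝓘(ℝ, E) (fun h : G => g * h) 1 :=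
    (contMDiff_mul_left (I := 𝓘(ℝ, E)) (n := 2) (a := g)).contMDiffAt.mdifferentiableAt (by norm_num)
  have e1 : ρ.coeff φ u ∘ (fun h : G => g * h)
      = ρ.coeff (φ.comp ((ρ.toHom g).restrictScalars ℝ)) u := by
    ext h; simp [coeff]
  have e2 := mfderiv_comp (1 : G) h hL
  rw [e1] at e2
  have e3 := ρ.mfderiv_coeff_one (φ.comp ((ρ.toHom g).restrictScalars ℝ)) u X
  rw [e2] at e3
  have e4 : (mfderiv 𝓘(ℝ, E) 𝓘(ℝ, ℝ) (ρ.coeff φ u) (g * 1) (mulInvariantVectorField X g) : ℝ)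
      = ρ.coeff φ (ρ.diff X u) g := e3
  rw [mul_one] at e4
  exact e4


theorem coeff_diff_lie (φ : V →L[ℝ] ℝ) (u : V) (X Y : GroupLieAlgebra 𝓘(ℝ, E) G) :
    φ (ρ.diff ⁅X, Y⁆ u) = φ (ρ.diff X (ρ.diff Y u)) - φ (ρ.diff Y (ρ.diff X u)) := by
  set e := extChartAt 𝓘(ℝ, E) (1 : G) with he
  let F : V → E → ℝ := fun u => ρ.coeff φ u ∘ e.symm
  have htgt : IsOpen e.target := by simpa [he] using (chartAt E (1 : G)).open_target
  have hx0 : e 1 ∈ e.target := mem_extChartAt_target _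
  have hsymm : ∀ x ∈ e.target, MDifferentiableAt 𝓘(ℝ, E) 𝓘(ℝ, E) e.symm x := fun x hx =>
    ((contMDiffOn_extChartAt_symm (n := 2) (1 : G)).contMDiffAt
      (htgt.mem_nhds hx)).mdifferentiableAt (by norm_num)
  have hf : ∀ u g, MDifferentiableAt 𝓘(ℝ, E) 𝓘(ℝ, ℝ) (ρ.coeff φ u) g := fun u g =>
    ((ρ.contMDiff_coeff φ u) g).mdifferentiableAt (by norm_num)
  have hFs : ∀ u, ∀ x ∈ e.target, ContDiffAt ℝ 2 (F u) x := fun u x hx =>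
    (ContMDiffAt.comp x ((ρ.contMDiff_coeff φ u) _)
      ((contMDiffOn_extChartAt_symm (n := 2) (1 : G)).contMDiffAt
      (htgt.mem_nhds hx))).contDiffAt
  let P : GroupLieAlgebra 𝓘(ℝ, E) G → E → E := fun Z =>
    VectorField.mpullbackWithin 𝓘(ℝ, E) 𝓘(ℝ, E) e.symm (mulInvariantVectorField Z)
      (Set.range 𝓘(ℝ, E))
  have hP : ∀ u Z, ∀ x ∈ e.target,
      fderiv ℝ (F u) x (P Z x) = ρ.coeff φ (ρ.diff Z u) (e.symm x) := by
    intro u Z x hx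
    have h1 := mfderiv_comp x (hf u (e.symm x)) (hsymm x hx)
    have hinv := isInvertible_mfderivWithin_extChartAt_symm (I := 𝓘(ℝ, E)) hx
    rw [← ρ.mfderiv_coeff_invariant, ← mfderiv_eq_fderiv]
    change (mfderiv 𝓘(ℝ, E) 𝓘(ℝ, ℝ) (ρ.coeff φ u ∘ e.symm) x) (P Z x) = _
    rw [h1]
    change (mfderiv 𝓘(ℝ, E) 𝓘(ℝ, ℝ) (ρ.coeff φ u) (e.symm x))
      ((mfderiv 𝓘(ℝ, E) 𝓘(ℝ, E) e.symm x) (P Z x)) = _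
    congr 1
    have h2 : (mfderivWithin 𝓘(ℝ, E) 𝓘(ℝ, E) e.symm (Set.range 𝓘(ℝ, E)) x) (P Z x)
        = mulInvariantVectorField Z (e.symm x) := hinv.self_apply_inverse _
    simpa [mfderivWithin_univ] using h2
  have hset : e.symm ⁻¹' Set.univ ∩ Set.range 𝓘(ℝ, E) = Set.univ := by simp
  have hPd : ∀ Z, DifferentiableAt ℝ (P Z) (e 1) := by
    intro Z
    have h := (mdifferentiableAt_mulInvariantVectorField (I := 𝓘(ℝ, E)) (G := G) Z
      (g := 1)).mdifferentiableWithinAt (s := Set.univ)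
    have h2 : DifferentiableWithinAt ℝ (P Z)
        (e.symm ⁻¹' Set.univ ∩ Set.range 𝓘(ℝ, E)) (e 1) :=
      h.differentiableWithinAt_mpullbackWithin_vectorField
    rw [hset] at h2
    exact differentiableWithinAt_univ.mp h2
  have hFP : ∀ u Z, (fun x => fderiv ℝ (F u) x (P Z x)) =ᶠ[𝓝 (e 1)] F (ρ.diff Z u) := by
    intro u Z
    filter_upwards [htgt.mem_nhds hx0] with x hx using hP u Z x hx
  have hval : ∀ u Z W, fderiv ℝ (fun x => fderiv ℝ (F u) x (P Z x)) (e 1) (P W (e 1))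
      = φ (ρ.diff W (ρ.diff Z u)) := by
    intro u Z W
    rw [(hFP u Z).fderiv_eq, hP _ _ _ hx0, extChartAt_to_inv]
    simp [coeff]
  have hbr := VectorField.fderiv_apply_lieBracket (hFs u (e 1) hx0) (by simp) (hPd Y) (hPd X)
  rw [hval, hval] at hbr
  rw [← hbr, ← ρ.mfderiv_coeff_one]
  have hE : MDifferentiableAt 𝓘(ℝ, E) 𝓘(ℝ, E) e 1 :=
    (contMDiffAt_extChartAt (I := 𝓘(ℝ, E)) (n := 2) (x := (1 : G))).mdifferentiableAt
      (by norm_num)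
  have hFm : MDifferentiableAt 𝓘(ℝ, E) 𝓘(ℝ, ℝ) (F u) (e 1) :=
    ((hFs u (e 1) hx0).differentiableAt (by norm_num)).mdifferentiableAt
  have hfF : ρ.coeff φ u =ᶠ[𝓝 1] F u ∘ e := by
    filter_upwards [extChartAt_source_mem_nhds (I := 𝓘(ℝ, E)) (1 : G)] with g hg
    simp [F, e.left_inv hg]
  have hinv : (mfderiv 𝓘(ℝ, E) 𝓘(ℝ, E) e 1).IsInvertible :=
    isInvertible_mfderiv_extChartAt (mem_extChartAt_source (1 : G))
  have hX : (mfderiv 𝓘(ℝ, E) 𝓘(ℝ, E) e 1) ⁅X, Y⁆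
      = VectorField.lieBracket ℝ (P X) (P Y) (e 1) := by
    let B : E := VectorField.lieBracketWithin ℝ (P X) (P Y)
      (e.symm ⁻¹' Set.univ ∩ Set.range 𝓘(ℝ, E)) (e 1)
    have h8 : ⁅X, Y⁆ = (mfderiv 𝓘(ℝ, E) 𝓘(ℝ, E) e 1).inverse B :=
      VectorField.mlieBracketWithin_apply
    have h9 : B = VectorField.lieBracket ℝ (P X) (P Y) (e 1) := by
      simp only [B, hset, VectorField.lieBracketWithin_univ]
    rw [h8, ← h9]
    exact hinv.self_apply_inverse _
  have h5 : mfderiv 𝓘(ℝ, E) 𝓘(ℝ, ℝ) (F u ∘ e) 1 =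
      (mfderiv 𝓘(ℝ, E) 𝓘(ℝ, ℝ) (F u) (e 1)).comp (mfderiv 𝓘(ℝ, E) 𝓘(ℝ, E) e 1) :=
    mfderiv_comp (1 : G) hFm hE
  have h6 := hfF.mfderiv_eq (I := 𝓘(ℝ, E)) (I' := 𝓘(ℝ, ℝ))
  have h7 : (mfderiv 𝓘(ℝ, E) 𝓘(ℝ, ℝ) (ρ.coeff φ u) 1 ⁅X, Y⁆ : ℝ)
      = mfderiv 𝓘(ℝ, E) 𝓘(ℝ, ℝ) (F u ∘ e) 1 ⁅X, Y⁆ := by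
    rw [h6]; rfl
  refine h7.trans ?_
  rw [h5]
  change (mfderiv 𝓘(ℝ, E) 𝓘(ℝ, ℝ) (F u) (e 1)) ((mfderiv 𝓘(ℝ, E) 𝓘(ℝ, E) e 1) ⁅X, Y⁆) = _
  rw [hX, mfderiv_eq_fderiv]
  rfl


/-- The differentiated representation of the Lie algebra of `G` on `V`. -/
def differential : GroupLieAlgebra 𝓘(ℝ, E) G →ₗ⁅ℝ⁆ Module.End ℂ V where
  toFun X :=
    { toFun := ρ.diff X
      map_add' := fun u v => by
        refine SeparatingDual.eq_iff_forall_dual_eq (R := ℝ) |>.2 fun φ => ?_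
        have hu := (ρ.hasFDerivAt_orbit u).clm_comp_tvs φ
        have hv := (ρ.hasFDerivAt_orbit v).clm_comp_tvs φ
        have h1 := ((ρ.hasFDerivAt_orbit (u + v)).clm_comp_tvs φ).unique
          ((hu.add hv).congr_of_eventuallyEq (.of_forall fun x => by simp))
        have h2 : φ (ρ.diff X (u + v)) = φ (ρ.diff X u) + φ (ρ.diff X v) :=
          congrArg (fun L : E →L[ℝ] ℝ => L (show E from X)) h1
        rw [h2, map_add]
      map_smul' := fun c u => by
        let A : V →L[ℝ] V := (c • ContinuousLinearMap.id ℂ V).restrictScalars ℝ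
        have h1 := (ρ.hasFDerivAt_orbit (c • u)).unique
          (((ρ.hasFDerivAt_orbit u).clm_comp_tvs A).congr_of_eventuallyEq
            (.of_forall fun x => by simp [A]))
        exact congrArg (fun L : E →L[ℝ] V => L (show E from X)) h1 }
  map_add' X Y := by
    ext u
    exact map_add (fderiv ℝ (fun x : E => ρ.toHom ((chartAt E (1 : G)).symm x) u)
      (chartAt E (1 : G) 1)) X Y
  map_smul' c X := by
    ext u
    exact map_smul (fderiv ℝ (fun x : E => ρ.toHom ((chartAt E (1 : G)).symm x) u)
      (chartAt E (1 : G) 1)) c X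
  map_lie' {X Y} := by
    ext u
    refine SeparatingDual.eq_iff_forall_dual_eq (R := ℝ) |>.2 fun φ => ?_
    refine (ρ.coeff_diff_lie φ u X Y).trans ?_
    simp only [LieRing.of_associative_ring_bracket]
    exact (map_sub φ _ _).symm

end SmoothRep

/-- The complex-linear extension to `ℂ ⊗ g` of a representation of a real Lie algebra `g`. -/
def extendComplex {g V : Type*} [LieRing g] [LieAlgebra ℝ g] [AddCommGroup V] [Module ℂ V]
    (f : g →ₗ⁅ℝ⁆ Module.End ℂ V) : (ℂ ⊗[ℝ] g) →ₗ⁅ℂ⁆ Module.End ℂ V :=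
  { LinearMap.liftBaseChange ℂ (f : g →ₗ[ℝ] Module.End ℂ V) with
    map_lie' := by
      intro x y
      change LinearMap.liftBaseChange ℂ (f : g →ₗ[ℝ] Module.End ℂ V) ⁅x, y⁆ =
        ⁅LinearMap.liftBaseChange ℂ (f : g →ₗ[ℝ] Module.End ℂ V) x,
          LinearMap.liftBaseChange ℂ (f : g →ₗ[ℝ] Module.End ℂ V) y⁆
      induction x with
      | zero => simp
      | add x x' hx hx' => simp [hx, hx']
      | tmul a X =>
        induction y with
        | zero => 
          refine (congrArg (LinearMap.liftBaseChange ℂ (f : g →ₗ[ℝ] Module.End ℂ V))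
            (lie_zero (a ⊗ₜ[ℝ] X))).trans ?_
          rw [map_zero, lie_zero]
        | add y y' hy hy' => 
          refine (congrArg (LinearMap.liftBaseChange ℂ (f : g →ₗ[ℝ] Module.End ℂ V))
            (lie_add (a ⊗ₜ[ℝ] X) y y')).trans ?_
          rw [map_add, hy, hy', map_add, lie_add]
        | tmul b Y => simp [mul_smul, smul_comm a b] }

/-- The diagonal action on a tensor product. -/
def tensorAction {L V W : Type*} [LieRing L] [LieAlgebra ℂ L] [AddCommGroup V] [Module ℂ V]
    [AddCommGroup W] [Module ℂ W] (ρ : L →ₗ⁅ℂ⁆ Module.End ℂ V) (σ : L →ₗ⁅ℂ⁆ Module.End ℂ W) :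
    L →ₗ⁅ℂ⁆ Module.End ℂ (V ⊗[ℂ] W) where
  toFun A := (ρ A).rTensor W + (σ A).lTensor V
  map_add' A B := by simp only [map_add, LinearMap.rTensor_add, LinearMap.lTensor_add]; abel
  map_smul' c A := by
    simp only [map_smul, LinearMap.rTensor_smul, LinearMap.lTensor_smul, smul_add,
      RingHom.id_apply]
  map_lie' {A B} := by
    refine TensorProduct.ext' fun v w => ?_
    simp [LieRing.of_associative_ring_bracket]
    abel

/-- The universal enveloping algebra. -/
abbrev Envelope (L : Type*) [LieRing L] [LieAlgebra ℂ L] : Type _ := UniversalEnvelopingAlgebra ℂ L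

/-- The center of the universal enveloping algebra. -/
abbrev EnvelopeCenter (L : Type*) [LieRing L] [LieAlgebra ℂ L] : Subalgebra ℂ (Envelope L) :=
  Subalgebra.center ℂ (Envelope L)

section Center
variable {L V : Type*} [LieRing L] [LieAlgebra ℂ L] [AddCommGroup V] [Module ℂ V]

/-- The action of the center of the enveloping algebra. -/
def centerAction (ρ : L →ₗ⁅ℂ⁆ Module.End ℂ V) : EnvelopeCenter L →ₐ[ℂ] Module.End ℂ V :=
  (UniversalEnvelopingAlgebra.lift ℂ ρ).comp (EnvelopeCenter L).val

/-- The `τ`-primary component `⋃ k, ⋂ z, ker (z - τ z) ^ k` (the union is increasing). -/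
def primaryComponent (ρ : L →ₗ⁅ℂ⁆ Module.End ℂ V) (τ : EnvelopeCenter L → ℂ) :
    Submodule ℂ V :=
  ⨆ k : ℕ, ⨅ z : EnvelopeCenter L, LinearMap.ker ((centerAction ρ z - τ z • 1) ^ k)

open Classical in
/-- The projection onto the `τ`-primary component along the sum of all the other primary components.
It is only meaningful when these two subspaces are complementary. -/
def primaryProjection (ρ : L →ₗ⁅ℂ⁆ Module.End ℂ V) (τ : EnvelopeCenter L → ℂ) :
    Module.End ℂ V :=
  if h : IsCompl (primaryComponent ρ τ)
      (⨆ (σ : EnvelopeCenter L → ℂ) (_ : σ ≠ τ), primaryComponent ρ σ)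
  then (primaryComponent ρ τ).projection _ h else 0

end Center

section HC
variable {L V : Type*} [LieRing L] [LieAlgebra ℂ L] [AddCommGroup V] [Module ℂ V]

/-- The left ideal of `U(L)` generated by `n` and by the `H - c` for `(H, c) ∈ h`. When `n` spans
the nilradical of a Borel subalgebra and `h` lists the values of a weight on a basis of the Cartan
subalgebra, the quotient of `U(L)` by it is the Verma module with that highest weight. -/
def vermaIdeal (n : Set L) (h : Set (L × ℂ)) : Ideal (Envelope L) :=
  Ideal.span ({a | ∃ x ∈ n, a = UniversalEnvelopingAlgebra.ι ℂ x} ∪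
    {a | ∃ p ∈ h, a = UniversalEnvelopingAlgebra.ι ℂ p.1 - algebraMap ℂ (Envelope L) p.2})

/-- The scalar `c` by which the central element `z` acts on the Verma module `U(L) / J`, that is, the
unique `c` with `z - c ∈ J`. -/
def centralCharacter (J : Ideal (Envelope L)) (z : EnvelopeCenter L) : ℂ :=
  Classical.epsilon fun c : ℂ => (z : Envelope L) - algebraMap ℂ (Envelope L) c ∈ J

/-- The center of the enveloping algebra acts by the scalars `τ`. -/
def HasCentralCharacter (ρ : L →ₗ⁅ℂ⁆ Module.End ℂ V) (τ : EnvelopeCenter L → ℂ) : Prop :=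
  ∀ (z : EnvelopeCenter L) (v : V), centerAction ρ z v = τ z • v
end HC

/-- The complex Lie algebra `o(n, ℂ)` of skew-symmetric matrices. -/
abbrev SO (n : ℕ) : LieSubalgebra ℂ (Matrix (Fin n) (Fin n) ℂ) :=
  LieAlgebra.Orthogonal.so (Fin n) ℂ

/-- The skew-symmetric matrix `a bᵀ - b aᵀ`, i.e. `w ↦ (b ⬝ w) a - (a ⬝ w) b`. -/
def wedge {n : ℕ} (a b : Fin n → ℂ) : SO n :=
  ⟨Matrix.vecMulVec a b - Matrix.vecMulVec b a, by
    rw [LieAlgebra.Orthogonal.mem_so]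
    simp [Matrix.transpose_sub, Matrix.transpose_vecMulVec]⟩

/-- The character of the center of `U(o(4, ℂ))` with Harish-Chandra parameter `lam`. With the
isotropic vectors `a₁ = (1, i, 0, 0)`, `b₁ = (1, -i, 0, 0)`, `a₂ = (0, 0, 1, i)`,
`b₂ = (0, 0, 1, -i)`, the Cartan subalgebra has basis `H₁ = ½ a₁ ∧ b₁`, `H₂ = ½ a₂ ∧ b₂`, the
vectors `a₁, b₁, a₂, b₂` have weights `e₁, -e₁, e₂, -e₂`, the positive roots are `e₁ ± e₂` with root
vectors `a₁ ∧ a₂`, `a₁ ∧ b₂`, and `ρ = (1, 0)`. -/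
def hc4 (lam : Fin 2 → ℂ) : EnvelopeCenter (SO 4) → ℂ :=
  centralCharacter (vermaIdeal
    {wedge ![1, Complex.I, 0, 0] ![0, 0, 1, Complex.I],
      wedge ![1, Complex.I, 0, 0] ![0, 0, 1, -Complex.I]}
    {((1 / 2 : ℂ) • wedge ![1, Complex.I, 0, 0] ![1, -Complex.I, 0, 0], lam 0 - 1),
      ((1 / 2 : ℂ) • wedge ![0, 0, 1, Complex.I] ![0, 0, 1, -Complex.I], lam 1)})

/-- The character of the center of `U(o(3, ℂ))` with Harish-Chandra parameter `ν`; the Cartan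
subalgebra is spanned by `H = ½ a ∧ b` with `a = (1, i, 0)`, `b = (1, -i, 0)`, the positive root is
`e₁` with root vector `a ∧ (0, 0, 1)`, and `ρ = 1/2`. -/
def hc3 (ν : ℂ) : EnvelopeCenter (SO 3) → ℂ :=
  centralCharacter (vermaIdeal
    {wedge ![1, Complex.I, 0] ![0, 0, 1]}
    {((1 / 2 : ℂ) • wedge ![1, Complex.I, 0] ![1, -Complex.I, 0], ν - 1 / 2)})

/-- The natural representation of `o(n, ℂ)` on `ℂⁿ`. -/
def standardRep (n : ℕ) : SO n →ₗ⁅ℂ⁆ Module.End ℂ (Fin n → ℂ) :=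
  (Matrix.toLinAlgEquiv' : Matrix (Fin n) (Fin n) ℂ ≃ₐ[ℂ] _).toAlgHom.toLieHom.comp (SO n).incl

/-- The embedding `A ↦ diag(A, 0)` of `3 × 3` matrices into `4 × 4` matrices; it maps `o(3, ℂ)` onto
the isotropy subalgebra of the last basis vector of `ℂ⁴`. -/
def extendByZero (A : Matrix (Fin 3) (Fin 3) ℂ) : Matrix (Fin 4) (Fin 4) ℂ :=
  Matrix.of fun i j => Fin.lastCases 0 (fun i' => Fin.lastCases 0 (fun j' => A i' j') j) i

section Pair

variable {E E' G G' : Type*} [NormedAddCommGroup E] [NormedSpace ℝ E] [CompleteSpace E]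
    [NormedAddCommGroup E'] [NormedSpace ℝ E'] [CompleteSpace E']
    [Group G] [TopologicalSpace G] [ChartedSpace E G] [LieGroup 𝓘(ℝ, E) ∞ G]
    [Group G'] [TopologicalSpace G'] [ChartedSpace E' G'] [LieGroup 𝓘(ℝ, E') ∞ G']

/-- The differential at the identity of a homomorphism of Lie groups (`j 1 = 1`, so that the tangent
space of `G` at `j 1` is the Lie algebra of `G`). -/
def lieDifferential (j : G' →* G) (X : GroupLieAlgebra 𝓘(ℝ, E') G') :
    GroupLieAlgebra 𝓘(ℝ, E) G :=
  mfderiv 𝓘(ℝ, E') 𝓘(ℝ, E) j 1 X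

variable (E E' G G') in
/-- A pair of Lie groups `G' ⊂ G` (an injective homomorphism `j` of Lie groups) together with an
isomorphism of the pair of complexified Lie algebras with `(o(4, ℂ), o(3, ℂ))`. -/
structure O4O3Pair where
  j : G' →* G
  smooth : ContMDiff 𝓘(ℝ, E') 𝓘(ℝ, E) ∞ j
  injective : Function.Injective j
  iso : (ℂ ⊗[ℝ] GroupLieAlgebra 𝓘(ℝ, E) G) ≃ₗ⁅ℂ⁆ SO 4
  iso' : (ℂ ⊗[ℝ] GroupLieAlgebra 𝓘(ℝ, E') G') ≃ₗ⁅ℂ⁆ SO 3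
  compatible : ∀ X : GroupLieAlgebra 𝓘(ℝ, E') G',
    (iso ((1 : ℂ) ⊗ₜ[ℝ] lieDifferential j X) : Matrix (Fin 4) (Fin 4) ℂ)
      = extendByZero (iso' ((1 : ℂ) ⊗ₜ[ℝ] X) : Matrix (Fin 3) (Fin 3) ℂ)

variable [FiniteDimensional ℝ E] [FiniteDimensional ℝ E']
    {V W : Type*} [AddCommGroup V] [Module ℂ V] [UniformSpace V] [FrechetSpace V]
    [AddCommGroup W] [Module ℂ W] [UniformSpace W] [FrechetSpace W]
    (P : O4O3Pair E E' G G')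

/-- The action of `o(4, ℂ)` on a smooth representation of `G`. -/
def O4O3Pair.action (ρ : SmoothRep E G V) : SO 4 →ₗ⁅ℂ⁆ Module.End ℂ V :=
  (extendComplex ρ.differential).comp P.iso.symm.toLieHom

/-- The action of `o(3, ℂ)` on a smooth representation of `G'`. -/
def O4O3Pair.action' (η : SmoothRep E' G' W) : SO 3 →ₗ⁅ℂ⁆ Module.End ℂ W :=
  (extendComplex η.differential).comp P.iso'.symm.toLieHom

/-- The action of `o(4, ℂ)` on `V ⊗ ℂ⁴`. -/
def O4O3Pair.tensorFour (ρ : SmoothRep E G V) :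
    SO 4 →ₗ⁅ℂ⁆ Module.End ℂ (V ⊗[ℂ] (Fin 4 → ℂ)) :=
  tensorAction (P.action ρ) (standardRep 4)

/-- `T` is a symmetry breaking operator: it intertwines the actions of `G'`. -/
def O4O3Pair.IsSymmetryBreaking (ρ : SmoothRep E G V) (η : SmoothRep E' G' W)
    (T : V →L[ℂ] W) : Prop :=
  ∀ (h : G') (u : V), T (ρ.toHom (P.j h) u) = η.toHom h (T u)

end Pair

/-- The generator `f₀` of the `o(3, ℂ)`-invariants of `ℂ⁴`. -/
def f0 : Fin 4 → ℂ := Pi.single (Fin.last 3) 1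

/-- The `o(3, ℂ)`-equivariant projection `ℂ⁴ = ℂ f₀ ⊕ ℂ³ → ℂ f₀ ≃ ℂ`. -/
def prF : (Fin 4 → ℂ) →ₗ[ℂ] ℂ := LinearMap.proj (Fin.last 3)

/-- The map `T ⊗ pr : V ⊗ ℂ⁴ → W ⊗ ℂ ≃ W`. -/
def tensorPr {V W : Type*} [AddCommGroup V] [Module ℂ V] [AddCommGroup W] [Module ℂ W]
    (T : V →ₗ[ℂ] W) : V ⊗[ℂ] (Fin 4 → ℂ) →ₗ[ℂ] W :=
  (TensorProduct.rid ℂ W).toLinearMap ∘ₗ TensorProduct.map T prF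

/-- The sign `±1` as a complex number. -/
def signC (δ : ℤˣ) : ℂ := ((δ : ℤ) : ℂ)

/-- The rational function `C_{i,δ}(λ₁, λ₂; ν)`; the indices `1, 2` are `0, 1 : Fin 2`. -/
def translationCoeff (i : Fin 2) (δ : ℤˣ) (lam : Fin 2 → ℂ) (ν : ℂ) : ℂ :=
  (-1) ^ (i : ℕ) * ((lam i + ν + signC δ / 2) * (lam i - ν + signC δ / 2)) /
    (2 * (lam 0 ^ 2 - lam 1 ^ 2))

end

/-! The algebra o(4) splits into two commuting ideals isomorphic to o(3), the self-dual and
anti-self-dual halves. In the coordinates x = λ₁ + λ₂, y = λ₁ - λ₂ their Casimir elements, suitably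
shifted, act on Π_λ by x² and y². On ℂ⁴ = ℂ² ⊗ ℂ² each ideal acts by quaternion units. Hence the
coupling operator A of the first ideal on Π_λ ⊗ ℂ⁴ satisfies A² = x² (`coupling_mul_self`), and the
Casimir of the diagonal action is x² + 1 + 2A (`lift_tensorAction_casimirFour`). Where A = εx with ε
= ±1, this Casimir is (x + ε)². The second ideal gives in the same way an operator B with B² = y²,
which commutes with A.

Regularity of λ means that x and y are nonzero. Then (1 + εA/x)(1 + ε'B/y)/4 are four complementary
projections onto joint eigenspaces with pairwise distinct Casimir values. The Casimirs generate the
center of U(o(4)) (`mem_adjoin_casimirFour`), so these projections are the primary projections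
(`isCompl_primaryComponent`). The shift by δe₁ is ε = ε' = δ, and the shift by δe₂ is ε = δ, ε' =
-δ.

It remains to take the f₀-component of the expanded projection at u ⊗ f₀. The terms 1, A, B each
contribute Tu, since skew matrices move f₀ into its orthogonal complement. The term AB contributes
Tu + T(Σ X₊X₋ u), the sum running over the corresponding members of the two triples. Polarization
expresses Σ X₊X₋ through the two Casimirs and the Casimir of the diagonal o(3); the latter becomes
the scalar (2ν)² after T (`tensorPr_coupling_coupling_eq`). What is left is an identity of rational
functions.

The generation of the center is proved without PBW or the Harish-Chandra isomorphism. A weight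
argument shows that central elements are polynomials in Casimir and Cartan elements, and explicit
Verma modules show that the Cartan variables do not occur. -/

noncomputable section

set_option linter.unusedSimpArgs false
set_option linter.unnecessarySeqFocus false

/-! ### Rotation triples: Casimir, ladder operators, coupling with quaternion units. -/

/-- Three elements of a ring satisfying the commutation relations of (twice) the standard basis of
`o(3)`. -/
structure RotationTriple {A : Type*} [Ring A] (x y z : A) : Prop where
  xy : x * y - y * x = -(2 * z)
  yz : y * z - z * y = -(2 * x)
  zx : z * x - x * z = -(2 * y)

/-- The shifted Casimir element of a rotation triple. -/
def casimir {A : Type*} [Ring A] (x y z : A) : A := 1 - (x * x + y * y + z * z)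

/-- The raising operator of a rotation triple. -/
def raising {A : Type*} [Ring A] [Algebra ℂ A] (y z : A) : A := y + Complex.I • z

/-- The lowering operator of a rotation triple. -/
def lowering {A : Type*} [Ring A] [Algebra ℂ A] (y z : A) : A :=
  (-(1 / 4) : ℂ) • (y - Complex.I • z)

/-- The Cartan element of a rotation triple. -/
def cartan {A : Type*} [Ring A] [Algebra ℂ A] (x : A) : A := -(Complex.I • x)

namespace RotationTriple

section Ring
variable {A : Type*} [Ring A] {x y z : A} (h : RotationTriple x y z)
include h

theorem rotate : RotationTriple y z x := ⟨h.yz, h.zx, h.xy⟩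

theorem casimir_comm_left : Commute (casimir x y z) x := by
  have h1 := h.xy
  have h3 := h.zx
  unfold casimir Commute SemiconjBy
  linear_combination (norm := noncomm_ring) y * h1 + h1 * y - z * h3 - h3 * z

omit h in
theorem casimir_rotate : casimir y z x = casimir x y z := by
  unfold casimir; abel

theorem casimir_comm_mid : Commute (casimir x y z) y := by
  have := h.rotate.casimir_comm_left
  rwa [casimir_rotate] at this

theorem casimir_comm_right : Commute (casimir x y z) z := by
  have := h.rotate.rotate.casimir_comm_left
  rwa [casimir_rotate, casimir_rotate] at this

/-- The coupling of a rotation triple with commuting quaternion units squares to the Casimir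
element. -/
theorem coupling_sq {a b c : A} (haa : a * a = -1) (hbb : b * b = -1) (hcc : c * c = -1)
    (hab : a * b = -c) (hbc : b * c = -a) (hca : c * a = -b)
    (hba : b * a = c) (hcb : c * b = a) (hac : a * c = b)
    (hc : ∀ u ∈ ({a, b, c} : Set A), ∀ v ∈ ({x, y, z} : Set A), u * v = v * u) :
    (1 - (x * a + y * b + z * c)) * (1 - (x * a + y * b + z * c)) = casimir x y z := by
  have key : ∀ u ∈ ({a, b, c} : Set A), ∀ v ∈ ({x, y, z} : Set A), ∀ (p q : A),
      (p * u) * (v * q) = (p * v) * (u * q) := by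
    intro u hu v hv p q
    rw [mul_assoc, ← mul_assoc u, hc u hu v hv]; noncomm_ring
  simp only [Set.mem_insert_iff, Set.mem_singleton_iff, forall_eq_or_imp, forall_eq] at key
  obtain ⟨⟨k1, k2, k3⟩, ⟨k4, k5, k6⟩, ⟨k7, k8, k9⟩⟩ := key
  have h1 := h.xy
  have h2 := h.yz
  have h3 := h.zx
  -- With D = xa + yb + zc, the squares contribute -(x² + y² + z²) and the mixed terms combine to
  -- -[x,y]c - [y,z]a - [z,x]b = 2D. So D² = 2D - (x² + y² + z²), and the linear terms cancel in (1
  -- - D)².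
  simp only [sub_mul, mul_sub, add_mul, mul_add, one_mul, mul_one, k1, k2, k3, k4, k5, k6, k7, k8,
    k9, haa, hbb, hcc, hab, hbc, hca, hba, hcb, hac, casimir]
  linear_combination (norm := noncomm_ring) -(h1 * c) - h2 * a - h3 * b

omit h in
-- Each mixed product occurs twice because the families commute, and -(a² + b² + c²) = 3. The 3 is
-- split as 1 + 2 so that the mixed terms assemble into twice the coupling.
theorem casimir_add {a b c : A} (haa : a * a = -1) (hbb : b * b = -1) (hcc : c * c = -1)
    (hc : ∀ u ∈ ({a, b, c} : Set A), ∀ v ∈ ({x, y, z} : Set A), u * v = v * u) :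
    casimir (x + a) (y + b) (z + c)
      = casimir x y z + 1 + 2 * (1 - (x * a + y * b + z * c)) := by
  simp only [Set.mem_insert_iff, Set.mem_singleton_iff, forall_eq_or_imp, forall_eq] at hc
  obtain ⟨⟨k1, -, -⟩, ⟨-, k5, -⟩, ⟨-, -, k9⟩⟩ := hc
  unfold casimir
  simp only [add_mul, mul_add, k1, k5, k9, haa, hbb, hcc]
  noncomm_ring

end Ring

section Algebra
variable {A : Type*} [Ring A] [Algebra ℂ A] {x y z : A} (h : RotationTriple x y z)
include h

/-- The commutation relations as rewriting rules towards the order x, y, z, with complex scalars, so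
that identities in the triple reduce to comparing coefficients. -/
theorem straighten : y * x = x * y + (2 : ℂ) • z ∧ z * y = y * z + (2 : ℂ) • x ∧
    z * x = x * z - (2 : ℂ) • y := by
  have h1 := h.xy
  have h2 := h.yz
  have h3 := h.zx
  simp only [two_smul]
  rw [two_mul] at h1 h2 h3
  rw [sub_eq_iff_eq_add] at h1 h2 h3
  refine ⟨?_, ?_, ?_⟩
  · rw [h1]; abel
  · rw [h2]; abel
  · rw [h3]; abel

theorem raising_mul_cartan :
    raising y z * cartan x = (cartan x - (2 : ℂ) • 1) * raising y z := by
  obtain ⟨h1, h2, h3⟩ := h.straighten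
  simp only [raising, cartan, add_mul, mul_add, sub_mul, mul_neg, neg_mul, smul_mul_assoc,
    mul_smul_comm, one_mul, h1, h3, smul_add, smul_sub, smul_smul, Complex.I_mul_I]
  match_scalars <;> simp <;> ring_nf <;> simp

theorem lowering_mul_cartan :
    lowering y z * cartan x = (cartan x + (2 : ℂ) • 1) * lowering y z := by
  obtain ⟨h1, h2, h3⟩ := h.straighten
  simp only [lowering, cartan, add_mul, sub_mul, mul_sub, mul_neg, neg_mul, smul_mul_assoc,
    mul_smul_comm, one_mul, h1, h3, smul_add, smul_sub, smul_smul]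
  match_scalars <;> simp <;> ring_nf <;> norm_num

/-- Write e, f, h for the raising, lowering and Cartan elements. The factor -1/4 in f gives [e, f] =
h, and the shift by 1 in the Casimir completes the square in h. A vector killed by e of weight c - 1
therefore has Casimir value c². -/
theorem casimir_eq_lowering_mul_raising :
    casimir x y z = (cartan x + 1) * (cartan x + 1) + (4 : ℂ) • (lowering y z * raising y z) := by
  obtain ⟨-, h2, -⟩ := h.straighten
  simp only [raising, lowering, cartan, casimir, add_mul, mul_add, sub_mul, mul_neg,
    neg_mul, smul_mul_assoc, mul_smul_comm, one_mul, mul_one, h2, smul_add, smul_sub,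
    smul_smul]
  match_scalars <;> simp <;> ring_nf <;> simp

theorem casimir_eq_raising_mul_lowering :
    casimir x y z = (cartan x - 1) * (cartan x - 1) + (4 : ℂ) • (raising y z * lowering y z) := by
  obtain ⟨-, h2, -⟩ := h.straighten
  simp only [raising, lowering, cartan, casimir, add_mul, sub_mul, mul_sub, mul_neg,
    neg_mul, smul_mul_assoc, mul_smul_comm, one_mul, mul_one, h2, smul_add, smul_sub,
    smul_smul]
  match_scalars <;> simp <;> ring_nf <;> simp

end Algebra

end RotationTriple

/-! ### Ladder monomials and weight decompositions. -/

/-- A commuting family in an algebra can be substituted into polynomials. -/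
theorem exists_algHom_of_commute {σ A : Type*} [Ring A] [Algebra ℂ A] (x : σ → A)
    (hx : ∀ i j, x i * x j = x j * x i) :
    ∃ Φ : MvPolynomial σ ℂ →ₐ[ℂ] A, ∀ i, Φ (MvPolynomial.X i) = x i := by
  have : IsMulCommutative (Algebra.adjoin ℂ (Set.range x)) :=
    Algebra.isMulCommutative_adjoin ℂ (by rintro _ ⟨i, rfl⟩ _ ⟨j, rfl⟩; exact hx i j)
  let _ : CommRing (Algebra.adjoin ℂ (Set.range x)) :=
    { (inferInstance : Ring (Algebra.adjoin ℂ (Set.range x))) with mul_comm := mul_comm' }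
  let y : σ → Algebra.adjoin ℂ (Set.range x) := fun i => ⟨x i, Algebra.subset_adjoin ⟨i, rfl⟩⟩
  let Ψ : MvPolynomial σ ℂ →ₐ[ℂ] Algebra.adjoin ℂ (Set.range x) := MvPolynomial.aeval y
  refine ⟨(Algebra.adjoin ℂ (Set.range x)).val.comp Ψ, fun i => ?_⟩
  exact congrArg Subtype.val (MvPolynomial.aeval_X y i)

/-- The integral powers `…, f ^ 2, f, 1, e, e ^ 2, …` of a raising and a lowering operator. -/
def ladder {A : Type*} [Monoid A] (e f : A) : ℤ → A
  | .ofNat n => e ^ n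
  | .negSucc n => f ^ (n + 1)

section Ladder

variable {A : Type*} [Ring A] [Algebra ℂ A]

omit [Algebra ℂ A] in
theorem ladder_neg (e f : A) (m : ℤ) : ladder f e (-m) = ladder e f m := by
  rcases m with (_ | n) | n
  · simp [ladder]
  · change ladder f e (Int.negSucc n) = _
    rfl
  · rfl

/-- At a negative index e meets a power of f, and e f is split off as a coefficient in `C`; at a
nonnegative index the coefficient is 1. -/
theorem mul_ladder (C : Subalgebra ℂ A) {e f : A} (hef : e * f ∈ C) (m : ℤ) :
    ∃ c ∈ C, e * ladder e f m = c * ladder e f (m + 1) := by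
  rcases m with n | n
  · refine ⟨1, C.one_mem, ?_⟩
    change e * e ^ n = 1 * e ^ (n + 1)
    rw [one_mul, pow_succ']
  · refine ⟨e * f, hef, ?_⟩
    change e * f ^ (n + 1) = _
    have : ladder e f (Int.negSucc n + 1) = f ^ n := by
      rcases n with _ | n
      · simp [ladder]
      · rfl
    rw [this, pow_succ', mul_assoc]

theorem mul_ladder' (C : Subalgebra ℂ A) {e f : A} (hfe : f * e ∈ C) (m : ℤ) :
    ∃ c ∈ C, f * ladder e f m = c * ladder e f (m - 1) := by
  -- Exchanging e and f reverses the ladder.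
  obtain ⟨c, hc, h⟩ := mul_ladder C hfe (-m)
  rw [ladder_neg, show -m + 1 = -(m - 1) by ring, ladder_neg] at h
  exact ⟨c, hc, h⟩

omit [Algebra ℂ A] in
theorem commute_ladder {a e f : A} (he : Commute a e) (hf : Commute a f) (m : ℤ) :
    Commute a (ladder e f m) := by
  rcases m with n | n
  · exact he.pow_right n
  · exact hf.pow_right _

theorem mul_pow_weight {h e : A} {w : ℂ} (he : h * e - e * h = w • e) (n : ℕ) :
    h * e ^ n - e ^ n * h = ((n : ℂ) * w) • e ^ n := by
  induction n with
  | zero => simp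
  | succ n ih =>
    have : h * e ^ (n + 1) - e ^ (n + 1) * h
        = (h * e ^ n - e ^ n * h) * e + e ^ n * (h * e - e * h) := by
      rw [pow_succ]; noncomm_ring
    rw [this, ih, he, smul_mul_assoc, mul_smul_comm, ← pow_succ, ← add_smul]
    push_cast
    ring_nf

theorem mul_ladder_weight {h e f : A} {w : ℂ} (he : h * e - e * h = w • e)
    (hf : h * f - f * h = (-w) • f) (m : ℤ) :
    h * ladder e f m - ladder e f m * h = ((m : ℂ) * w) • ladder e f m := by
  rcases m with n | n
  · exact mul_pow_weight he n
  · have := mul_pow_weight hf (n + 1)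
    change h * f ^ (n + 1) - f ^ (n + 1) * h = ((Int.negSucc n : ℤ) * w : ℂ) • f ^ (n + 1)
    rw [this]
    push_cast
    ring_nf

theorem mul_weight {h a b : A} {v w : ℂ} (ha : h * a - a * h = v • a)
    (hb : h * b - b * h = w • b) :
    h * (a * b) - (a * b) * h = (v + w) • (a * b) := by
  have : h * (a * b) - (a * b) * h = (h * a - a * h) * b + a * (h * b - b * h) := by
    noncomm_ring
  rw [this, ha, hb, smul_mul_assoc, mul_smul_comm, add_smul]

/-- If a subalgebra times a family of elements is stable under left multiplication by generators
of the algebra, then it is everything. -/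
theorem iSup_map_mulRight_eq_top {ι : Type*} (C : Subalgebra ℂ A) (L : ι → A) (i₀ : ι)
    (h₀ : L i₀ = 1) {s : Set A} (hs : Algebra.adjoin ℂ s = ⊤)
    (H : ∀ g ∈ s, ∀ c ∈ C, ∀ i, g * (c * L i) ∈
      ⨆ i, (Subalgebra.toSubmodule C).map (LinearMap.mulRight ℂ (L i))) :
    ⨆ i, (Subalgebra.toSubmodule C).map (LinearMap.mulRight ℂ (L i)) = ⊤ := by
  set S := ⨆ i, (Subalgebra.toSubmodule C).map (LinearMap.mulRight ℂ (L i)) with hS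
  have key : ∀ a : A, ∀ t ∈ S, a * t ∈ S := by
    intro a
    have ha : a ∈ Algebra.adjoin ℂ s := hs ▸ Algebra.mem_top
    induction ha using Algebra.adjoin_induction with
    | mem g hg =>
      intro t ht
      have : S ≤ S.comap (LinearMap.mulLeft ℂ g) := by
        refine iSup_le fun i => ?_
        rintro _ ⟨c, hc, rfl⟩
        exact H g hg c hc i
      exact this ht
    | algebraMap r =>
      intro t ht
      rw [← Algebra.smul_def]
      exact S.smul_mem r ht
    | add a b _ _ ha hb =>
      intro t ht
      rw [add_mul]
      exact S.add_mem (ha t ht) (hb t ht)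
    | mul a b _ _ ha hb =>
      intro t ht
      rw [mul_assoc]
      exact ha _ (hb t ht)
  rw [eq_top_iff]
  intro a _
  have h1 : (1 : A) ∈ S := by
    refine Submodule.mem_iSup_of_mem i₀ ⟨1, C.one_mem, ?_⟩
    simp [h₀]
  simpa using key a 1 h1

/-- An eigenvector lies in the summand with its own eigenvalue. -/
theorem mem_of_iSup_eq_top_of_eigen {ι M : Type*} [AddCommGroup M] [Module ℂ M]
    (D : Module.End ℂ M) (W : ι → Submodule ℂ M) (w : ι → ℂ) (hw : Function.Injective w)
    (hW : ∀ i, W i ≤ D.eigenspace (w i)) (htop : ⨆ i, W i = ⊤) (i₀ : ι) {v : M}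
    (hv : v ∈ D.eigenspace (w i₀)) : v ∈ W i₀ := by
  have hind := (Module.End.eigenspaces_iSupIndep D).comp hw
  have hle : (⊤ : Submodule ℂ M) ≤ W i₀ ⊔ ⨆ (i) (_ : i ≠ i₀), W i := by
    rw [← htop]
    refine iSup_le fun i => ?_
    by_cases h : i = i₀
    · exact h ▸ le_sup_left
    · exact (le_iSup₂_of_le (f := fun i (_ : i ≠ i₀) => W i) i h le_rfl).trans le_sup_right
  -- The remainder b is an eigenvector for `w i₀` that also lies in the sum of the other
  -- eigenspaces, so independence of eigenspaces forces it to vanish.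
  obtain ⟨a, ha, b, hb, hab⟩ := Submodule.mem_sup.1 (hle (Submodule.mem_top (x := v)))
  have hb1 : b ∈ D.eigenspace (w i₀) := by
    rw [eq_sub_of_add_eq' hab]
    exact Submodule.sub_mem _ hv (hW i₀ ha)
  have hb2 : b ∈ ⨆ (i) (_ : i ≠ i₀), D.eigenspace (w i) :=
    (iSup₂_mono fun i _ => hW i) hb
  have : b = 0 := by
    have := (hind i₀).le_bot ⟨hb1, hb2⟩
    simpa using this
  rw [← hab, this, add_zero]
  exact ha

end Ladder

/-- A one-variable polynomial taking the same value on an infinite arithmetic progression is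
constant. Applied to the variables 1 and 3 in turn, this removes both, for values a², b² of the
other two variables; over ℂ every value is a square. -/
theorem MvPolynomial.eq_bind_of_eval_periodic (P : MvPolynomial (Fin 4) ℂ)
    (h : ∀ (a b : ℂ) (k l : ℕ), MvPolynomial.eval ![a ^ 2, a - 1 - 2 * k, b ^ 2, b - 1 - 2 * l] P
      = MvPolynomial.eval ![a ^ 2, a - 1, b ^ 2, b - 1] P) (r : Fin 4 → ℂ) :
    MvPolynomial.eval r P = MvPolynomial.eval ![r 0, 0, r 2, 0] P := by
  have const : ∀ (p : Polynomial ℂ) (b c : ℂ), (∀ k : ℕ, p.eval (b - 2 * k) = c) →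
      ∀ t, p.eval t = c := by
    intro p b c hp t
    have : p = Polynomial.C c := by
      refine Polynomial.eq_of_infinite_eval_eq _ _ (Set.Infinite.mono ?_
        (Set.infinite_range_of_injective (f := fun k : ℕ => b - 2 * (k : ℂ)) ?_))
      · rintro _ ⟨k, rfl⟩
        simpa using hp k
      · intro k l hkl
        simpa using hkl
    rw [this, Polynomial.eval_C]
  have slice : ∀ (q : Fin 4 → Polynomial ℂ) (t : ℂ),
      (MvPolynomial.aeval q P).eval t = MvPolynomial.eval (fun i => (q i).eval t) P := by
    intro q t
    rw [MvPolynomial.aeval_def, ← Polynomial.coe_evalRingHom, MvPolynomial.hom_eval₂]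
    have : ((Polynomial.evalRingHom t).comp (algebraMap ℂ (Polynomial ℂ))) = RingHom.id ℂ := by
      ext; simp
    rw [this]
    rfl
  have main : ∀ a b s t : ℂ, MvPolynomial.eval ![a ^ 2, s, b ^ 2, t] P
      = MvPolynomial.eval ![a ^ 2, a - 1, b ^ 2, b - 1] P := by
    intro a b s t
    have step : ∀ (l : ℕ) (s : ℂ), MvPolynomial.eval ![a ^ 2, s, b ^ 2, b - 1 - 2 * l] P
        = MvPolynomial.eval ![a ^ 2, a - 1, b ^ 2, b - 1] P := by
      intro l s
      have e : ∀ u : ℂ, (MvPolynomial.aeval ![Polynomial.C (a ^ 2), Polynomial.X,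
          Polynomial.C (b ^ 2), Polynomial.C (b - 1 - 2 * l)] P).eval u
          = MvPolynomial.eval ![a ^ 2, u, b ^ 2, b - 1 - 2 * l] P := by
        intro u
        rw [slice]
        congr 2
        funext i
        fin_cases i <;> simp
      rw [← e]
      exact const _ (a - 1) _ (fun k => by rw [e]; exact h a b k l) s
    have e : ∀ u : ℂ, (MvPolynomial.aeval ![Polynomial.C (a ^ 2), Polynomial.C s,
        Polynomial.C (b ^ 2), Polynomial.X] P).eval u
        = MvPolynomial.eval ![a ^ 2, s, b ^ 2, u] P := by
      intro u
      rw [slice]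
      congr 2
      funext i
      fin_cases i <;> simp
    rw [← e]
    exact const _ (b - 1) _ (fun l => by rw [e]; exact step l s) t
  obtain ⟨a, ha⟩ := IsAlgClosed.exists_pow_nat_eq (r 0) (n := 2) (by norm_num)
  obtain ⟨b, hb⟩ := IsAlgClosed.exists_pow_nat_eq (r 2) (n := 2) (by norm_num)
  have hr : r = ![a ^ 2, r 1, b ^ 2, r 3] := by
    funext i
    fin_cases i <;> simp [ha, hb]
  rw [← ha, ← hb, main, hr, main]

section CommuteOperators
variable {A : Type*} [Ring A] [Algebra ℂ A] {a x y z : A}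

theorem commute_raising (hy : Commute a y) (hz : Commute a z) : Commute a (raising y z) :=
  hy.add_right (hz.smul_right _)

theorem commute_lowering (hy : Commute a y) (hz : Commute a z) : Commute a (lowering y z) :=
  (hy.sub_right (hz.smul_right _)).smul_right _

theorem commute_cartan (hx : Commute a x) : Commute a (cartan x) :=
  (hx.smul_right _).neg_right

omit [Algebra ℂ A] in
theorem commute_casimir (hx : Commute a x) (hy : Commute a y) (hz : Commute a z) :
    Commute a (casimir x y z) :=
  (Commute.one_right a).sub_right
    (((hx.mul_right hx).add_right (hy.mul_right hy)).add_right (hz.mul_right hz))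

end CommuteOperators

namespace RotationTriple
variable {A : Type*} [Ring A] [Algebra ℂ A] {x y z : A} (h : RotationTriple x y z)
include h

theorem casimir_comm_raising : Commute (casimir x y z) (raising y z) :=
  commute_raising h.casimir_comm_mid h.casimir_comm_right

theorem casimir_comm_lowering : Commute (casimir x y z) (lowering y z) :=
  commute_lowering h.casimir_comm_mid h.casimir_comm_right

theorem casimir_comm_cartan : Commute (casimir x y z) (cartan x) :=
  commute_cartan h.casimir_comm_left

theorem raising_weight : cartan x * raising y z - raising y z * cartan x
    = (2 : ℂ) • raising y z := by
  rw [h.raising_mul_cartan, sub_mul, smul_mul_assoc, one_mul, sub_sub_cancel]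

theorem lowering_weight : cartan x * lowering y z - lowering y z * cartan x
    = (-2 : ℂ) • lowering y z := by
  rw [h.lowering_mul_cartan, add_mul, smul_mul_assoc, one_mul, neg_smul]
  abel

variable {M : Type*} [AddCommGroup M] [Module ℂ M] (θ : A →ₐ[ℂ] Module.End ℂ M)

theorem casimir_apply_of_raising_eq_zero {v : M} {c : ℂ} (he : θ (raising y z) v = 0)
    (hv : θ (cartan x) v = (c - 1) • v) : θ (casimir x y z) v = c ^ 2 • v := by
  rw [h.casimir_eq_lowering_mul_raising]
  simp only [map_add, map_mul, map_smul, map_one, LinearMap.add_apply, Module.End.mul_apply,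
    LinearMap.smul_apply, Module.End.one_apply, he, hv, map_zero, smul_zero, add_zero]
  module

end RotationTriple

/-- An element of weight w shifts eigenvalues of h by w. The case w = 0 is used for the Casimir
elements. -/
theorem cartan_lowering_pow_apply {A M : Type*} [Ring A] [Algebra ℂ A] [AddCommGroup M]
    [Module ℂ M] (θ : A →ₐ[ℂ] Module.End ℂ M) {h a : A} {w c : ℂ} {v : M}
    (ha : h * a - a * h = w • a) (hv : θ h v = c • v) :
    θ h (θ a v) = (c + w) • θ a v := by
  rw [sub_eq_iff_eq_add] at ha
  rw [← Module.End.mul_apply, ← map_mul, ha, map_add, map_smul, map_mul, LinearMap.add_apply,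
    LinearMap.smul_apply, Module.End.mul_apply, hv, map_smul, ← add_smul, add_comm]

theorem MvPolynomial.algHom_apply_eigenvector {σ A M : Type*} [Ring A] [Algebra ℂ A]
    [AddCommGroup M] [Module ℂ M] (Φ : MvPolynomial σ ℂ →ₐ[ℂ] A) (θ : A →ₐ[ℂ] Module.End ℂ M)
    (r : σ → ℂ) {v : M} (hr : ∀ i, θ (Φ (MvPolynomial.X i)) v = r i • v)
    (P : MvPolynomial σ ℂ) : θ (Φ P) v = MvPolynomial.eval r P • v := by
  induction P using MvPolynomial.induction_on with
  | C a =>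
    have : (MvPolynomial.C a : MvPolynomial σ ℂ) = algebraMap ℂ _ a := rfl
    rw [this, AlgHom.commutes, AlgHom.commutes]
    simp [Module.algebraMap_end_apply]
  | add p q hp hq => simp [add_smul, hp, hq]
  | mul_X p i hp => 
    simp only [map_mul, Module.End.mul_apply, hr, map_smul, hp, MvPolynomial.eval_X, mul_smul]
    rw [smul_comm]

/-! ### The center of an algebra generated by two commuting rotation triples. -/

section Center

variable {A : Type*} [Ring A] [Algebra ℂ A] {x y z x' y' z' : A}

/-- Moving e to the right past a polynomial in Casimir and Cartan elements replaces it by another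
such polynomial. The property passes to sums and products, so it only has to be checked on the
variables, where it is a commutation or a shift by ±2. -/
theorem exists_twist {σ : Type*} (Φ : MvPolynomial σ ℂ →ₐ[ℂ] A) (e : A)
    (he : ∀ i, ∃ Q, e * Φ (MvPolynomial.X i) = Φ Q * e) (P : MvPolynomial σ ℂ) :
    ∃ Q, e * Φ P = Φ Q * e := by
  induction P using MvPolynomial.induction_on with
  | C a =>
    refine ⟨MvPolynomial.C a, ?_⟩
    have : (MvPolynomial.C a : MvPolynomial σ ℂ) = algebraMap ℂ _ a := rfl
    rw [this, AlgHom.commutes]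
    exact (Algebra.commutes a e).symm
  | add p q hp hq =>
    obtain ⟨p', hp⟩ := hp
    obtain ⟨q', hq⟩ := hq
    exact ⟨p' + q', by rw [map_add, mul_add, hp, hq, map_add, add_mul]⟩
  | mul_X p i hp =>
    obtain ⟨p', hp⟩ := hp
    obtain ⟨q, hq⟩ := he i
    exact ⟨p' * q, by rw [map_mul, ← mul_assoc, hp, mul_assoc, hq, map_mul, mul_assoc]⟩

/-- An element commuting with the Cartan elements of two commuting rotation triples that generate
the algebra is a polynomial in the Casimir and Cartan elements. -/
theorem exists_polynomial_of_mem_center (h1 : RotationTriple x y z)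
    (h2 : RotationTriple x' y' z')
    (hc : ∀ u ∈ ({x, y, z} : Set A), ∀ v ∈ ({x', y', z'} : Set A), Commute u v)
    (hgen : Algebra.adjoin ℂ ({x, y, z, x', y', z'} : Set A) = ⊤)
    (Φ : MvPolynomial (Fin 4) ℂ →ₐ[ℂ] A)
    (hΦ : ∀ i, Φ (MvPolynomial.X i)
      = ![casimir x y z, cartan x, casimir x' y' z', cartan x'] i)
    {w : A} (hw : w ∈ Subalgebra.center ℂ A) : ∃ P, w = Φ P := by
  simp only [Set.mem_insert_iff, Set.mem_singleton_iff, forall_eq_or_imp, forall_eq] at hc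
  obtain ⟨⟨c11, c12, c13⟩, ⟨c21, c22, c23⟩, ⟨c31, c32, c33⟩⟩ := hc
  set e := raising y z with he
  set f := lowering y z with hf
  set e' := raising y' z' with he'
  set f' := lowering y' z' with hf'
  have Φ0 : Φ (MvPolynomial.X 0) = casimir x y z := by simpa using hΦ 0
  have Φ1 : Φ (MvPolynomial.X 1) = cartan x := by simpa using hΦ 1
  have Φ2 : Φ (MvPolynomial.X 2) = casimir x' y' z' := by simpa using hΦ 2
  have Φ3 : Φ (MvPolynomial.X 3) = cartan x' := by simpa using hΦ 3
  have xe' : Commute x e' := commute_raising c12 c13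
  have ye' : Commute y e' := commute_raising c22 c23
  have ze' : Commute z e' := commute_raising c32 c33
  have xf' : Commute x f' := commute_lowering c12 c13
  have yf' : Commute y f' := commute_lowering c22 c23
  have zf' : Commute z f' := commute_lowering c32 c33
  have x'e : Commute x' e := commute_raising c21.symm c31.symm
  have y'e : Commute y' e := commute_raising c22.symm c32.symm
  have z'e : Commute z' e := commute_raising c23.symm c33.symm
  have x'f : Commute x' f := commute_lowering c21.symm c31.symm
  have y'f : Commute y' f := commute_lowering c22.symm c32.symm
  have z'f : Commute z' f := commute_lowering c23.symm c33.symm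
  -- C is the algebra of polynomials in the Casimir and Cartan elements. It contains e f and f e,
  -- and likewise for the second triple, because the Casimir is (h - 1)² + 4ef = (h + 1)² + 4fe.
  let C := Φ.range
  have hX : ∀ P, Φ P ∈ C := fun P => ⟨P, rfl⟩
  have ef : e * f ∈ C := by
    refine ⟨(1 / 4 : ℂ) • (MvPolynomial.X 0 - (MvPolynomial.X 1 - 1) * (MvPolynomial.X 1 - 1)), ?_⟩
    simp only [AlgHom.toRingHom_eq_coe, RingHom.coe_coe, map_smul, map_sub, map_mul, map_one, Φ0,
      Φ1, h1.casimir_eq_raising_mul_lowering]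
    module
  have fe : f * e ∈ C := by
    refine ⟨(1 / 4 : ℂ) • (MvPolynomial.X 0 - (MvPolynomial.X 1 + 1) * (MvPolynomial.X 1 + 1)), ?_⟩
    simp only [AlgHom.toRingHom_eq_coe, RingHom.coe_coe, map_smul, map_sub, map_add, map_mul,
      map_one, Φ0, Φ1, h1.casimir_eq_lowering_mul_raising]
    module
  have ef' : e' * f' ∈ C := by
    refine ⟨(1 / 4 : ℂ) • (MvPolynomial.X 2 - (MvPolynomial.X 3 - 1) * (MvPolynomial.X 3 - 1)), ?_⟩
    simp only [AlgHom.toRingHom_eq_coe, RingHom.coe_coe, map_smul, map_sub, map_mul, map_one, Φ2,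
      Φ3, h2.casimir_eq_raising_mul_lowering]
    module
  have fe' : f' * e' ∈ C := by
    refine ⟨(1 / 4 : ℂ) • (MvPolynomial.X 2 - (MvPolynomial.X 3 + 1) * (MvPolynomial.X 3 + 1)), ?_⟩
    simp only [AlgHom.toRingHom_eq_coe, RingHom.coe_coe, map_smul, map_sub, map_add, map_mul,
      map_one, Φ2, Φ3, h2.casimir_eq_lowering_mul_raising]
    module
  have two : ∀ i : Fin 4, Φ (MvPolynomial.X i - (2 : ℂ) • 1) = Φ (MvPolynomial.X i) - (2 : ℂ) • 1 ∧
      Φ (MvPolynomial.X i + (2 : ℂ) • 1) = Φ (MvPolynomial.X i) + (2 : ℂ) • 1 := by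
    intro i
    simp only [map_sub, map_add, map_smul, map_one, and_self]
  have te : ∀ P, ∃ Q, e * Φ P = Φ Q * e := by
    refine exists_twist Φ e fun i => ?_
    fin_cases i
    · exact ⟨MvPolynomial.X 0, by
        change e * Φ (MvPolynomial.X 0) = _
        rw [Φ0]; exact h1.casimir_comm_raising.symm⟩
    · exact ⟨MvPolynomial.X 1 - (2 : ℂ) • 1, by
        change e * Φ (MvPolynomial.X 1) = _
        rw [(two 1).1, Φ1]; exact h1.raising_mul_cartan⟩
    · exact ⟨MvPolynomial.X 2, by
        change e * Φ (MvPolynomial.X 2) = _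
        rw [Φ2]; exact commute_casimir x'e.symm y'e.symm z'e.symm⟩
    · exact ⟨MvPolynomial.X 3, by
        change e * Φ (MvPolynomial.X 3) = _
        rw [Φ3]; exact commute_cartan x'e.symm⟩
  have tf : ∀ P, ∃ Q, f * Φ P = Φ Q * f := by
    refine exists_twist Φ f fun i => ?_
    fin_cases i
    · exact ⟨MvPolynomial.X 0, by
        change f * Φ (MvPolynomial.X 0) = _
        rw [Φ0]; exact h1.casimir_comm_lowering.symm⟩
    · exact ⟨MvPolynomial.X 1 + (2 : ℂ) • 1, by
        change f * Φ (MvPolynomial.X 1) = _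
        rw [(two 1).2, Φ1]; exact h1.lowering_mul_cartan⟩
    · exact ⟨MvPolynomial.X 2, by
        change f * Φ (MvPolynomial.X 2) = _
        rw [Φ2]; exact commute_casimir x'f.symm y'f.symm z'f.symm⟩
    · exact ⟨MvPolynomial.X 3, by
        change f * Φ (MvPolynomial.X 3) = _
        rw [Φ3]; exact commute_cartan x'f.symm⟩
  have te' : ∀ P, ∃ Q, e' * Φ P = Φ Q * e' := by
    refine exists_twist Φ e' fun i => ?_
    fin_cases i
    · exact ⟨MvPolynomial.X 0, by
        change e' * Φ (MvPolynomial.X 0) = _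
        rw [Φ0]; exact commute_casimir xe'.symm ye'.symm ze'.symm⟩
    · exact ⟨MvPolynomial.X 1, by
        change e' * Φ (MvPolynomial.X 1) = _
        rw [Φ1]; exact commute_cartan xe'.symm⟩
    · exact ⟨MvPolynomial.X 2, by
        change e' * Φ (MvPolynomial.X 2) = _
        rw [Φ2]; exact h2.casimir_comm_raising.symm⟩
    · exact ⟨MvPolynomial.X 3 - (2 : ℂ) • 1, by
        change e' * Φ (MvPolynomial.X 3) = _
        rw [(two 3).1, Φ3]; exact h2.raising_mul_cartan⟩
  have tf' : ∀ P, ∃ Q, f' * Φ P = Φ Q * f' := by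
    refine exists_twist Φ f' fun i => ?_
    fin_cases i
    · exact ⟨MvPolynomial.X 0, by
        change f' * Φ (MvPolynomial.X 0) = _
        rw [Φ0]; exact commute_casimir xf'.symm yf'.symm zf'.symm⟩
    · exact ⟨MvPolynomial.X 1, by
        change f' * Φ (MvPolynomial.X 1) = _
        rw [Φ1]; exact commute_cartan xf'.symm⟩
    · exact ⟨MvPolynomial.X 2, by
        change f' * Φ (MvPolynomial.X 2) = _
        rw [Φ2]; exact h2.casimir_comm_lowering.symm⟩
    · exact ⟨MvPolynomial.X 3 + (2 : ℂ) • 1, by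
        change f' * Φ (MvPolynomial.X 3) = _
        rw [(two 3).2, Φ3]; exact h2.lowering_mul_cartan⟩
  -- The subspaces C · L(p) replace a PBW basis. Only their spanning is proved by hand: a generator
  -- passes C by twisting and then moves the ladder by one step. No linear independence inside them
  -- is needed.
  let L : ℤ × ℤ → A := fun p => ladder e f p.1 * ladder e' f' p.2
  let W : ℤ × ℤ → Submodule ℂ A := fun p =>
    (Subalgebra.toSubmodule C).map (LinearMap.mulRight ℂ (L p))
  have hL : ∀ p, L p = ladder e' f' p.2 * ladder e f p.1 := fun p =>
    commute_ladder (commute_ladder (commute_raising y'e.symm z'e.symm)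
      (commute_lowering y'e.symm z'e.symm) _).symm
      (commute_ladder (commute_raising y'f.symm z'f.symm)
      (commute_lowering y'f.symm z'f.symm) _).symm _ |>.symm
  have hW : ∀ c ∈ C, ∀ p, c * L p ∈ W p := fun c hc p => ⟨c, hc, rfl⟩
  have hgen' : Algebra.adjoin ℂ ({e, f, cartan x, e', f', cartan x'} : Set A) = ⊤ := by
    rw [eq_top_iff, ← hgen, Algebra.adjoin_le_iff]
    set S := Algebra.adjoin ℂ ({e, f, cartan x, e', f', cartan x'} : Set A) with hS
    have hsub : ({e, f, cartan x, e', f', cartan x'} : Set A) ⊆ S := Algebra.subset_adjoin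
    simp only [Set.insert_subset_iff, Set.singleton_subset_iff, SetLike.mem_coe] at hsub ⊢
    obtain ⟨s1, s2, s3, s4, s5, s6⟩ := hsub
    have ex : ∀ {x : A}, cartan x ∈ S → x ∈ S := by
      intro x hx
      have : x = Complex.I • cartan x := by
        rw [cartan, smul_neg, smul_smul, Complex.I_mul_I, neg_smul, one_smul, neg_neg]
      rw [this]; exact S.smul_mem hx _
    have ey : ∀ {y z : A}, raising y z ∈ S → lowering y z ∈ S → y ∈ S := by
      intro y z h h'
      have : y = (1 / 2 : ℂ) • raising y z - (2 : ℂ) • lowering y z := by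
        rw [raising, lowering]; module
      rw [this]; exact S.sub_mem (S.smul_mem h _) (S.smul_mem h' _)
    have ez : ∀ {y z : A}, raising y z ∈ S → lowering y z ∈ S → z ∈ S := by
      intro y z h h'
      have : z = (-(1 / 2) * Complex.I) • (raising y z + (4 : ℂ) • lowering y z) := by
        rw [raising, lowering]
        match_scalars <;> simp <;> ring_nf <;> simp
      rw [this]; exact S.smul_mem (S.add_mem h (S.smul_mem h' _)) _
    exact ⟨ex s3, ey s1 s2, ez s1 s2, ex s6, ey s4 s5, ez s4 s5⟩
  have htop : ⨆ p, W p = ⊤ := by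
    refine iSup_map_mulRight_eq_top C L (0, 0) (by simp [L, ladder]) hgen' ?_
    have step : ∀ (g : A) (p q : ℤ × ℤ), (∀ P, ∃ Q, g * Φ P = Φ Q * g) →
        (∃ c ∈ C, g * L p = c * L q) → ∀ c ∈ C, g * (c * L p) ∈ ⨆ p, W p := by
      rintro g p q hg ⟨c', hc', hgp⟩ _ ⟨P, rfl⟩
      obtain ⟨Q, hQ⟩ := hg P
      have hQ' : g * (Φ : MvPolynomial (Fin 4) ℂ →+* A) P = Φ Q * g := hQ
      refine Submodule.mem_iSup_of_mem q ?_
      have : g * ((Φ : MvPolynomial (Fin 4) ℂ →+* A) P * L p) = (Φ Q * c') * L q := by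
        rw [← mul_assoc, hQ', mul_assoc, hgp, ← mul_assoc]
      exact this ▸ hW _ (C.mul_mem (hX Q) hc') q
    have assoc : ∀ {g a a' b c : A}, g * a = c * a' → g * (a * b) = c * (a' * b) := by
      intro g a a' b c h
      rw [← mul_assoc, h, mul_assoc]
    simp only [Set.mem_insert_iff, Set.mem_singleton_iff, forall_eq_or_imp, forall_eq]
    refine ⟨fun c hc p => ?_, fun c hc p => ?_, fun c hc p => ?_, fun c hc p => ?_,
      fun c hc p => ?_, fun c hc p => ?_⟩
    · obtain ⟨d, hd, h⟩ := mul_ladder C ef p.1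
      exact step e p (p.1 + 1, p.2) te ⟨d, hd, assoc h⟩ c hc
    · obtain ⟨d, hd, h⟩ := mul_ladder' C fe p.1
      exact step f p (p.1 - 1, p.2) tf ⟨d, hd, assoc h⟩ c hc
    · rw [← mul_assoc]
      exact Submodule.mem_iSup_of_mem p (hW _ (C.mul_mem (Φ1 ▸ hX _) hc) p)
    · obtain ⟨d, hd, h⟩ := mul_ladder C ef' p.2
      exact step e' p (p.1, p.2 + 1) te' ⟨d, hd, by rw [hL, hL]; exact assoc h⟩ c hc
    · obtain ⟨d, hd, h⟩ := mul_ladder' C fe' p.2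
      exact step f' p (p.1, p.2 - 1) tf' ⟨d, hd, by rw [hL, hL]; exact assoc h⟩ c hc
    · rw [← mul_assoc]
      exact Submodule.mem_iSup_of_mem p (hW _ (C.mul_mem (Φ3 ▸ hX _) hc) p)
  -- The two integral weights are packed into one Gaussian integer, so the single operator [d, ·]
  -- separates the whole ℤ × ℤ grading.
  let d := cartan x + Complex.I • cartan x'
  have dweight : ∀ {a : A} {s t : ℂ}, cartan x * a - a * cartan x = s • a →
      cartan x' * a - a * cartan x' = t • a → d * a - a * d = (s + t * Complex.I) • a := by
    intro a s t hs ht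
    have : d * a - a * d = (cartan x * a - a * cartan x)
        + Complex.I • (cartan x' * a - a * cartan x') := by
      simp only [d, add_mul, mul_add, smul_mul_assoc, mul_smul_comm, smul_sub]
      abel
    rw [this, hs, ht, smul_smul, ← add_smul, mul_comm Complex.I]
  have zero_of_comm : ∀ {a b : A}, Commute a b → b * a - a * b = (0 : ℂ) • a := by
    intro a b h
    rw [zero_smul, h.eq, sub_self]
  have we := dweight h1.raising_weight (zero_of_comm (commute_cartan x'e.symm))
  have wf := dweight h1.lowering_weight (zero_of_comm (commute_cartan x'f.symm))
  have we' := dweight (zero_of_comm (commute_cartan xe'.symm)) h2.raising_weight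
  have wf' := dweight (zero_of_comm (commute_cartan xf'.symm)) h2.lowering_weight
  let D : Module.End ℂ A := LinearMap.mulLeft ℂ d - LinearMap.mulRight ℂ d
  have hD : ∀ (a : A) (s : ℂ), a ∈ D.eigenspace s ↔ d * a - a * d = s • a := by
    intro a s
    rw [Module.End.mem_eigenspace_iff]
    rfl
  have hWD : ∀ p, W p ≤ D.eigenspace (2 * ((p.1 : ℂ) + p.2 * Complex.I)) := by
    rintro p _ ⟨c, ⟨P, rfl⟩, rfl⟩
    rw [hD]
    have hP : d * Φ P - Φ P * d = (0 : ℂ) • Φ P := by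
      refine zero_of_comm ?_
      have : d = Φ (MvPolynomial.X 1 + Complex.I • MvPolynomial.X 3) := by
        rw [map_add, map_smul, Φ1, Φ3]
      rw [this]
      exact (Commute.all P _).map Φ
    have := mul_weight hP (mul_weight (mul_ladder_weight we (by rw [wf]; congr 1; ring) p.1)
      (mul_ladder_weight we' (by rw [wf']; congr 1; ring) p.2))
    refine this.trans ?_
    rw [show (0 : ℂ) + (p.1 * (2 + 0 * Complex.I) + p.2 * (0 + 2 * Complex.I))
      = 2 * ((p.1 : ℂ) + p.2 * Complex.I) by ring]
    rfl
  have hinj : Function.Injective fun p : ℤ × ℤ => 2 * ((p.1 : ℂ) + p.2 * Complex.I) := by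
    rintro ⟨p, q⟩ ⟨p', q'⟩ h
    have h' : ((p : ℂ) + q * Complex.I) = (p' : ℂ) + q' * Complex.I :=
      mul_left_cancel₀ two_ne_zero h
    have h1 := congrArg Complex.re h'
    have h2 := congrArg Complex.im h'
    simp at h1 h2
    rw [h1, h2]
  -- A central element has weight zero, so it lies in the summand at (0, 0), where the ladder
  -- monomial is 1 and only a polynomial in C remains.
  have hw0 : w ∈ D.eigenspace ((fun p : ℤ × ℤ => 2 * ((p.1 : ℂ) + p.2 * Complex.I)) (0, 0)) := by
    rw [hD, Subalgebra.mem_center_iff.1 hw d]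
    simp
  obtain ⟨c, ⟨P, rfl⟩, hP⟩ := mem_of_iSup_eq_top_of_eigen D W _ hinj hWD htop (0, 0) hw0
  refine ⟨P, ?_⟩
  rw [← hP]
  simp [L, ladder]

/-- The center of an algebra generated by two commuting rotation triples and having sufficiently
many Verma modules is generated by the two Casimir elements. -/
theorem mem_adjoin_casimir_of_mem_center (h1 : RotationTriple x y z)
    (h2 : RotationTriple x' y' z')
    (hc : ∀ u ∈ ({x, y, z} : Set A), ∀ v ∈ ({x', y', z'} : Set A), Commute u v)
    (hgen : Algebra.adjoin ℂ ({x, y, z, x', y', z'} : Set A) = ⊤)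
    (hV : ∀ a b : ℂ, ∃ (M : Type) (_ : AddCommGroup M) (_ : Module ℂ M)
      (θ : A →ₐ[ℂ] Module.End ℂ M) (v : M), θ (raising y z) v = 0 ∧ θ (raising y' z') v = 0 ∧
        θ (cartan x) v = (a - 1) • v ∧ θ (cartan x') v = (b - 1) • v ∧
        ∀ k l : ℕ, θ (lowering y z ^ k * lowering y' z' ^ l) v ≠ 0)
    {w : A} (hw : w ∈ Subalgebra.center ℂ A) :
    w ∈ Algebra.adjoin ℂ ({casimir x y z, casimir x' y' z'} : Set A) := by
  have hc' := hc
  simp only [Set.mem_insert_iff, Set.mem_singleton_iff, forall_eq_or_imp, forall_eq] at hc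
  obtain ⟨⟨c11, c12, c13⟩, ⟨c21, c22, c23⟩, ⟨c31, c32, c33⟩⟩ := hc
  have cxO : Commute x (casimir x' y' z') := commute_casimir c11 c12 c13
  have cyO : Commute y (casimir x' y' z') := commute_casimir c21 c22 c23
  have czO : Commute z (casimir x' y' z') := commute_casimir c31 c32 c33
  have cOx : Commute x' (casimir x y z) := commute_casimir c11.symm c21.symm c31.symm
  have cOy : Commute y' (casimir x y z) := commute_casimir c12.symm c22.symm c32.symm
  have cOz : Commute z' (casimir x y z) := commute_casimir c13.symm c23.symm c33.symm
  obtain ⟨Φ, hΦ⟩ := exists_algHom_of_commute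
    ![casimir x y z, cartan x, casimir x' y' z', cartan x'] (by
      have e01 : Commute (casimir x y z) (cartan x) := h1.casimir_comm_cartan
      have e02 : Commute (casimir x y z) (casimir x' y' z') :=
        (commute_casimir cxO.symm cyO.symm czO.symm).symm
      have e03 : Commute (casimir x y z) (cartan x') := commute_cartan cOx.symm
      have e12 : Commute (cartan x) (casimir x' y' z') := (commute_cartan cxO.symm).symm
      have e13 : Commute (cartan x) (cartan x') := commute_cartan (commute_cartan c11.symm).symm
      have e23 : Commute (casimir x' y' z') (cartan x') := h2.casimir_comm_cartan
      intro i j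
      fin_cases i <;> fin_cases j
      exacts [rfl, e01, e02, e03, e01.symm, rfl, e12, e13, e02.symm, e12.symm, rfl, e23,
        e03.symm, e13.symm, e23.symm, rfl])
  obtain ⟨P, rfl⟩ := exists_polynomial_of_mem_center h1 h2 hc' hgen Φ hΦ hw
  have Φ0 : Φ (MvPolynomial.X 0) = casimir x y z := by simpa using hΦ 0
  have Φ2 : Φ (MvPolynomial.X 2) = casimir x' y' z' := by simpa using hΦ 2
  -- On a highest weight vector v the central element is P at the weights of v. On f^k f'^l v, which
  -- is nonzero, the Casimir values are unchanged and the Cartan weights drop by 2k and 2l.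
  -- Centrality makes the two scalars equal.
  have hper : ∀ (a b : ℂ) (k l : ℕ),
      MvPolynomial.eval ![a ^ 2, a - 1 - 2 * k, b ^ 2, b - 1 - 2 * l] P
        = MvPolynomial.eval ![a ^ 2, a - 1, b ^ 2, b - 1] P := by
    intro a b k l
    obtain ⟨M, _, _, θ, v, he, he', hh, hh', hne⟩ := hV a b
    set F := lowering y z ^ k * lowering y' z' ^ l with hF
    have hO := h1.casimir_apply_of_raising_eq_zero θ he hh
    have hO' := h2.casimir_apply_of_raising_eq_zero θ he' hh'
    have zero_of_comm : ∀ {a b : A}, Commute a b → b * a - a * b = (0 : ℂ) • a := by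
      intro a b h
      rw [zero_smul, h.eq, sub_self]
    have yl : Commute y (lowering y' z') := commute_lowering c22 c23
    have zl : Commute z (lowering y' z') := commute_lowering c32 c33
    have xl : Commute x (lowering y' z') := commute_lowering c12 c13
    have x'l : Commute x' (lowering y z) := commute_lowering c21.symm c31.symm
    have F0 : casimir x y z * F - F * casimir x y z = (0 : ℂ) • F :=
      zero_of_comm ((h1.casimir_comm_lowering.pow_right k).mul_right
        ((commute_lowering cOy.symm cOz.symm).pow_right l)).symm
    have F2 : casimir x' y' z' * F - F * casimir x' y' z' = (0 : ℂ) • F :=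
      zero_of_comm (((commute_lowering cyO.symm czO.symm).pow_right k).mul_right
        (h2.casimir_comm_lowering.pow_right l)).symm
    have F1 : cartan x * F - F * cartan x = ((k : ℂ) * (-2) + 0) • F :=
      mul_weight (mul_pow_weight h1.lowering_weight k)
        (zero_of_comm (commute_cartan (xl.symm.pow_left l)))
    have F3 : cartan x' * F - F * cartan x' = (0 + (l : ℂ) * (-2)) • F :=
      mul_weight (zero_of_comm (commute_cartan (x'l.symm.pow_left k)))
        (mul_pow_weight h2.lowering_weight l)
    have E0 := MvPolynomial.algHom_apply_eigenvector Φ θ ![a ^ 2, a - 1, b ^ 2, b - 1] (v := v)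
      (by
        intro i
        rw [hΦ]
        fin_cases i
        exacts [hO, hh, hO', hh']) P
    have E1 := MvPolynomial.algHom_apply_eigenvector Φ θ
      ![a ^ 2, a - 1 - 2 * k, b ^ 2, b - 1 - 2 * l] (v := θ F v)
      (by
        intro i
        rw [hΦ]
        fin_cases i
        · refine (cartan_lowering_pow_apply θ F0 hO).trans ?_
          rw [add_zero]; rfl
        · refine (cartan_lowering_pow_apply θ F1 hh).trans ?_
          congr 1
          simp
          ring
        · refine (cartan_lowering_pow_apply θ F2 hO').trans ?_
          rw [add_zero]; rfl
        · refine (cartan_lowering_pow_apply θ F3 hh').trans ?_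
          congr 1
          simp
          ring) P
    have hcomm := Subalgebra.mem_center_iff.1 hw F
    rw [← Module.End.mul_apply, ← map_mul, ← hcomm, map_mul, Module.End.mul_apply, E0,
      map_smul] at E1
    exact (smul_left_injective ℂ (hne k l) E1).symm
  -- P does not depend on the Cartan variables, so they may be set to any value; 0 is taken.
  have hP : P = MvPolynomial.bind₁ ![MvPolynomial.X 0, 0, MvPolynomial.X 2, 0] P := by
    refine MvPolynomial.funext fun r => ?_
    rw [MvPolynomial.eq_bind_of_eval_periodic P hper r]
    refine Eq.trans ?_ (MvPolynomial.eval₂Hom_bind₁ (RingHom.id ℂ) r _ P).symm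
    change MvPolynomial.eval _ P = MvPolynomial.eval _ P
    congr 2
    funext i
    fin_cases i <;> simp
  have hmem : ∀ Q, Φ (MvPolynomial.bind₁ ![MvPolynomial.X 0, 0, MvPolynomial.X 2, 0] Q) ∈
      Algebra.adjoin ℂ ({casimir x y z, casimir x' y' z'} : Set A) := by
    intro Q
    induction Q using MvPolynomial.induction_on with
    | C a =>
      have : (MvPolynomial.C a : MvPolynomial (Fin 4) ℂ) = algebraMap ℂ _ a := rfl
      rw [this, AlgHom.commutes, AlgHom.commutes]
      exact Subalgebra.algebraMap_mem _ a
    | add p q hp hq => rw [map_add, map_add]; exact add_mem hp hq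
    | mul_X p i hp =>
      rw [map_mul, map_mul]
      refine mul_mem hp ?_
      rw [MvPolynomial.bind₁_X_right]
      fin_cases i
      · change Φ (MvPolynomial.X 0) ∈ _
        rw [Φ0]; exact Algebra.subset_adjoin (by simp)
      · simp
      · change Φ (MvPolynomial.X 2) ∈ _
        rw [Φ2]; exact Algebra.subset_adjoin (by simp)
      · simp
  rw [hP]
  exact hmem P

end Center

/-! ### Rotation triples in Lie algebras and the homomorphisms they determine. -/

section LieTriple

/-- Three elements of a Lie algebra satisfying the relations of a rotation triple. -/
structure LieRotationTriple {L : Type*} [LieRing L] (x y z : L) : Prop where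
  xy : ⁅x, y⁆ = -(z + z)
  yz : ⁅y, z⁆ = -(x + x)
  zx : ⁅z, x⁆ = -(y + y)

variable {L A : Type*} [LieRing L] [LieAlgebra ℂ L] [Ring A] [Algebra ℂ A]

theorem LieRotationTriple.map {x y z : L} (h : LieRotationTriple x y z) (f : L →ₗ⁅ℂ⁆ A) :
    RotationTriple (f x) (f y) (f z) := by
  refine ⟨?_, ?_, ?_⟩
  · rw [← LieRing.of_associative_ring_bracket, ← LieHom.map_lie, h.xy, two_mul]; simp
  · rw [← LieRing.of_associative_ring_bracket, ← LieHom.map_lie, h.yz, two_mul]; simp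
  · rw [← LieRing.of_associative_ring_bracket, ← LieHom.map_lie, h.zx, two_mul]; simp

/-- The Lie algebra homomorphism determined by a rotation triple in an algebra. -/
def RotationTriple.lieHom {x y z : A} (h : RotationTriple x y z) (α β γ : L →ₗ[ℂ] ℂ)
    (hα : ∀ a b, α ⁅a, b⁆ = γ a * β b - β a * γ b)
    (hβ : ∀ a b, β ⁅a, b⁆ = α a * γ b - γ a * α b)
    (hγ : ∀ a b, γ ⁅a, b⁆ = β a * α b - α a * β b) : L →ₗ⁅ℂ⁆ A :=
  { (1 / 2 : ℂ) • (α.smulRight x + β.smulRight y + γ.smulRight z) with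
    map_lie' := by
      intro a b
      obtain ⟨h1, h2, h3⟩ := h.straighten
      simp only [AddHom.toFun_eq_coe, LinearMap.coe_toAddHom, LinearMap.smul_apply,
        LinearMap.add_apply, LinearMap.smulRight_apply, hα, hβ, hγ,
        LieRing.of_associative_ring_bracket, smul_mul_assoc, mul_smul_comm, add_mul, mul_add,
        h1, h2, h3, smul_add, smul_sub]
      module }

end LieTriple

/-! ### Verma modules of sl(2) realized on polynomials. -/

section Verma
open Polynomial

/-- The raising operator of the Verma module of highest weight `μ`, realized on polynomials. -/
def vermaRaising (μ : ℂ) : Module.End ℂ ℂ[X] :=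
  μ • derivative - LinearMap.mulLeft ℂ X ∘ₗ derivative ∘ₗ derivative

/-- The lowering operator of a Verma module. -/
def vermaLowering : Module.End ℂ ℂ[X] := LinearMap.mulLeft ℂ X

/-- The Cartan operator of the Verma module of highest weight `μ`. -/
def vermaCartan (μ : ℂ) : Module.End ℂ ℂ[X] :=
  μ • LinearMap.id - (2 : ℂ) • (LinearMap.mulLeft ℂ X ∘ₗ derivative)

theorem vermaCartan_mul_raising (μ : ℂ) : vermaCartan μ * vermaRaising μ
    = vermaRaising μ * vermaCartan μ + (2 : ℂ) • vermaRaising μ := by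
  refine LinearMap.ext fun p => ?_
  simp only [vermaCartan, vermaRaising, Module.End.mul_apply, LinearMap.sub_apply,
    LinearMap.add_apply, LinearMap.smul_apply, LinearMap.comp_apply, LinearMap.mulLeft_apply,
    LinearMap.id_apply, derivative_sub, derivative_mul, derivative_X, smul_eq_C_mul,
    map_ofNat, derivative_C, derivative_add, derivative_one, derivative_zero, derivative_ofNat]
  ring

theorem vermaCartan_mul_lowering (μ : ℂ) : vermaCartan μ * vermaLowering
    = vermaLowering * vermaCartan μ - (2 : ℂ) • vermaLowering := by
  refine LinearMap.ext fun p => ?_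
  simp only [vermaCartan, vermaLowering, Module.End.mul_apply, LinearMap.sub_apply,
    LinearMap.smul_apply, LinearMap.comp_apply, LinearMap.mulLeft_apply,
    LinearMap.id_apply, derivative_mul, derivative_X, smul_eq_C_mul, map_ofNat]
  ring

theorem vermaRaising_mul_lowering (μ : ℂ) : vermaRaising μ * vermaLowering
    = vermaLowering * vermaRaising μ + vermaCartan μ := by
  refine LinearMap.ext fun p => ?_
  simp only [vermaCartan, vermaRaising, vermaLowering, Module.End.mul_apply, LinearMap.sub_apply,
    LinearMap.add_apply, LinearMap.smul_apply, LinearMap.comp_apply, LinearMap.mulLeft_apply,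
    LinearMap.id_apply, derivative_mul, derivative_X, smul_eq_C_mul, map_ofNat, derivative_add,
    derivative_one]
  ring

/-- The rotation triple acting on the Verma module of highest weight `μ`. -/
def vermaX (μ : ℂ) : Module.End ℂ ℂ[X] := Complex.I • vermaCartan μ

/-- The rotation triple acting on the Verma module of highest weight `μ`. -/
def vermaY (μ : ℂ) : Module.End ℂ ℂ[X] :=
  (1 / 2 : ℂ) • (vermaRaising μ - (4 : ℂ) • vermaLowering)

/-- The rotation triple acting on the Verma module of highest weight `μ`. -/
def vermaZ (μ : ℂ) : Module.End ℂ ℂ[X] :=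
  (-(1 / 2) * Complex.I) • (vermaRaising μ + (4 : ℂ) • vermaLowering)

/-- The operators solve e = y + iz, f = -(y - iz)/4, h = -ix for x, y, z, so the relations are those
of e, f, h rewritten. -/
theorem rotationTriple_verma (μ : ℂ) : RotationTriple (vermaX μ) (vermaY μ) (vermaZ μ) := by
  have h1 := vermaCartan_mul_raising μ
  have h2 := vermaCartan_mul_lowering μ
  have h3 := vermaRaising_mul_lowering μ
  refine ⟨?_, ?_, ?_⟩ <;>
  · simp only [vermaX, vermaY, vermaZ, add_mul, mul_add, sub_mul, mul_sub, smul_mul_assoc,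
      mul_smul_comm, h1, h2, h3, two_mul]
    match_scalars <;> ring_nf <;> simp

theorem cartan_verma (μ : ℂ) : cartan (vermaX μ) = vermaCartan μ := by
  simp [cartan, vermaX, smul_smul]

theorem raising_verma (μ : ℂ) : raising (vermaY μ) (vermaZ μ) = vermaRaising μ := by
  rw [raising, vermaY, vermaZ]
  match_scalars <;> ring_nf <;> simp <;> norm_num

theorem lowering_verma (μ : ℂ) : lowering (vermaY μ) (vermaZ μ) = vermaLowering := by
  rw [lowering, vermaY, vermaZ]
  match_scalars <;> ring_nf <;> simp <;> norm_num

theorem vermaRaising_one (μ : ℂ) : vermaRaising μ 1 = 0 := by simp [vermaRaising]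

theorem vermaCartan_one (μ : ℂ) : vermaCartan μ 1 = μ • 1 := by simp [vermaCartan]

theorem vermaLowering_pow_one (k : ℕ) : (vermaLowering ^ k) 1 = X ^ k := by
  induction k with
  | zero => simp
  | succ k ih =>
    rw [pow_succ', Module.End.mul_apply, ih, pow_succ']
    rfl

end Verma

section MapOperators
variable {A B : Type*} [Ring A] [Algebra ℂ A] [Ring B] [Algebra ℂ B] (θ : A →ₐ[ℂ] B) (x y z : A)

theorem map_raising : θ (raising y z) = raising (θ y) (θ z) := by simp [raising]
theorem map_lowering : θ (lowering y z) = lowering (θ y) (θ z) := by simp [lowering]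
theorem map_cartan : θ (cartan x) = cartan (θ x) := by simp [cartan]
theorem map_casimir : θ (casimir x y z) = casimir (θ x) (θ y) (θ z) := by simp [casimir]

end MapOperators

/-! ### Verma ideals, central characters and generators of enveloping algebras. -/

section Ideal
variable {L : Type*} [LieRing L] [LieAlgebra ℂ L]

/-- The annihilator of a highest weight vector is a left ideal containing the generators of the
Verma ideal. With a nonzero vector this shows that the Verma ideal is proper. -/
theorem lift_apply_of_mem_vermaIdeal {V : Type*} [AddCommGroup V] [Module ℂ V]
    (ρ : L →ₗ⁅ℂ⁆ Module.End ℂ V) {n : Set L} {h : Set (L × ℂ)} {v : V}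
    (hn : ∀ x ∈ n, ρ x v = 0) (hh : ∀ p ∈ h, ρ p.1 v = p.2 • v) {a : Envelope L}
    (ha : a ∈ vermaIdeal n h) : UniversalEnvelopingAlgebra.lift ℂ ρ a v = 0 := by
  induction ha using Submodule.span_induction with
  | mem a ha =>
    rcases ha with ⟨x, hx, rfl⟩ | ⟨p, hp, rfl⟩
    · rw [UniversalEnvelopingAlgebra.lift_ι_apply]; exact hn x hx
    · rw [map_sub, UniversalEnvelopingAlgebra.lift_ι_apply, AlgHom.commutes, LinearMap.sub_apply,
        hh p hp, Module.algebraMap_end_apply, sub_self]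
  | zero => simp
  | add a b _ _ ha hb => rw [map_add, LinearMap.add_apply, ha, hb, add_zero]
  | smul r a _ ha => rw [smul_eq_mul, map_mul, Module.End.mul_apply, ha, map_zero]

/-- The defining property of the central character determines it, provided the Verma module is
nonzero. -/
theorem centralCharacter_eq {J : Ideal (Envelope L)} (hJ : (1 : Envelope L) ∉ J)
    {z : EnvelopeCenter L} {c : ℂ} (hc : (z : Envelope L) - algebraMap ℂ (Envelope L) c ∈ J) :
    centralCharacter J z = c := by
  have h : (z : Envelope L) - algebraMap ℂ (Envelope L) (centralCharacter J z) ∈ J :=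
    Classical.epsilon_spec (p := fun c : ℂ => (z : Envelope L) - algebraMap ℂ (Envelope L) c ∈ J)
      ⟨c, hc⟩
  by_contra hne
  refine hJ ?_
  have h1 := J.sub_mem hc h
  rw [sub_sub_sub_cancel_left, ← map_sub] at h1
  have h2 := J.mul_mem_left (algebraMap ℂ (Envelope L) (centralCharacter J z - c)⁻¹) h1
  rwa [← map_mul, inv_mul_cancel₀ (sub_ne_zero.2 hne), map_one] at h2

/-- Since the Casimir is (h + 1)² + 4fe, its difference with c² is (h + 1 + c)(h - (c - 1)) + 4fe.
Both right-hand factors lie in the left ideal J. -/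
theorem RotationTriple.casimir_sub_mem {A : Type*} [Ring A] [Algebra ℂ A] {x y z : A}
    (h : RotationTriple x y z) (J : Ideal A) {c : ℂ} (he : raising y z ∈ J)
    (hx : cartan x - algebraMap ℂ A (c - 1) ∈ J) :
    casimir x y z - algebraMap ℂ A (c ^ 2) ∈ J := by
  have : casimir x y z - algebraMap ℂ A (c ^ 2)
      = (cartan x + 1 + algebraMap ℂ A c) * (cartan x - algebraMap ℂ A (c - 1))
        + ((4 : ℂ) • lowering y z) * raising y z := by
    rw [h.casimir_eq_lowering_mul_raising]
    simp only [Algebra.algebraMap_eq_smul_one, add_mul, mul_sub, smul_mul_assoc, mul_smul_comm,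
      mul_add, one_mul, mul_one]
    module
  rw [this]
  exact J.add_mem (J.mul_mem_left _ hx) (J.mul_mem_left _ he)

/-- By the universal property, the lift of L into the subalgebra generated by its image, followed by
the inclusion, is the identity. -/
theorem UniversalEnvelopingAlgebra.adjoin_range_ι :
    Algebra.adjoin ℂ (Set.range (UniversalEnvelopingAlgebra.ι ℂ : L → Envelope L)) = ⊤ := by
  set S := Algebra.adjoin ℂ (Set.range (UniversalEnvelopingAlgebra.ι ℂ : L → Envelope L)) with hS
  let f : L →ₗ⁅ℂ⁆ S :=
    { toFun := fun x => ⟨UniversalEnvelopingAlgebra.ι ℂ x, Algebra.subset_adjoin ⟨x, rfl⟩⟩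
      map_add' := fun x y => Subtype.ext (map_add (UniversalEnvelopingAlgebra.ι ℂ) x y)
      map_smul' := fun c x => Subtype.ext (map_smul (UniversalEnvelopingAlgebra.ι ℂ) c x)
      map_lie' := fun {x y} => Subtype.ext (LieHom.map_lie (UniversalEnvelopingAlgebra.ι ℂ) x y) }
  have h : S.val.comp (UniversalEnvelopingAlgebra.lift ℂ f) = AlgHom.id ℂ (Envelope L) := by
    apply UniversalEnvelopingAlgebra.hom_ext
    ext x
    simp [f]
  rw [eq_top_iff]
  intro a _
  have := DFunLike.congr_fun h a
  rw [AlgHom.id_apply] at this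
  rw [← this]
  exact (UniversalEnvelopingAlgebra.lift ℂ f a).2

theorem mem_center_of_adjoin_eq_top {A : Type*} [Ring A] [Algebra ℂ A] {s : Set A}
    (hs : Algebra.adjoin ℂ s = ⊤) {z : A} (hz : ∀ a ∈ s, Commute a z) :
    z ∈ Subalgebra.center ℂ A := by
  rw [Subalgebra.mem_center_iff]
  intro b
  have hb : b ∈ Algebra.adjoin ℂ s := hs ▸ Algebra.mem_top
  have : Commute b z := by
    induction hb using Algebra.adjoin_induction with
    | mem g hg => exact hz g hg
    | algebraMap r => exact Algebra.commutes r z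
    | add a b _ _ ha hb => exact ha.add_left hb
    | mul a b _ _ ha hb => exact ha.mul_left hb
  exact this

end Ideal

/-! ### The matrices of o(3) and o(4), and the splitting of o(4) into two ideals. -/

section SkewMatrices

/-- The elementary skew-symmetric matrices. -/
def elemSkew {n : ℕ} (a b : Fin n) : SO n := wedge (Pi.single a 1) (Pi.single b 1)

theorem elemSkew_apply {n : ℕ} (a b i j : Fin n) :
    (elemSkew a b : Matrix (Fin n) (Fin n) ℂ) i j
      = (if i = a ∧ j = b then 1 else 0) - (if i = b ∧ j = a then 1 else 0) := by
  simp [elemSkew, wedge, Matrix.vecMulVec_apply, Pi.single_apply, ite_and]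
  split_ifs <;> rfl

theorem SO.apply_swap {n : ℕ} (A : SO n) (i j : Fin n) : A.1 j i = -A.1 i j := by
  have h := (LieAlgebra.Orthogonal.mem_so (Fin n) ℂ A.1).1 A.2
  exact congrFun (congrFun h i) j

theorem SO.apply_self {n : ℕ} (A : SO n) (i : Fin n) : A.1 i i = 0 :=
  self_eq_neg.1 (SO.apply_swap A i i)

theorem SO.ext_of_lt {n : ℕ} {A B : SO n} (h : ∀ i j, i < j → A.1 i j = B.1 i j) : A = B := by
  refine Subtype.ext (Matrix.ext fun i j => ?_)
  rcases lt_trichotomy i j with hij | rfl | hij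
  · exact h i j hij
  · rw [SO.apply_self, SO.apply_self]
  · rw [SO.apply_swap A j i, SO.apply_swap B j i, h j i hij]

theorem SO.ext_three {A B : SO 3} (h01 : A.1 0 1 = B.1 0 1) (h02 : A.1 0 2 = B.1 0 2)
    (h12 : A.1 1 2 = B.1 1 2) : A = B := by
  refine SO.ext_of_lt fun i j hij => ?_
  fin_cases i <;> fin_cases j <;> first | assumption | (exact absurd hij (by decide))

theorem SO.ext_four {A B : SO 4} (h01 : A.1 0 1 = B.1 0 1) (h02 : A.1 0 2 = B.1 0 2)
    (h03 : A.1 0 3 = B.1 0 3) (h12 : A.1 1 2 = B.1 1 2) (h13 : A.1 1 3 = B.1 1 3)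
    (h23 : A.1 2 3 = B.1 2 3) : A = B := by
  refine SO.ext_of_lt fun i j hij => ?_
  fin_cases i <;> fin_cases j <;> first | assumption | (exact absurd hij (by decide))

theorem SO.add_apply {n : ℕ} (A B : SO n) (i j : Fin n) : (A + B).1 i j = A.1 i j + B.1 i j := rfl
theorem SO.sub_apply {n : ℕ} (A B : SO n) (i j : Fin n) : (A - B).1 i j = A.1 i j - B.1 i j := rfl
theorem SO.neg_apply {n : ℕ} (A : SO n) (i j : Fin n) : (-A).1 i j = -A.1 i j := rfl
theorem SO.zero_apply {n : ℕ} (i j : Fin n) : (0 : SO n).1 i j = 0 := rfl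
theorem SO.smul_apply {n : ℕ} (c : ℂ) (A : SO n) (i j : Fin n) : (c • A).1 i j = c * A.1 i j := rfl
theorem SO.lie_apply {n : ℕ} (A B : SO n) (i j : Fin n) :
    ⁅A, B⁆.1 i j = ∑ k, A.1 i k * B.1 k j - ∑ k, B.1 i k * A.1 k j := rfl
theorem SO.wedge_apply {n : ℕ} (a b : Fin n → ℂ) (i j : Fin n) :
    (wedge a b).1 i j = a i * b j - b i * a j := rfl

/-- An entry of a skew-symmetric matrix, as a linear form. -/
def SO.entry {n : ℕ} (i j : Fin n) : SO n →ₗ[ℂ] ℂ where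
  toFun A := A.1 i j
  map_add' _ _ := rfl
  map_smul' _ _ := rfl

theorem SO.entry_apply {n : ℕ} (i j : Fin n) (A : SO n) : SO.entry i j A = A.1 i j := rfl

/-- The first member of the (anti-)self-dual rotation triple of `o(4)`. -/
def fourX (s : ℂ) : SO 4 := elemSkew 0 1 + s • elemSkew 2 3
/-- The second member of the (anti-)self-dual rotation triple of `o(4)`. -/
def fourY (s : ℂ) : SO 4 := elemSkew 0 2 - s • elemSkew 1 3
/-- The third member of the (anti-)self-dual rotation triple of `o(4)`. -/
def fourZ (s : ℂ) : SO 4 := elemSkew 1 2 + s • elemSkew 0 3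

/-- The brackets produce coefficients 1 and s², which have to agree. The two solutions s = 1 and s =
-1 give the two ideals of o(4). -/
theorem lieRotationTriple_four {s : ℂ} (hs : s * s = 1) :
    LieRotationTriple (fourX s) (fourY s) (fourZ s) := by
  refine ⟨?_, ?_, ?_⟩ <;> refine SO.ext_four ?_ ?_ ?_ ?_ ?_ ?_ <;>
    simp [fourX, fourY, fourZ, SO.lie_apply, SO.add_apply, SO.sub_apply, SO.neg_apply,
      SO.smul_apply, elemSkew_apply] <;>
    first | ring1 | linear_combination hs | linear_combination -hs

theorem four_lie_four {a b : SO 4} (ha : a ∈ ({fourX 1, fourY 1, fourZ 1} : Set (SO 4)))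
    (hb : b ∈ ({fourX (-1), fourY (-1), fourZ (-1)} : Set (SO 4))) : ⁅a, b⁆ = 0 := by
  simp only [Set.mem_insert_iff, Set.mem_singleton_iff] at ha hb
  rcases ha with rfl | rfl | rfl <;> rcases hb with rfl | rfl | rfl <;>
  refine SO.ext_four ?_ ?_ ?_ ?_ ?_ ?_ <;>
    simp [fourX, fourY, fourZ, SO.lie_apply, SO.add_apply, SO.sub_apply,
      elemSkew_apply, SO.zero_apply]

/-- Doubling the elementary matrices turns [E₀₁, E₀₂] = -E₁₂ and its rotations into the triple
relations. It also matches the sums of the s = 1 and s = -1 triples of o(4), where the entries in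
the last row and column cancel. -/
theorem lieRotationTriple_three : LieRotationTriple ((2 : ℂ) • elemSkew (n := 3) 0 1)
    ((2 : ℂ) • elemSkew 0 2) ((2 : ℂ) • elemSkew 1 2) := by
  refine ⟨?_, ?_, ?_⟩ <;> refine SO.ext_three ?_ ?_ ?_ <;>
    simp [SO.lie_apply, SO.add_apply, SO.neg_apply,
      SO.smul_apply, elemSkew_apply] <;> norm_num

theorem SO.four_eq (A : SO 4) : A = (1 / 2 : ℂ) • ((A.1 0 1 + A.1 2 3) • fourX 1
    + (A.1 0 2 - A.1 1 3) • fourY 1 + (A.1 1 2 + A.1 0 3) • fourZ 1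
    + (A.1 0 1 - A.1 2 3) • fourX (-1) + (A.1 0 2 + A.1 1 3) • fourY (-1)
    + (A.1 1 2 - A.1 0 3) • fourZ (-1)) := by
  refine SO.ext_four ?_ ?_ ?_ ?_ ?_ ?_ <;>
    simp [fourX, fourY, fourZ, SO.add_apply, SO.sub_apply,
      SO.smul_apply, elemSkew_apply] <;> ring

variable {A : Type*} [Ring A] [Algebra ℂ A]

/-- The representation of `o(3)` given by a rotation triple. -/
def RotationTriple.threeHom {x y z : A} (h : RotationTriple x y z) : SO 3 →ₗ⁅ℂ⁆ A :=
  h.lieHom (SO.entry 0 1) (SO.entry 0 2) (SO.entry 1 2)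
    (fun a b => by
      simp only [SO.entry_apply, SO.lie_apply, Fin.sum_univ_three, SO.apply_self,
        SO.apply_swap a 0 1, SO.apply_swap a 0 2, SO.apply_swap a 1 2,
        SO.apply_swap b 0 1, SO.apply_swap b 0 2, SO.apply_swap b 1 2]
      ring)
    (fun a b => by
      simp only [SO.entry_apply, SO.lie_apply, Fin.sum_univ_three, SO.apply_self,
        SO.apply_swap a 0 1, SO.apply_swap a 0 2, SO.apply_swap a 1 2,
        SO.apply_swap b 0 1, SO.apply_swap b 0 2, SO.apply_swap b 1 2]
      ring)
    (fun a b => by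
      simp only [SO.entry_apply, SO.lie_apply, Fin.sum_univ_three, SO.apply_self,
        SO.apply_swap a 0 1, SO.apply_swap a 0 2, SO.apply_swap a 1 2,
        SO.apply_swap b 0 1, SO.apply_swap b 0 2, SO.apply_swap b 1 2]
      ring)

/-- The representation of `o(4)` given by a rotation triple, through one of the two projections
of `o(4)` onto `o(3)`. -/
def RotationTriple.fourHom {x y z : A} (h : RotationTriple x y z) {s : ℂ} (hs : s * s = 1) :
    SO 4 →ₗ⁅ℂ⁆ A :=
  h.lieHom (SO.entry 0 1 + s • SO.entry 2 3) (SO.entry 0 2 - s • SO.entry 1 3)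
    (SO.entry 1 2 + s • SO.entry 0 3)
    (fun a b => by
      simp only [SO.entry_apply, SO.lie_apply, Fin.sum_univ_four, SO.apply_self,
        SO.apply_swap a 0 1, SO.apply_swap a 0 2, SO.apply_swap a 1 2, SO.apply_swap a 0 3,
        SO.apply_swap a 1 3, SO.apply_swap a 2 3, LinearMap.add_apply, LinearMap.smul_apply,
        SO.apply_swap b 0 1, SO.apply_swap b 0 2, SO.apply_swap b 1 2, SO.apply_swap b 0 3,
        SO.apply_swap b 1 3, SO.apply_swap b 2 3, LinearMap.sub_apply, smul_eq_mul]
      linear_combination (a.1 0 3 * b.1 1 3 - a.1 1 3 * b.1 0 3) * hs)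
    (fun a b => by
      simp only [SO.entry_apply, SO.lie_apply, Fin.sum_univ_four, SO.apply_self,
        SO.apply_swap a 0 1, SO.apply_swap a 0 2, SO.apply_swap a 1 2, SO.apply_swap a 0 3,
        SO.apply_swap a 1 3, SO.apply_swap a 2 3, LinearMap.add_apply, LinearMap.smul_apply,
        SO.apply_swap b 0 1, SO.apply_swap b 0 2, SO.apply_swap b 1 2, SO.apply_swap b 0 3,
        SO.apply_swap b 1 3, SO.apply_swap b 2 3, LinearMap.sub_apply, smul_eq_mul]
      linear_combination (a.1 0 3 * b.1 2 3 - a.1 2 3 * b.1 0 3) * hs)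
    (fun a b => by
      simp only [SO.entry_apply, SO.lie_apply, Fin.sum_univ_four, SO.apply_self,
        SO.apply_swap a 0 1, SO.apply_swap a 0 2, SO.apply_swap a 1 2, SO.apply_swap a 0 3,
        SO.apply_swap a 1 3, SO.apply_swap a 2 3, LinearMap.add_apply, LinearMap.smul_apply,
        SO.apply_swap b 0 1, SO.apply_swap b 0 2, SO.apply_swap b 1 2, SO.apply_swap b 0 3,
        SO.apply_swap b 1 3, SO.apply_swap b 2 3, LinearMap.sub_apply, smul_eq_mul]
      linear_combination (a.1 1 3 * b.1 2 3 - a.1 2 3 * b.1 1 3) * hs)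

theorem RotationTriple.threeHom_apply {x y z : A} (h : RotationTriple x y z) (a : SO 3) :
    h.threeHom a = (1 / 2 : ℂ) • (a.1 0 1 • x + a.1 0 2 • y + a.1 1 2 • z) := rfl

theorem RotationTriple.fourHom_apply {x y z : A} (h : RotationTriple x y z) {s : ℂ}
    (hs : s * s = 1) (a : SO 4) : h.fourHom hs a = (1 / 2 : ℂ) • ((a.1 0 1 + s * a.1 2 3) • x
      + (a.1 0 2 - s * a.1 1 3) • y + (a.1 1 2 + s * a.1 0 3) • z) := rfl

/-- For s, t = ±1 the factor (1 + st)/2 is 1 when s = t and 0 otherwise: the homomorphism sees one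
ideal and kills the other. -/
theorem RotationTriple.fourHom_fourX {x y z : A} (h : RotationTriple x y z) {s : ℂ}
    (hs : s * s = 1) (t : ℂ) : h.fourHom hs (fourX t) = ((1 + s * t) / 2) • x ∧
      h.fourHom hs (fourY t) = ((1 + s * t) / 2) • y ∧
      h.fourHom hs (fourZ t) = ((1 + s * t) / 2) • z := by
  simp only [RotationTriple.fourHom_apply]
  refine ⟨?_, ?_, ?_⟩ <;>
  · simp [fourX, fourY, fourZ, SO.add_apply, SO.sub_apply, SO.smul_apply, elemSkew_apply]
    module

end SkewMatrices

/-- The generators of the enveloping algebra of `o(n)`. -/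
abbrev envι {n : ℕ} : SO n →ₗ⁅ℂ⁆ Envelope (SO n) := UniversalEnvelopingAlgebra.ι ℂ

section Lift

variable {L V : Type*} [LieRing L] [LieAlgebra ℂ L] [AddCommGroup V] [Module ℂ V]
  (ρ : L →ₗ⁅ℂ⁆ Module.End ℂ V)

theorem lift_raising (y z : L) : UniversalEnvelopingAlgebra.lift ℂ ρ
    (raising (UniversalEnvelopingAlgebra.ι ℂ y) (UniversalEnvelopingAlgebra.ι ℂ z))
      = raising (ρ y) (ρ z) := by
  rw [map_raising, UniversalEnvelopingAlgebra.lift_ι_apply, UniversalEnvelopingAlgebra.lift_ι_apply]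

theorem lift_lowering (y z : L) : UniversalEnvelopingAlgebra.lift ℂ ρ
    (lowering (UniversalEnvelopingAlgebra.ι ℂ y) (UniversalEnvelopingAlgebra.ι ℂ z))
      = lowering (ρ y) (ρ z) := by
  rw [map_lowering, UniversalEnvelopingAlgebra.lift_ι_apply,
    UniversalEnvelopingAlgebra.lift_ι_apply]

theorem lift_cartan (x : L) : UniversalEnvelopingAlgebra.lift ℂ ρ
    (cartan (UniversalEnvelopingAlgebra.ι ℂ x)) = cartan (ρ x) := by
  rw [map_cartan, UniversalEnvelopingAlgebra.lift_ι_apply]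

theorem lift_casimir (x y z : L) : UniversalEnvelopingAlgebra.lift ℂ ρ
    (casimir (UniversalEnvelopingAlgebra.ι ℂ x) (UniversalEnvelopingAlgebra.ι ℂ y)
      (UniversalEnvelopingAlgebra.ι ℂ z)) = casimir (ρ x) (ρ y) (ρ z) := by
  rw [map_casimir, UniversalEnvelopingAlgebra.lift_ι_apply,
    UniversalEnvelopingAlgebra.lift_ι_apply, UniversalEnvelopingAlgebra.lift_ι_apply]

end Lift

/-! ### Verma modules of o(4) as exterior tensor products. -/

section VermaFour
open Polynomial

theorem one_mul_one_complex : (1 : ℂ) * 1 = 1 := one_mul 1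
theorem neg_one_mul_neg_one_complex : (-1 : ℂ) * -1 = 1 := by norm_num

/-- The exterior tensor product of two Verma modules, as a representation of `o(4)`. -/
def vermaFour (a b : ℂ) : SO 4 →ₗ⁅ℂ⁆ Module.End ℂ (ℂ[X] ⊗[ℂ] ℂ[X]) :=
  tensorAction ((rotationTriple_verma (a - 1)).fourHom one_mul_one_complex)
    ((rotationTriple_verma (b - 1)).fourHom neg_one_mul_neg_one_complex)

theorem vermaFour_apply (a b : ℂ) (A : SO 4) : vermaFour a b A
    = ((rotationTriple_verma (a - 1)).fourHom one_mul_one_complex A).rTensor ℂ[X]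
      + ((rotationTriple_verma (b - 1)).fourHom neg_one_mul_neg_one_complex A).lTensor ℂ[X] := rfl

theorem vermaFour_one (a b : ℂ) :
    vermaFour a b (fourX 1) = (vermaX (a - 1)).rTensor ℂ[X] ∧
    vermaFour a b (fourY 1) = (vermaY (a - 1)).rTensor ℂ[X] ∧
    vermaFour a b (fourZ 1) = (vermaZ (a - 1)).rTensor ℂ[X] := by
  obtain ⟨h1, h2, h3⟩ := (rotationTriple_verma (a - 1)).fourHom_fourX one_mul_one_complex 1
  obtain ⟨k1, k2, k3⟩ := (rotationTriple_verma (b - 1)).fourHom_fourX neg_one_mul_neg_one_complex 1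
  simp only [vermaFour_apply, h1, h2, h3, k1, k2, k3]
  norm_num

theorem vermaFour_neg_one (a b : ℂ) :
    vermaFour a b (fourX (-1)) = (vermaX (b - 1)).lTensor ℂ[X] ∧
    vermaFour a b (fourY (-1)) = (vermaY (b - 1)).lTensor ℂ[X] ∧
    vermaFour a b (fourZ (-1)) = (vermaZ (b - 1)).lTensor ℂ[X] := by
  obtain ⟨h1, h2, h3⟩ := (rotationTriple_verma (a - 1)).fourHom_fourX one_mul_one_complex (-1)
  obtain ⟨k1, k2, k3⟩ :=
    (rotationTriple_verma (b - 1)).fourHom_fourX neg_one_mul_neg_one_complex (-1)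
  simp only [vermaFour_apply, h1, h2, h3, k1, k2, k3]
  norm_num

theorem rTensor_raising {V W : Type*} [AddCommGroup V] [Module ℂ V] [AddCommGroup W] [Module ℂ W]
    (x y z : Module.End ℂ V) :
    raising (y.rTensor W) (z.rTensor W) = (raising y z).rTensor W ∧
    lowering (y.rTensor W) (z.rTensor W) = (lowering y z).rTensor W ∧
    cartan (x.rTensor W) = (cartan x).rTensor W := by
  simp [raising, lowering, cartan, LinearMap.rTensor_add, LinearMap.rTensor_sub,
    LinearMap.rTensor_smul, LinearMap.rTensor_neg]

theorem lTensor_raising {V W : Type*} [AddCommGroup V] [Module ℂ V] [AddCommGroup W] [Module ℂ W]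
    (x y z : Module.End ℂ W) :
    raising (y.lTensor V) (z.lTensor V) = (raising y z).lTensor V ∧
    lowering (y.lTensor V) (z.lTensor V) = (lowering y z).lTensor V ∧
    cartan (x.lTensor V) = (cartan x).lTensor V := by
  simp [raising, lowering, cartan, LinearMap.lTensor_add, LinearMap.lTensor_sub,
    LinearMap.lTensor_smul, LinearMap.lTensor_neg]

theorem X_pow_tmul_X_pow_ne_zero (k l : ℕ) : (X ^ k : ℂ[X]) ⊗ₜ[ℂ] (X ^ l : ℂ[X]) ≠ 0 := by
  intro h
  have := congrArg (TensorProduct.lid ℂ ℂ ∘ₗ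
    TensorProduct.map (lcoeff ℂ k) (lcoeff ℂ l) : ℂ[X] ⊗[ℂ] ℂ[X] →ₗ[ℂ] ℂ) h
  simp at this

/-- Both lowering operators are multiplications by X, so the lowered vectors are X^k ⊗ X^l, nonzero
for every highest weight, including the reducible cases. The data serve both to compute the center
and to show that the Verma ideals are proper. -/
theorem vermaFour_highestWeight (a b : ℂ) :
    let θ := UniversalEnvelopingAlgebra.lift ℂ (vermaFour a b)
    let v : ℂ[X] ⊗[ℂ] ℂ[X] := 1 ⊗ₜ 1
    θ (raising (envι (fourY 1)) (envι (fourZ 1))) v = 0 ∧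
    θ (raising (envι (fourY (-1))) (envι (fourZ (-1)))) v = 0 ∧
    θ (cartan (envι (fourX 1))) v = (a - 1) • v ∧
    θ (cartan (envι (fourX (-1)))) v = (b - 1) • v ∧
    ∀ k l : ℕ, θ (lowering (envι (fourY 1)) (envι (fourZ 1)) ^ k *
      lowering (envι (fourY (-1))) (envι (fourZ (-1))) ^ l) v ≠ 0 := by
  intro θ v
  obtain ⟨h1, h2, h3⟩ := vermaFour_one a b
  obtain ⟨k1, k2, k3⟩ := vermaFour_neg_one a b
  obtain ⟨r1, r2, r3⟩ := rTensor_raising (W := ℂ[X]) (vermaX (a - 1)) (vermaY (a - 1)) (vermaZ (a - 1))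
  obtain ⟨l1, l2, l3⟩ := lTensor_raising (V := ℂ[X]) (vermaX (b - 1)) (vermaY (b - 1)) (vermaZ (b - 1))
  refine ⟨?_, ?_, ?_, ?_, fun k l => ?_⟩
  · refine (LinearMap.congr_fun (lift_raising _ _ _) v).trans ?_
    rw [h2, h3, r1, LinearMap.rTensor_tmul, raising_verma, vermaRaising_one,
      TensorProduct.zero_tmul]
  · refine (LinearMap.congr_fun (lift_raising _ _ _) v).trans ?_
    rw [k2, k3, l1, LinearMap.lTensor_tmul, raising_verma, vermaRaising_one,
      TensorProduct.tmul_zero]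
  · refine (LinearMap.congr_fun (lift_cartan _ _) v).trans ?_
    rw [h1, r3, LinearMap.rTensor_tmul, cartan_verma, vermaCartan_one, TensorProduct.smul_tmul']
  · refine (LinearMap.congr_fun (lift_cartan _ _) v).trans ?_
    rw [k1, l3, LinearMap.lTensor_tmul, cartan_verma, vermaCartan_one, TensorProduct.tmul_smul]
  · have e1 : θ (lowering (envι (fourY 1)) (envι (fourZ 1)))
        = vermaLowering.rTensor ℂ[X] := by
      refine (lift_lowering _ _ _).trans ?_
      rw [h2, h3, r2, lowering_verma]
    have e2 : θ (lowering (envι (fourY (-1))) (envι (fourZ (-1))))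
        = vermaLowering.lTensor ℂ[X] := by
      refine (lift_lowering _ _ _).trans ?_
      rw [k2, k3, l2, lowering_verma]
    rw [map_mul, map_pow, map_pow, e1, e2, LinearMap.rTensor_pow, LinearMap.lTensor_pow,
      Module.End.mul_apply, LinearMap.lTensor_tmul, LinearMap.rTensor_tmul, vermaLowering_pow_one,
      vermaLowering_pow_one]
    exact X_pow_tmul_X_pow_ne_zero k l

end VermaFour

/-! ### The center of U(o(4)). -/

section Center

theorem rotationTriple_four {s : ℂ} (hs : s * s = 1) :
    RotationTriple (envι (fourX s)) (envι (fourY s)) (envι (fourZ s)) :=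
  (lieRotationTriple_four hs).map envι

theorem commute_of_lie_eq_zero {L A : Type*} [LieRing L] [LieAlgebra ℂ L] [Ring A] [Algebra ℂ A]
    (f : L →ₗ⁅ℂ⁆ A) {a b : L} (h : ⁅a, b⁆ = 0) : Commute (f a) (f b) := by
  have := LieHom.map_lie f a b
  rw [h, map_zero, LieRing.of_associative_ring_bracket] at this
  exact (sub_eq_zero.1 this.symm)

theorem commute_four {A : Type*} [Ring A] [Algebra ℂ A] (f : SO 4 →ₗ⁅ℂ⁆ A) :
    ∀ u ∈ ({f (fourX 1), f (fourY 1), f (fourZ 1)} : Set A),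
    ∀ v ∈ ({f (fourX (-1)), f (fourY (-1)), f (fourZ (-1))} : Set A), Commute u v := by
  have h : ∀ a ∈ ({fourX 1, fourY 1, fourZ 1} : Set (SO 4)),
      ∀ b ∈ ({fourX (-1), fourY (-1), fourZ (-1)} : Set (SO 4)), Commute (f a) (f b) :=
    fun a ha b hb => commute_of_lie_eq_zero f (four_lie_four ha hb)
  simpa only [Set.mem_insert_iff, Set.mem_singleton_iff, forall_eq_or_imp, forall_eq] using h

theorem adjoin_four : Algebra.adjoin ℂ ({envι (fourX 1), envι (fourY 1), envι (fourZ 1),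
    envι (fourX (-1)), envι (fourY (-1)), envι (fourZ (-1))} : Set (Envelope (SO 4))) = ⊤ := by
  rw [eq_top_iff, ← UniversalEnvelopingAlgebra.adjoin_range_ι, Algebra.adjoin_le_iff]
  rintro _ ⟨A, rfl⟩
  set S := Algebra.adjoin ℂ ({envι (fourX 1), envι (fourY 1), envι (fourZ 1),
    envι (fourX (-1)), envι (fourY (-1)), envι (fourZ (-1))} : Set (Envelope (SO 4))) with hS
  have hsub : ({envι (fourX 1), envι (fourY 1), envι (fourZ 1),
    envι (fourX (-1)), envι (fourY (-1)), envι (fourZ (-1))} : Set (Envelope (SO 4))) ⊆ S :=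
    Algebra.subset_adjoin
  simp only [Set.insert_subset_iff, Set.singleton_subset_iff, SetLike.mem_coe] at hsub ⊢
  obtain ⟨s1, s2, s3, s4, s5, s6⟩ := hsub
  rw [SO.four_eq A]
  simp only [map_smul, map_add]
  exact S.smul_mem (S.add_mem (S.add_mem (S.add_mem (S.add_mem (S.add_mem (S.smul_mem s1 _)
    (S.smul_mem s2 _)) (S.smul_mem s3 _)) (S.smul_mem s4 _)) (S.smul_mem s5 _))
    (S.smul_mem s6 _)) _

/-- The Casimir element of one of the two ideals of `o(4)`. -/
def casimirFour (s : ℂ) : Envelope (SO 4) :=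
  casimir (envι (fourX s)) (envι (fourY s)) (envι (fourZ s))

theorem casimirFour_one_mem : casimirFour 1 ∈ EnvelopeCenter (SO 4) := by
  refine mem_center_of_adjoin_eq_top adjoin_four ?_
  have h := rotationTriple_four one_mul_one_complex
  have hc := commute_four envι
  simp only [Set.mem_insert_iff, Set.mem_singleton_iff, forall_eq_or_imp, forall_eq] at hc ⊢
  obtain ⟨⟨c11, c12, c13⟩, ⟨c21, c22, c23⟩, ⟨c31, c32, c33⟩⟩ := hc
  exact ⟨h.casimir_comm_left.symm, h.casimir_comm_mid.symm, h.casimir_comm_right.symm,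
    commute_casimir c11.symm c21.symm c31.symm, commute_casimir c12.symm c22.symm c32.symm,
    commute_casimir c13.symm c23.symm c33.symm⟩

theorem casimirFour_neg_one_mem : casimirFour (-1) ∈ EnvelopeCenter (SO 4) := by
  refine mem_center_of_adjoin_eq_top adjoin_four ?_
  have h := rotationTriple_four neg_one_mul_neg_one_complex
  have hc := commute_four envι
  simp only [Set.mem_insert_iff, Set.mem_singleton_iff, forall_eq_or_imp, forall_eq] at hc ⊢
  obtain ⟨⟨c11, c12, c13⟩, ⟨c21, c22, c23⟩, ⟨c31, c32, c33⟩⟩ := hc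
  exact ⟨commute_casimir c11 c12 c13, commute_casimir c21 c22 c23, commute_casimir c31 c32 c33,
    h.casimir_comm_left.symm, h.casimir_comm_mid.symm, h.casimir_comm_right.symm⟩

/-- The center of `U(o(4))` is generated by the Casimir elements of the two ideals of `o(4)`. -/
theorem mem_adjoin_casimirFour {z : Envelope (SO 4)} (hz : z ∈ EnvelopeCenter (SO 4)) :
    z ∈ Algebra.adjoin ℂ ({casimirFour 1, casimirFour (-1)} : Set (Envelope (SO 4))) :=
  mem_adjoin_casimir_of_mem_center (rotationTriple_four one_mul_one_complex)
    (rotationTriple_four neg_one_mul_neg_one_complex) (commute_four envι) adjoin_four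
    (fun a b => ⟨_, _, _, _, _, vermaFour_highestWeight a b⟩) hz

end Center

/-! ### Harish-Chandra parameters in terms of Casimir values. -/

section HarishChandra

/-- The Verma ideal defining `hc4`. -/
def idealFour (lam : Fin 2 → ℂ) : Ideal (Envelope (SO 4)) :=
  vermaIdeal
    {wedge ![1, Complex.I, 0, 0] ![0, 0, 1, Complex.I],
      wedge ![1, Complex.I, 0, 0] ![0, 0, 1, -Complex.I]}
    {((1 / 2 : ℂ) • wedge ![1, Complex.I, 0, 0] ![1, -Complex.I, 0, 0], lam 0 - 1),
      ((1 / 2 : ℂ) • wedge ![0, 0, 1, Complex.I] ![0, 0, 1, -Complex.I], lam 1)}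

/-- The root vectors for e₁ + e₂ and e₁ - e₂ are the raising operators of the triples s = 1 and s =
-1. -/
theorem wedge_four_root : wedge ![1, Complex.I, 0, 0] ![0, 0, 1, Complex.I]
      = fourY 1 + Complex.I • fourZ 1 ∧
    wedge ![1, Complex.I, 0, 0] ![0, 0, 1, -Complex.I] = fourY (-1) + Complex.I • fourZ (-1) := by
  constructor <;> refine SO.ext_four ?_ ?_ ?_ ?_ ?_ ?_ <;>
    simp [fourY, fourZ, SO.wedge_apply, SO.add_apply, SO.sub_apply,
      SO.smul_apply, elemSkew_apply]

/-- With h₊, h₋ the Cartan elements of the two triples, H₁ = (h₊ + h₋)/2 and H₂ = (h₊ - h₋)/2.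
Highest weight (λ₁ - 1, λ₂) thus means weights λ₁ + λ₂ - 1 and λ₁ - λ₂ - 1 for h₊ and h₋. -/
theorem wedge_four_cartan :
    (1 / 2 : ℂ) • wedge ![1, Complex.I, 0, 0] ![1, -Complex.I, 0, 0]
      = (-Complex.I / 2) • (fourX 1 + fourX (-1)) ∧
    (1 / 2 : ℂ) • wedge ![0, 0, 1, Complex.I] ![0, 0, 1, -Complex.I]
      = (-Complex.I / 2) • (fourX 1 - fourX (-1)) := by
  constructor <;> refine SO.ext_four ?_ ?_ ?_ ?_ ?_ ?_ <;>
    simp [fourX, SO.wedge_apply, SO.add_apply, SO.sub_apply,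
      SO.smul_apply, elemSkew_apply] <;> ring

/-- The scalar chosen in `centralCharacter` is unique only when the Verma module is nonzero; the
explicit model of `vermaFour` supplies a nonzero highest weight vector. -/
theorem one_notMem_idealFour (lam : Fin 2 → ℂ) : (1 : Envelope (SO 4)) ∉ idealFour lam := by
  intro h
  obtain ⟨he, he', hh, hh', hne⟩ :=
    vermaFour_highestWeight (lam 0 + lam 1) (lam 0 - lam 1)
  replace he := (LinearMap.congr_fun (lift_raising _ _ _) _).symm.trans he
  replace he' := (LinearMap.congr_fun (lift_raising _ _ _) _).symm.trans he'
  replace hh := (LinearMap.congr_fun (lift_cartan _ _) _).symm.trans hh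
  replace hh' := (LinearMap.congr_fun (lift_cartan _ _) _).symm.trans hh'
  set ρ := vermaFour (lam 0 + lam 1) (lam 0 - lam 1) with hρ
  have key := lift_apply_of_mem_vermaIdeal ρ (v := 1 ⊗ₜ[ℂ] 1) ?_ ?_ h
  · have := hne 0 0
    simp only [pow_zero, mul_one] at this
    exact this key
  · simp only [Set.mem_insert_iff, Set.mem_singleton_iff, forall_eq_or_imp, forall_eq,
      wedge_four_root, map_add, map_smul]
    exact ⟨he, he'⟩
  · simp only [Set.mem_insert_iff, Set.mem_singleton_iff, forall_eq_or_imp, forall_eq,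
      wedge_four_cartan, map_add, map_smul, map_sub, LinearMap.smul_apply,
      LinearMap.add_apply, LinearMap.sub_apply]
    simp only [cartan, LinearMap.neg_apply, LinearMap.smul_apply] at hh hh'
    constructor
    · have := congrArg₂ (fun p q => (1 / 2 : ℂ) • (p + q)) hh hh'
      refine Eq.trans ?_ (this.trans ?_) <;> module
    · have := congrArg₂ (fun p q => (1 / 2 : ℂ) • (p - q)) hh hh'
      refine Eq.trans ?_ (this.trans ?_) <;> module

theorem casimirFour_sub_mem (lam : Fin 2 → ℂ) :
    casimirFour 1 - algebraMap ℂ _ ((lam 0 + lam 1) ^ 2) ∈ idealFour lam ∧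
    casimirFour (-1) - algebraMap ℂ _ ((lam 0 - lam 1) ^ 2) ∈ idealFour lam := by
  have hn : ∀ x ∈ ({wedge ![1, Complex.I, 0, 0] ![0, 0, 1, Complex.I],
      wedge ![1, Complex.I, 0, 0] ![0, 0, 1, -Complex.I]} : Set (SO 4)), envι x ∈ idealFour lam :=
    fun x hx => Ideal.subset_span (Or.inl ⟨x, hx, rfl⟩)
  have hh : ∀ p ∈ ({((1 / 2 : ℂ) • wedge ![1, Complex.I, 0, 0] ![1, -Complex.I, 0, 0], lam 0 - 1),
      ((1 / 2 : ℂ) • wedge ![0, 0, 1, Complex.I] ![0, 0, 1, -Complex.I], lam 1)} :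
      Set (SO 4 × ℂ)), envι p.1 - algebraMap ℂ _ p.2 ∈ idealFour lam :=
    fun p hp => Ideal.subset_span (Or.inr ⟨p, hp, rfl⟩)
  simp only [Set.mem_insert_iff, Set.mem_singleton_iff, forall_eq_or_imp, forall_eq,
    wedge_four_root, wedge_four_cartan, map_add, map_sub, map_smul] at hn hh
  obtain ⟨h1, h2⟩ := hh
  constructor
  · refine (rotationTriple_four one_mul_one_complex).casimir_sub_mem _ hn.1 ?_
    convert (idealFour lam).add_mem h1 h2 using 1
    simp only [cartan, Algebra.algebraMap_eq_smul_one]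
    module
  · refine (rotationTriple_four neg_one_mul_neg_one_complex).casimir_sub_mem _ hn.2 ?_
    convert (idealFour lam).sub_mem h1 h2 using 1
    simp only [cartan, Algebra.algebraMap_eq_smul_one]
    module

theorem hc4_casimirFour (lam : Fin 2 → ℂ) :
    hc4 lam ⟨casimirFour 1, casimirFour_one_mem⟩ = (lam 0 + lam 1) ^ 2 ∧
    hc4 lam ⟨casimirFour (-1), casimirFour_neg_one_mem⟩ = (lam 0 - lam 1) ^ 2 :=
  ⟨centralCharacter_eq (one_notMem_idealFour lam) (casimirFour_sub_mem lam).1,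
    centralCharacter_eq (one_notMem_idealFour lam) (casimirFour_sub_mem lam).2⟩

/-- A vector on which the two Casimir elements act as prescribed by `lam` has the infinitesimal
character `lam`. -/
theorem centerAction_eq_hc4_smul {V : Type*} [AddCommGroup V] [Module ℂ V]
    (ρ : SO 4 →ₗ⁅ℂ⁆ Module.End ℂ V) (lam : Fin 2 → ℂ) {v : V}
    (h1 : UniversalEnvelopingAlgebra.lift ℂ ρ (casimirFour 1) v = (lam 0 + lam 1) ^ 2 • v)
    (h2 : UniversalEnvelopingAlgebra.lift ℂ ρ (casimirFour (-1)) v = (lam 0 - lam 1) ^ 2 • v)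
    (z : EnvelopeCenter (SO 4)) : centerAction ρ z v = hc4 lam z • v := by
  -- One scalar c is tracked simultaneously in the Verma quotient and on v. It is prescribed on the
  -- two Casimirs and propagates to the algebra they generate, which contains the center.
  have key : ∀ a ∈ Algebra.adjoin ℂ ({casimirFour 1, casimirFour (-1)} : Set (Envelope (SO 4))),
      ∃ c : ℂ, a - algebraMap ℂ _ c ∈ idealFour lam ∧
        UniversalEnvelopingAlgebra.lift ℂ ρ a v = c • v := by
    intro a ha
    induction ha using Algebra.adjoin_induction with
    | mem g hg =>
      simp only [Set.mem_insert_iff, Set.mem_singleton_iff] at hg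
      rcases hg with rfl | rfl
      · exact ⟨_, (casimirFour_sub_mem lam).1, h1⟩
      · exact ⟨_, (casimirFour_sub_mem lam).2, h2⟩
    | algebraMap r =>
      refine ⟨r, by simp, ?_⟩
      rw [AlgHom.commutes, Module.algebraMap_end_apply]
    | add a b _ _ ha hb =>
      obtain ⟨c, hc, hc'⟩ := ha
      obtain ⟨d, hd, hd'⟩ := hb
      refine ⟨c + d, ?_, ?_⟩
      · convert (idealFour lam).add_mem hc hd using 1
        rw [map_add]; abel
      · rw [map_add, LinearMap.add_apply, hc', hd', add_smul]
    | mul a b _ _ ha hb =>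
      obtain ⟨c, hc, hc'⟩ := ha
      obtain ⟨d, hd, hd'⟩ := hb
      refine ⟨c * d, ?_, ?_⟩
      -- The ideal is only a left ideal, so ab - cd is written as a(b - d) + d(a - c), using that
      -- the scalar d commutes with a.
      · convert (idealFour lam).add_mem ((idealFour lam).mul_mem_left a hd)
          ((idealFour lam).mul_mem_left (algebraMap ℂ _ d) hc) using 1
        rw [map_mul, mul_sub, mul_sub, ← Algebra.commutes d a, ← map_mul, ← map_mul, mul_comm d c]
        abel
      · rw [map_mul, Module.End.mul_apply, hd', map_smul, hc', smul_smul, mul_comm]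
  obtain ⟨c, hc, hc'⟩ := key z (mem_adjoin_casimirFour z.2)
  have : hc4 lam z = c := centralCharacter_eq (one_notMem_idealFour lam) hc
  rw [this]
  exact hc'

/-- The Casimir element of `o(3)`. -/
def casimirThree : Envelope (SO 3) :=
  casimir (envι ((2 : ℂ) • elemSkew 0 1)) (envι ((2 : ℂ) • elemSkew 0 2))
    (envι ((2 : ℂ) • elemSkew 1 2))

theorem rotationTriple_three : RotationTriple (envι ((2 : ℂ) • elemSkew (n := 3) 0 1))
    (envι ((2 : ℂ) • elemSkew 0 2)) (envι ((2 : ℂ) • elemSkew 1 2)) :=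
  lieRotationTriple_three.map envι

theorem casimirThree_mem : casimirThree ∈ EnvelopeCenter (SO 3) := by
  refine mem_center_of_adjoin_eq_top UniversalEnvelopingAlgebra.adjoin_range_ι ?_
  rintro _ ⟨A, rfl⟩
  have hA : A = (A.1 0 1 / 2) • ((2 : ℂ) • elemSkew 0 1) + (A.1 0 2 / 2) • ((2 : ℂ) • elemSkew 0 2)
      + (A.1 1 2 / 2) • ((2 : ℂ) • elemSkew 1 2) := by
    refine SO.ext_three ?_ ?_ ?_ <;> simp [SO.add_apply, SO.smul_apply, elemSkew_apply]
  rw [hA, map_add, map_add, map_smul _ (A.1 0 1 / 2), map_smul _ (A.1 0 2 / 2),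
    map_smul _ (A.1 1 2 / 2)]
  have h := rotationTriple_three
  have c1 := h.casimir_comm_left.symm.smul_left (A.1 0 1 / 2)
  have c2 := h.casimir_comm_mid.symm.smul_left (A.1 0 2 / 2)
  have c3 := h.casimir_comm_right.symm.smul_left (A.1 1 2 / 2)
  exact (c1.add_left c2).add_left c3

/-- The Cartan element of the doubled triple is 2H. Highest weight ν - 1/2 for H becomes 2ν - 1 = c
- 1 with c = 2ν, so the Casimir value is c². -/
theorem hc3_casimirThree (ν : ℂ) : hc3 ν ⟨casimirThree, casimirThree_mem⟩ = (2 * ν) ^ 2 := by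
  have hroot : wedge ![1, Complex.I, 0] ![0, 0, 1]
      = (1 / 2 : ℂ) • ((2 : ℂ) • elemSkew 0 2 + Complex.I • ((2 : ℂ) • elemSkew 1 2)) := by
    refine SO.ext_three ?_ ?_ ?_ <;>
      simp [SO.wedge_apply, SO.add_apply, SO.smul_apply, elemSkew_apply] <;> ring
  have hcart : (1 / 2 : ℂ) • wedge ![1, Complex.I, 0] ![1, -Complex.I, 0]
      = (-Complex.I / 2) • ((2 : ℂ) • elemSkew 0 1) := by
    refine SO.ext_three ?_ ?_ ?_ <;>
      simp [SO.wedge_apply, SO.smul_apply, elemSkew_apply] <;> ring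
  refine centralCharacter_eq ?_ ?_
  · intro h
    have hv := rotationTriple_verma (2 * ν - 1)
    have e1 : hv.threeHom ((2 : ℂ) • elemSkew 0 1) = vermaX (2 * ν - 1) := by
      simp [RotationTriple.threeHom_apply, elemSkew_apply]
    have e2 : hv.threeHom ((2 : ℂ) • elemSkew 0 2) = vermaY (2 * ν - 1) := by
      simp [RotationTriple.threeHom_apply, elemSkew_apply]
    have e3 : hv.threeHom ((2 : ℂ) • elemSkew 1 2) = vermaZ (2 * ν - 1) := by
      simp [RotationTriple.threeHom_apply, elemSkew_apply]
    have key := lift_apply_of_mem_vermaIdeal hv.threeHom (v := 1) ?_ ?_ h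
    · simp at key
    · simp only [Set.mem_singleton_iff, forall_eq]
      rw [hroot, map_smul, map_add, map_smul _ Complex.I, e2, e3]
      have : vermaY (2 * ν - 1) + Complex.I • vermaZ (2 * ν - 1) = vermaRaising (2 * ν - 1) :=
        raising_verma _
      rw [this, LinearMap.smul_apply, vermaRaising_one, smul_zero]
    · simp only [Set.mem_singleton_iff, forall_eq]
      rw [hcart, map_smul, e1]
      have : (-Complex.I / 2) • vermaX (2 * ν - 1) = (1 / 2 : ℂ) • cartan (vermaX (2 * ν - 1)) := by
        rw [cartan]; module
      rw [this, cartan_verma, LinearMap.smul_apply, vermaCartan_one]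
      module
  · set J := vermaIdeal {wedge ![1, Complex.I, 0] ![0, 0, 1]}
      {((1 / 2 : ℂ) • wedge ![1, Complex.I, 0] ![1, -Complex.I, 0], ν - 1 / 2)} with hJ
    have hn : envι (wedge ![1, Complex.I, 0] ![0, 0, 1]) ∈ J :=
      Ideal.subset_span (Or.inl ⟨_, rfl, rfl⟩)
    have hh : envι ((1 / 2 : ℂ) • wedge ![1, Complex.I, 0] ![1, -Complex.I, 0])
        - algebraMap ℂ _ (ν - 1 / 2) ∈ J := Ideal.subset_span (Or.inr ⟨_, rfl, rfl⟩)
    rw [hroot, map_smul, map_add, map_smul _ Complex.I] at hn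
    rw [hcart, map_smul] at hh
    refine rotationTriple_three.casimir_sub_mem _ ?_ ?_
    · convert J.mul_mem_left (algebraMap ℂ _ 2) hn using 1
      rw [raising, ← Algebra.smul_def]
      module
    · convert J.mul_mem_left (algebraMap ℂ _ 2) hh using 1
      rw [cartan, ← Algebra.smul_def]
      simp only [Algebra.algebraMap_eq_smul_one]
      module

end HarishChandra

/-! ### The action of the two ideals on ℂ⁴ by quaternion units. -/

section Standard

theorem four_matrix (s : ℂ) :
    (fourX s).1 = !![0, 1, 0, 0; -1, 0, 0, 0; 0, 0, 0, s; 0, 0, -s, 0] ∧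
    (fourY s).1 = !![0, 0, 1, 0; 0, 0, 0, -s; -1, 0, 0, 0; 0, s, 0, 0] ∧
    (fourZ s).1 = !![0, 0, 0, s; 0, 0, 1, 0; 0, -1, 0, 0; -s, 0, 0, 0] := by
  refine ⟨?_, ?_, ?_⟩ <;> ext i j <;> fin_cases i <;> fin_cases j <;>
    simp [fourX, fourY, fourZ, SO.add_apply, SO.sub_apply, SO.smul_apply, elemSkew_apply]

/-- In ℂ⁴ = ℂ² ⊗ ℂ² each ideal acts through one two-dimensional factor, so its triple consists of
quaternion units, up to the sign convention of the products. -/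
theorem four_matrix_mul {s : ℂ} (hs : s * s = 1) :
    (fourX s).1 * (fourX s).1 = -1 ∧ (fourY s).1 * (fourY s).1 = -1 ∧
    (fourZ s).1 * (fourZ s).1 = -1 ∧ (fourX s).1 * (fourY s).1 = -(fourZ s).1 ∧
    (fourY s).1 * (fourZ s).1 = -(fourX s).1 ∧ (fourZ s).1 * (fourX s).1 = -(fourY s).1 ∧
    (fourY s).1 * (fourX s).1 = (fourZ s).1 ∧ (fourZ s).1 * (fourY s).1 = (fourX s).1 ∧
    (fourX s).1 * (fourZ s).1 = (fourY s).1 := by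
  obtain ⟨h1, h2, h3⟩ := four_matrix s
  rw [h1, h2, h3]
  refine ⟨?_, ?_, ?_, ?_, ?_, ?_, ?_, ?_, ?_⟩ <;> ext i j <;> fin_cases i <;> fin_cases j <;>
    simp [Matrix.mul_apply, Fin.sum_univ_four, hs]

theorem standardRep_apply {n : ℕ} (A : SO n) (v : Fin n → ℂ) :
    standardRep n A v = A.1.mulVec v := rfl

theorem standardRep_mul {n : ℕ} (A B : SO n) :
    standardRep n A * standardRep n B = Matrix.toLinAlgEquiv' (A.1 * B.1) := by
  rw [map_mul]; rfl

end Standard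

/-! ### Coupling operators on V ⊗ ℂ⁴. -/

section Coupling

variable {V : Type*} [AddCommGroup V] [Module ℂ V] (ρ : SO 4 →ₗ⁅ℂ⁆ Module.End ℂ V)

/-- The coupling operator on `V ⊗ ℂ⁴` of one of the two ideals of `o(4)`. -/
def coupling (s : ℂ) : Module.End ℂ (V ⊗[ℂ] (Fin 4 → ℂ)) :=
  1 - (TensorProduct.map (ρ (fourX s)) (standardRep 4 (fourX s))
    + TensorProduct.map (ρ (fourY s)) (standardRep 4 (fourY s))
    + TensorProduct.map (ρ (fourZ s)) (standardRep 4 (fourZ s)))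

theorem coupling_eq (s : ℂ) : coupling ρ s =
    1 - ((ρ (fourX s)).rTensor (Fin 4 → ℂ) * (standardRep 4 (fourX s)).lTensor V
      + (ρ (fourY s)).rTensor (Fin 4 → ℂ) * (standardRep 4 (fourY s)).lTensor V
      + (ρ (fourZ s)).rTensor (Fin 4 → ℂ) * (standardRep 4 (fourZ s)).lTensor V) := by
  simp only [coupling, Module.End.mul_eq_comp, LinearMap.rTensor_comp_lTensor]

theorem rTensor_casimir {W : Type*} [AddCommGroup W] [Module ℂ W] (x y z : Module.End ℂ V) :
    casimir (x.rTensor W) (y.rTensor W) (z.rTensor W) = (casimir x y z).rTensor W := by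
  simp only [casimir, LinearMap.rTensor_sub, LinearMap.rTensor_add, LinearMap.rTensor_mul]
  congr 1
  exact (LinearMap.rTensor_id W V).symm

theorem RotationTriple.rTensor {x y z : Module.End ℂ V} (h : RotationTriple x y z)
    (W : Type*) [AddCommGroup W] [Module ℂ W] :
    RotationTriple (x.rTensor W) (y.rTensor W) (z.rTensor W) := by
  obtain ⟨h1, h2, h3⟩ := h
  refine ⟨?_, ?_, ?_⟩
  · rw [← LinearMap.rTensor_mul, ← LinearMap.rTensor_mul, ← LinearMap.rTensor_sub, h1,
      LinearMap.rTensor_neg, two_mul, two_mul, LinearMap.rTensor_add]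
  · rw [← LinearMap.rTensor_mul, ← LinearMap.rTensor_mul, ← LinearMap.rTensor_sub, h2,
      LinearMap.rTensor_neg, two_mul, two_mul, LinearMap.rTensor_add]
  · rw [← LinearMap.rTensor_mul, ← LinearMap.rTensor_mul, ← LinearMap.rTensor_sub, h3,
      LinearMap.rTensor_neg, two_mul, two_mul, LinearMap.rTensor_add]

theorem lTensor_mul_standardRep {n : ℕ} {A B : SO n} {M : Matrix (Fin n) (Fin n) ℂ}
    (h : A.1 * B.1 = M) : (standardRep n A).lTensor V * (standardRep n B).lTensor V
      = (Matrix.toLinAlgEquiv' M : Module.End ℂ (Fin n → ℂ)).lTensor V := by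
  rw [← LinearMap.lTensor_mul, standardRep_mul, h]

theorem standardRep_quaternion {s : ℂ} (hs : s * s = 1) :
    let a := (standardRep 4 (fourX s)).lTensor V
    let b := (standardRep 4 (fourY s)).lTensor V
    let c := (standardRep 4 (fourZ s)).lTensor V
    a * a = -1 ∧ b * b = -1 ∧ c * c = -1 ∧ a * b = -c ∧ b * c = -a ∧ c * a = -b ∧
    b * a = c ∧ c * b = a ∧ a * c = b := by
  intro a b c
  obtain ⟨h1, h2, h3, h4, h5, h6, h7, h8, h9⟩ := four_matrix_mul hs
  have hneg : ∀ M : Matrix (Fin 4) (Fin 4) ℂ,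
      (Matrix.toLinAlgEquiv' (-M) : Module.End ℂ (Fin 4 → ℂ)).lTensor V
        = -(Matrix.toLinAlgEquiv' M : Module.End ℂ (Fin 4 → ℂ)).lTensor V := by
    intro M
    rw [map_neg, LinearMap.lTensor_neg]
  have hone : (Matrix.toLinAlgEquiv' (-1) : Module.End ℂ (Fin 4 → ℂ)).lTensor V = -1 := by
    rw [hneg, map_one]
    congr 1
    exact LinearMap.lTensor_id V _
  refine ⟨(lTensor_mul_standardRep h1).trans hone, (lTensor_mul_standardRep h2).trans hone,
    (lTensor_mul_standardRep h3).trans hone, (lTensor_mul_standardRep h4).trans (hneg _),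
    (lTensor_mul_standardRep h5).trans (hneg _), (lTensor_mul_standardRep h6).trans (hneg _),
    lTensor_mul_standardRep h7, lTensor_mul_standardRep h8, lTensor_mul_standardRep h9⟩

theorem lTensor_commute_rTensor {W : Type*} [AddCommGroup W] [Module ℂ W] (f : Module.End ℂ V)
    (g : Module.End ℂ W) : g.lTensor V * f.rTensor W = f.rTensor W * g.lTensor V := by
  rw [Module.End.mul_eq_comp, Module.End.mul_eq_comp, LinearMap.lTensor_comp_rTensor,
    LinearMap.rTensor_comp_lTensor]

theorem coupling_mul_self {s : ℂ} (hs : s * s = 1) : coupling ρ s * coupling ρ s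
    = (casimir (ρ (fourX s)) (ρ (fourY s)) (ρ (fourZ s))).rTensor (Fin 4 → ℂ) := by
  obtain ⟨h1, h2, h3, h4, h5, h6, h7, h8, h9⟩ := standardRep_quaternion (V := V) hs
  rw [← rTensor_casimir, coupling_eq]
  refine (((lieRotationTriple_four hs).map ρ).rTensor (Fin 4 → ℂ)).coupling_sq h1 h2 h3 h4 h5 h6
    h7 h8 h9 ?_
  simp only [Set.mem_insert_iff, Set.mem_singleton_iff, forall_eq_or_imp, forall_eq,
    lTensor_commute_rTensor, and_self]

/-- This is what turns eigenvalues of the coupling into infinitesimal characters: if the Casimir of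
V is x² and the coupling is εx with ε² = 1, the Casimir of V ⊗ ℂ⁴ is x² + 1 + 2εx = (x + ε)². -/
theorem lift_tensorAction_casimirFour {s : ℂ} (hs : s * s = 1) :
    UniversalEnvelopingAlgebra.lift ℂ (tensorAction ρ (standardRep 4)) (casimirFour s)
    = (casimir (ρ (fourX s)) (ρ (fourY s)) (ρ (fourZ s))).rTensor (Fin 4 → ℂ) + 1
      + 2 * coupling ρ s := by
  obtain ⟨h1, h2, h3, -⟩ := standardRep_quaternion (V := V) hs
  refine (lift_casimir _ _ _ _).trans ?_
  rw [← rTensor_casimir, coupling_eq]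
  refine RotationTriple.casimir_add h1 h2 h3 ?_
  simp only [Set.mem_insert_iff, Set.mem_singleton_iff, forall_eq_or_imp, forall_eq,
    lTensor_commute_rTensor, and_self]

end Coupling

/-! ### Primary decomposition by joint spectral projections. -/

section Primary

variable {M : Type*} [AddCommGroup M] [Module ℂ M] (σ : SO 4 →ₗ⁅ℂ⁆ Module.End ℂ M)

theorem commute_centerAction (z : EnvelopeCenter (SO 4)) (a : Envelope (SO 4)) :
    Commute (centerAction σ z) (UniversalEnvelopingAlgebra.lift ℂ σ a) := by
  have h : Commute (z : Envelope (SO 4)) a := ((Subalgebra.mem_center_iff.1 z.2) a).symm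
  exact h.map (UniversalEnvelopingAlgebra.lift ℂ σ)

/-- The parameter with prescribed sum and difference of its coordinates. -/
def sumDiff (x y : ℂ) : Fin 2 → ℂ := ![(x + y) / 2, (x - y) / 2]

theorem sumDiff_add (x y : ℂ) : sumDiff x y 0 + sumDiff x y 1 = x := by
  simp [sumDiff]; ring

theorem sumDiff_sub (x y : ℂ) : sumDiff x y 0 - sumDiff x y 1 = y := by
  simp [sumDiff]; ring

/-- The joint spectral projection of two commuting operators with squares `x ^ 2`, `y ^ 2`. -/
def spectralProjection (A B : Module.End ℂ M) (s t : ℂ) : Module.End ℂ M :=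
  (1 / 4 : ℂ) • ((1 + s • A) * (1 + t • B))

variable {A B : Module.End ℂ M} {x y : ℂ}

theorem mul_one_add_smul {A : Module.End ℂ M} {x : ℂ} (hA : A * A = x ^ 2 • (1 : Module.End ℂ M))
    (hx : x ≠ 0) {ε : ℂ} (hε : ε * ε = 1) : A * (1 + (ε / x) • A) = (ε * x) • (1 + (ε / x) • A) := by
  rw [mul_add, mul_one, mul_smul_comm, hA, smul_add, smul_smul, smul_smul,
    show ε / x * x ^ 2 = ε * x by field_simp, show ε * x * (ε / x) = 1 by field_simp; rwa [sq],
    one_smul, add_comm]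

variable (hA : A * A = x ^ 2 • (1 : Module.End ℂ M)) (hB : B * B = y ^ 2 • (1 : Module.End ℂ M))
  (hAB : Commute A B) (hx : x ≠ 0) (hy : y ≠ 0)
  (hΩA : UniversalEnvelopingAlgebra.lift ℂ σ (casimirFour 1)
    = (x ^ 2 + 1) • (1 : Module.End ℂ M) + (2 : ℂ) • A)
  (hΩB : UniversalEnvelopingAlgebra.lift ℂ σ (casimirFour (-1))
    = (y ^ 2 + 1) • (1 : Module.End ℂ M) + (2 : ℂ) • B)

include hA hx in
theorem mul_spectralProjection_left {ε : ℂ} (hε : ε * ε = 1) (t : ℂ) :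
    A * spectralProjection A B (ε / x) t = (ε * x) • spectralProjection A B (ε / x) t := by
  rw [spectralProjection, mul_smul_comm, ← mul_assoc, mul_one_add_smul hA hx hε, smul_mul_assoc,
    smul_comm]

include hB hAB hy in
theorem mul_spectralProjection_right {ε : ℂ} (hε : ε * ε = 1) (s : ℂ) :
    B * spectralProjection A B s (ε / y) = (ε * y) • spectralProjection A B s (ε / y) := by
  have hc : Commute B (1 + s • A) :=
    (Commute.one_right B).add_right (hAB.symm.smul_right s)
  rw [spectralProjection, mul_smul_comm, ← mul_assoc, hc.eq, mul_assoc,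
    mul_one_add_smul hB hy hε, mul_smul_comm, smul_comm]

theorem spectralProjection_sum (A B : Module.End ℂ M) (s t : ℂ) :
    spectralProjection A B s t + spectralProjection A B (-s) t + spectralProjection A B s (-t)
      + spectralProjection A B (-s) (-t) = 1 := by
  simp only [spectralProjection, add_mul, mul_add, smul_mul_assoc, mul_smul_comm, one_mul, mul_one]
  module

include hA hB hAB hx hy hΩA hΩB in
-- On the image A = εx and B = ε'y, so the two Casimirs take the values (x + ε)² and (y + ε')².
-- These determine the action of the whole center.
theorem centerAction_spectralProjection {ε ε' : ℂ} (hε : ε * ε = 1) (hε' : ε' * ε' = 1)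
    (z : EnvelopeCenter (SO 4)) (v : M) :
    centerAction σ z (spectralProjection A B (ε / x) (ε' / y) v)
      = hc4 (sumDiff (x + ε) (y + ε')) z • spectralProjection A B (ε / x) (ε' / y) v := by
  have h1 := LinearMap.congr_fun (mul_spectralProjection_left (B := B) hA hx hε (ε' / y)) v
  have h2 := LinearMap.congr_fun (mul_spectralProjection_right hB hAB hy hε' (ε / x)) v
  rw [Module.End.mul_apply, LinearMap.smul_apply] at h1 h2
  apply centerAction_eq_hc4_smul
  · rw [hΩA, sumDiff_add, LinearMap.add_apply, LinearMap.smul_apply, LinearMap.smul_apply, h1,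
      Module.End.one_apply, smul_smul, ← add_smul]
    congr 1
    linear_combination -hε
  · rw [hΩB, sumDiff_sub, LinearMap.add_apply, LinearMap.smul_apply, LinearMap.smul_apply, h2,
      Module.End.one_apply, smul_smul, ← add_smul]
    congr 1
    linear_combination -hε'

include hΩA hΩB in
-- A and B are affine functions of the actions of the two Casimirs, hence commute with the center.
theorem commute_centerAction_spectralProjection (s t : ℂ) (z : EnvelopeCenter (SO 4)) :
    Commute (centerAction σ z) (spectralProjection A B s t) := by
  have e : ∀ {C D : Module.End ℂ M} {c : ℂ}, D = c • (1 : Module.End ℂ M) + (2 : ℂ) • C →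
      Commute (centerAction σ z) D → Commute (centerAction σ z) C := by
    intro C D c h hD
    have : C = (1 / 2 : ℂ) • (D - c • (1 : Module.End ℂ M)) := by rw [h]; module
    rw [this]
    exact (hD.sub_right ((Commute.one_right _).smul_right _)).smul_right _
  have cA := e hΩA (commute_centerAction σ z _)
  have cB := e hΩB (commute_centerAction σ z _)
  exact (((Commute.one_right _).add_right (cA.smul_right s)).mul_right
    ((Commute.one_right _).add_right (cB.smul_right t))).smul_right _

variable (hscalar : ∀ (τ : EnvelopeCenter (SO 4) → ℂ), ∀ v ∈ primaryComponent σ τ,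
  ∀ z : EnvelopeCenter (SO 4), centerAction σ z v = τ z • v)

include hA hB hAB hx hy hΩA hΩB in
theorem spectralProjection_mem {ε ε' : ℂ} (hε : ε * ε = 1) (hε' : ε' * ε' = 1) (v : M) :
    spectralProjection A B (ε / x) (ε' / y) v
      ∈ primaryComponent σ (hc4 (sumDiff (x + ε) (y + ε'))) := by
  refine Submodule.mem_iSup_of_mem 1 ((Submodule.mem_iInf _).2 fun z => ?_)
  rw [pow_one, LinearMap.mem_ker, LinearMap.sub_apply, LinearMap.smul_apply, Module.End.one_apply,
    centerAction_spectralProjection σ hA hB hAB hx hy hΩA hΩB hε hε', sub_self]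

include hA hB hAB hx hy hΩA hΩB hscalar in
-- The projection commutes with the center. A nonzero image of v would be acted on both by τ and by
-- the character attached to the projection.
theorem spectralProjection_eq_zero {ε ε' : ℂ} (hε : ε * ε = 1) (hε' : ε' * ε' = 1)
    {τ : EnvelopeCenter (SO 4) → ℂ} (hτ : τ ≠ hc4 (sumDiff (x + ε) (y + ε'))) {v : M}
    (hv : v ∈ primaryComponent σ τ) : spectralProjection A B (ε / x) (ε' / y) v = 0 := by
  by_contra hne
  refine hτ (funext fun z => ?_)
  have h1 := centerAction_spectralProjection σ hA hB hAB hx hy hΩA hΩB hε hε' z v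
  rw [← Module.End.mul_apply,
    (commute_centerAction_spectralProjection σ hΩA hΩB _ _ z).eq, Module.End.mul_apply,
    hscalar τ v hv z, map_smul] at h1
  exact smul_left_injective ℂ hne h1

theorem hc4_sumDiff_ne {x y x' y' : ℂ} (h : x ^ 2 ≠ x' ^ 2 ∨ y ^ 2 ≠ y' ^ 2) :
    hc4 (sumDiff x y) ≠ hc4 (sumDiff x' y') := by
  intro he
  have h1 := congrFun he ⟨casimirFour 1, casimirFour_one_mem⟩
  have h2 := congrFun he ⟨casimirFour (-1), casimirFour_neg_one_mem⟩
  rw [(hc4_casimirFour _).1, (hc4_casimirFour _).1, sumDiff_add, sumDiff_add] at h1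
  rw [(hc4_casimirFour _).2, (hc4_casimirFour _).2, sumDiff_sub, sumDiff_sub] at h2
  tauto

/-- The two squares differ by 4xε. Regularity of the parameter enters here to separate the four
infinitesimal characters. -/
theorem add_sq_ne_add_neg_sq {x ε : ℂ} (hx : x ≠ 0) (hε : ε * ε = 1) :
    (x + -ε) ^ 2 ≠ (x + ε) ^ 2 := by
  intro h
  have : x * ε = 0 := by linear_combination -h / 4
  have : x = 0 := by linear_combination ε * this - x * hε
  exact hx this

include hA hB hAB hx hy hΩA hΩB hscalar in
/-- The primary decomposition is given by the joint spectral projections of the couplings. -/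
theorem isCompl_primaryComponent {ε ε' : ℂ} (hε : ε * ε = 1) (hε' : ε' * ε' = 1) :
    IsCompl (primaryComponent σ (hc4 (sumDiff (x + ε) (y + ε'))))
      (⨆ (τ : EnvelopeCenter (SO 4) → ℂ) (_ : τ ≠ hc4 (sumDiff (x + ε) (y + ε'))),
        primaryComponent σ τ) ∧
    primaryProjection σ (hc4 (sumDiff (x + ε) (y + ε')))
      = spectralProjection A B (ε / x) (ε' / y) := by
  set χ := hc4 (sumDiff (x + ε) (y + ε')) with hχ
  set S := ⨆ (τ : EnvelopeCenter (SO 4) → ℂ) (_ : τ ≠ χ), primaryComponent σ τ with hS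
  set p := spectralProjection A B (ε / x) (ε' / y) with hp
  have hnε : -ε * -ε = 1 := by rw [neg_mul_neg, hε]
  have hnε' : -ε' * -ε' = 1 := by rw [neg_mul_neg, hε']
  have hsum := spectralProjection_sum A B (ε / x) (ε' / y)
  rw [← neg_div, ← neg_div] at hsum
  have hχ1 : hc4 (sumDiff (x + -ε) (y + ε')) ≠ χ :=
    hc4_sumDiff_ne (Or.inl (add_sq_ne_add_neg_sq hx hε))
  have hχ2 : hc4 (sumDiff (x + ε) (y + -ε')) ≠ χ :=
    hc4_sumDiff_ne (Or.inr (add_sq_ne_add_neg_sq hy hε'))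
  have hχ3 : hc4 (sumDiff (x + -ε) (y + -ε')) ≠ χ :=
    hc4_sumDiff_ne (Or.inl (add_sq_ne_add_neg_sq hx hε))
  have hmem : ∀ {η η' : ℂ}, η * η = 1 → η' * η' = 1 → ∀ v,
      spectralProjection A B (η / x) (η' / y) v
        ∈ primaryComponent σ (hc4 (sumDiff (x + η) (y + η'))) :=
    fun h h' v => spectralProjection_mem σ hA hB hAB hx hy hΩA hΩB h h' v
  have hzero : ∀ {η η' : ℂ}, η * η = 1 → η' * η' = 1 → ∀ {τ : EnvelopeCenter (SO 4) → ℂ},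
      τ ≠ hc4 (sumDiff (x + η) (y + η')) → ∀ {v}, v ∈ primaryComponent σ τ →
      spectralProjection A B (η / x) (η' / y) v = 0 :=
    fun h h' _ hτ _ hv => spectralProjection_eq_zero σ hA hB hAB hx hy hΩA hΩB hscalar h h' hτ hv
  have hle : ∀ {τ : EnvelopeCenter (SO 4) → ℂ}, τ ≠ χ → primaryComponent σ τ ≤ S :=
    fun {τ} hτ => le_iSup₂_of_le (f := fun τ (_ : τ ≠ χ) => primaryComponent σ τ) τ hτ le_rfl
  -- The four projections sum to 1 and the other three belong to characters different from χ, so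
  -- they vanish on v.
  have hfix : ∀ v ∈ primaryComponent σ χ, p v = v := by
    intro v hv
    have := LinearMap.congr_fun hsum v
    simp only [LinearMap.add_apply, Module.End.one_apply] at this
    rwa [hzero hnε hε' hχ1.symm hv, hzero hε hnε' hχ2.symm hv, hzero hnε hnε' hχ3.symm hv, add_zero,
      add_zero, add_zero] at this
  have hker : S ≤ LinearMap.ker p := iSup₂_le fun τ hτ v hv => hzero hε hε' hτ hv
  have hres : ∀ v, v - p v ∈ S := by
    intro v
    have h := LinearMap.congr_fun hsum v
    simp only [LinearMap.add_apply, Module.End.one_apply] at h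
    have : v - p v = spectralProjection A B (-ε / x) (ε' / y) v
        + spectralProjection A B (ε / x) (-ε' / y) v
        + spectralProjection A B (-ε / x) (-ε' / y) v := by
      rw [sub_eq_iff_eq_add, ← hp] at *
      nth_rewrite 1 [← h]
      abel
    rw [this]
    exact S.add_mem (S.add_mem (hle hχ1 (hmem hnε hε' v)) (hle hχ2 (hmem hε hnε' v)))
      (hle hχ3 (hmem hnε hnε' v))
  have hcompl : IsCompl (primaryComponent σ χ) S := by
    rw [isCompl_iff, Submodule.disjoint_def, codisjoint_iff, eq_top_iff]
    refine ⟨fun v hv hv' => ?_, fun v _ => ?_⟩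
    · rw [← hfix v hv]
      exact hker hv'
    · rw [← add_sub_cancel (p v) v]
      exact Submodule.add_mem_sup (hmem hε hε' v) (hres v)
  refine ⟨hcompl, ?_⟩
  rw [primaryProjection, dif_pos hcompl]
  refine LinearMap.ext fun v => ?_
  conv_lhs => rw [← add_sub_cancel (p v) v]
  rw [map_add, Submodule.projection_apply_of_mem_left hcompl (hmem hε hε' v),
    Submodule.projection_apply_of_mem_right hcompl (hres v), add_zero]

end Primary

/-! ### The f₀-component and the translation coefficient. -/

section Translation

variable {V W : Type*} [AddCommGroup V] [Module ℂ V] [AddCommGroup W] [Module ℂ W]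
  (ρ : SO 4 →ₗ⁅ℂ⁆ Module.End ℂ V) (T : V →ₗ[ℂ] W)

theorem tensorPr_tmul (v : V) (w : Fin 4 → ℂ) : tensorPr T (v ⊗ₜ w) = w 3 • T v := by
  simp only [tensorPr, LinearMap.comp_apply, TensorProduct.map_tmul, LinearEquiv.coe_coe,
    TensorProduct.rid_tmul]
  rfl

theorem coupling_tmul (s : ℂ) (v : V) (w : Fin 4 → ℂ) : coupling ρ s (v ⊗ₜ w)
    = v ⊗ₜ w - (ρ (fourX s) v ⊗ₜ (fourX s).1.mulVec w + ρ (fourY s) v ⊗ₜ (fourY s).1.mulVec w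
      + ρ (fourZ s) v ⊗ₜ (fourZ s).1.mulVec w) := by
  simp [coupling, standardRep_apply]

theorem four_mulVec_f0 (s : ℂ) :
    (fourX s).1.mulVec f0 = ![0, 0, s, 0] ∧ (fourY s).1.mulVec f0 = ![0, -s, 0, 0] ∧
    (fourZ s).1.mulVec f0 = ![s, 0, 0, 0] := by
  obtain ⟨h1, h2, h3⟩ := four_matrix s
  rw [h1, h2, h3]
  refine ⟨?_, ?_, ?_⟩ <;> ext i <;> fin_cases i <;>
    simp [f0, Matrix.mulVec, dotProduct, Pi.single_apply]

theorem four_mulVec_three (s : ℂ) (w : Fin 4 → ℂ) :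
    (fourX s).1.mulVec w 3 = -s * w 2 ∧ (fourY s).1.mulVec w 3 = s * w 1 ∧
    (fourZ s).1.mulVec w 3 = -s * w 0 := by
  obtain ⟨h1, h2, h3⟩ := four_matrix s
  rw [h1, h2, h3]
  refine ⟨?_, ?_, ?_⟩ <;> simp [Matrix.mulVec, dotProduct, Fin.sum_univ_four]

theorem f0_three : f0 3 = 1 := by simp [f0]

/-- A skew-symmetric matrix maps f₀ to a vector with zero f₀-coordinate, so only the identity term
of the coupling survives. -/
theorem tensorPr_coupling (s : ℂ) (u : V) : tensorPr T (coupling ρ s (u ⊗ₜ f0)) = T u := by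
  obtain ⟨h1, h2, h3⟩ := four_mulVec_f0 s
  rw [coupling_tmul, h1, h2, h3]
  simp [tensorPr_tmul, f0_three]

/-- Each member of the triple s = -1 sends f₀ to minus or plus a basis vector of ℂ³, and only the
corresponding member of the triple s = 1 returns that vector to f₀. The signs multiply to +1 in each
of the three cases. -/
theorem tensorPr_coupling_coupling (u : V) :
    tensorPr T (coupling ρ 1 (coupling ρ (-1) (u ⊗ₜ f0)))
      = T u + (T (ρ (fourX 1) (ρ (fourX (-1)) u)) + T (ρ (fourY 1) (ρ (fourY (-1)) u))
        + T (ρ (fourZ 1) (ρ (fourZ (-1)) u))) := by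
  obtain ⟨h1, h2, h3⟩ := four_mulVec_f0 (-1)
  rw [coupling_tmul, h1, h2, h3]
  simp only [map_sub, map_add, coupling_tmul, tensorPr_tmul, four_mulVec_three, f0_three]
  simp [f0]
  abel

variable (η : SO 3 →ₗ⁅ℂ⁆ Module.End ℂ W)

/-- The value of the `f₀`-component of the product of the two couplings, for an operator `T`
intertwining the actions of `o(3)`. -/
theorem tensorPr_coupling_coupling_eq {x y ν : ℂ}
    (hx : casimir (ρ (fourX 1)) (ρ (fourY 1)) (ρ (fourZ 1)) = x ^ 2 • (1 : Module.End ℂ V))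
    (hy : casimir (ρ (fourX (-1))) (ρ (fourY (-1))) (ρ (fourZ (-1)))
      = y ^ 2 • (1 : Module.End ℂ V))
    (hν : UniversalEnvelopingAlgebra.lift ℂ η casimirThree = (2 * ν) ^ 2 • (1 : Module.End ℂ W))
    (hX : ∀ u, T (ρ (fourX 1 + fourX (-1)) u) = η ((2 : ℂ) • elemSkew 0 1) (T u))
    (hY : ∀ u, T (ρ (fourY 1 + fourY (-1)) u) = η ((2 : ℂ) • elemSkew 0 2) (T u))
    (hZ : ∀ u, T (ρ (fourZ 1 + fourZ (-1)) u) = η ((2 : ℂ) • elemSkew 1 2) (T u)) (u : V) :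
    tensorPr T (coupling ρ 1 (coupling ρ (-1) (u ⊗ₜ f0)))
      = ((x ^ 2 + y ^ 2 + 1) / 2 - 2 * ν ^ 2) • T u := by
  have hc := commute_four ρ
  simp only [Set.mem_insert_iff, Set.mem_singleton_iff, forall_eq_or_imp, forall_eq] at hc
  obtain ⟨⟨c1, -, -⟩, ⟨-, c2, -⟩, ⟨-, -, c3⟩⟩ := hc
  -- Polarization: the Casimir of the diagonal o(3) is the sum of the two Casimirs, minus 1, minus
  -- twice Σ X₊X₋. The -1 comes from the constant term of the shifted Casimir.
  have hsum : casimir (ρ (fourX 1 + fourX (-1))) (ρ (fourY 1 + fourY (-1)))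
      (ρ (fourZ 1 + fourZ (-1))) = (x ^ 2 + y ^ 2 - 1) • (1 : Module.End ℂ V)
        - (2 : ℂ) • (ρ (fourX 1) * ρ (fourX (-1)) + ρ (fourY 1) * ρ (fourY (-1))
          + ρ (fourZ 1) * ρ (fourZ (-1))) := by
    have : (x ^ 2 + y ^ 2 - 1) • (1 : Module.End ℂ V)
        = x ^ 2 • (1 : Module.End ℂ V) + y ^ 2 • (1 : Module.End ℂ V) - 1 := by module
    rw [this, ← hx, ← hy]
    simp only [casimir, map_add, add_mul, mul_add, c1.symm.eq, c2.symm.eq, c3.symm.eq]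
    module
  -- T carries the diagonal Casimir to that of o(3) on W, which is the scalar (2ν)². Under T the sum
  -- Σ X₊X₋ then becomes (x² + y² - 1)/2 - 2ν².
  have hT : T (casimir (ρ (fourX 1 + fourX (-1))) (ρ (fourY 1 + fourY (-1)))
      (ρ (fourZ 1 + fourZ (-1))) u) = (2 * ν) ^ 2 • T u := by
    have h1 := LinearMap.congr_fun hν (T u)
    have h2 := LinearMap.congr_fun (lift_casimir η ((2 : ℂ) • elemSkew 0 1)
      ((2 : ℂ) • elemSkew 0 2) ((2 : ℂ) • elemSkew 1 2)) (T u)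
    refine Eq.trans ?_ (h2.symm.trans h1)
    simp only [casimir, LinearMap.sub_apply, LinearMap.add_apply, Module.End.mul_apply,
      Module.End.one_apply, map_sub, ← hX, ← hY, ← hZ]
    simp only [map_add T]
  rw [hsum] at hT
  simp only [LinearMap.sub_apply, LinearMap.add_apply, LinearMap.smul_apply, Module.End.mul_apply,
    Module.End.one_apply, map_sub, map_add, map_smul] at hT
  rw [tensorPr_coupling_coupling]
  have key := congrArg (fun w => (1 / 2 : ℂ) • w) hT
  beta_reduce at key
  rw [← sub_eq_zero] at key ⊢
  refine Eq.trans ?_ ((congrArg Neg.neg key).trans neg_zero)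
  module

/-- The composite of a joint spectral projection of the couplings with `T ⊗ pr`. -/
theorem tensorPr_spectralProjection {x y ν : ℂ} (s t : ℂ) {u : V}
    (h : tensorPr T (coupling ρ 1 (coupling ρ (-1) (u ⊗ₜ f0)))
      = ((x ^ 2 + y ^ 2 + 1) / 2 - 2 * ν ^ 2) • T u) :
    tensorPr T (spectralProjection (coupling ρ 1) (coupling ρ (-1)) s t (u ⊗ₜ f0))
      = ((1 + s + t + s * t * ((x ^ 2 + y ^ 2 + 1) / 2 - 2 * ν ^ 2)) / 4) • T u := by
  have e : spectralProjection (coupling ρ 1) (coupling ρ (-1)) s t (u ⊗ₜ f0)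
      = (1 / 4 : ℂ) • (u ⊗ₜ f0 + s • coupling ρ 1 (u ⊗ₜ f0) + t • coupling ρ (-1) (u ⊗ₜ f0)
        + (s * t) • coupling ρ 1 (coupling ρ (-1) (u ⊗ₜ f0))) := by
    simp only [spectralProjection, LinearMap.smul_apply, Module.End.mul_apply, LinearMap.add_apply,
      Module.End.one_apply, map_add, map_smul]
    module
  rw [e, map_smul, map_add, map_add, map_add, map_smul, map_smul, map_smul, h, tensorPr_coupling,
    tensorPr_coupling, tensorPr_tmul, f0_three]
  module

/-- The translation formula in the coordinates of `o(4) ≃ sl(2) × sl(2)`. -/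
theorem translation_formula_sumDiff {x y ν : ℂ} (hx0 : x ≠ 0) (hy0 : y ≠ 0)
    (hρ : HasCentralCharacter ρ (hc4 (sumDiff x y))) (hη : HasCentralCharacter η (hc3 ν))
    (hscalar : ∀ (τ : EnvelopeCenter (SO 4) → ℂ),
      ∀ v ∈ primaryComponent (tensorAction ρ (standardRep 4)) τ,
      ∀ z : EnvelopeCenter (SO 4),
        centerAction (tensorAction ρ (standardRep 4)) z v = τ z • v)
    (hX : ∀ u, T (ρ (fourX 1 + fourX (-1)) u) = η ((2 : ℂ) • elemSkew 0 1) (T u))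
    (hY : ∀ u, T (ρ (fourY 1 + fourY (-1)) u) = η ((2 : ℂ) • elemSkew 0 2) (T u))
    (hZ : ∀ u, T (ρ (fourZ 1 + fourZ (-1)) u) = η ((2 : ℂ) • elemSkew 1 2) (T u))
    {ε ε' : ℂ} (hε : ε * ε = 1) (hε' : ε' * ε' = 1) :
    IsCompl (primaryComponent (tensorAction ρ (standardRep 4))
        (hc4 (sumDiff (x + ε) (y + ε'))))
      (⨆ (σ : EnvelopeCenter (SO 4) → ℂ) (_ : σ ≠ hc4 (sumDiff (x + ε) (y + ε'))),
        primaryComponent (tensorAction ρ (standardRep 4)) σ) ∧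
    ∀ u : V, tensorPr T (primaryProjection (tensorAction ρ (standardRep 4))
        (hc4 (sumDiff (x + ε) (y + ε'))) (u ⊗ₜ[ℂ] f0))
      = ((1 + ε / x + ε' / y + ε / x * (ε' / y) * ((x ^ 2 + y ^ 2 + 1) / 2 - 2 * ν ^ 2)) / 4)
        • T u := by
  have cx : casimir (ρ (fourX 1)) (ρ (fourY 1)) (ρ (fourZ 1)) = x ^ 2 • (1 : Module.End ℂ V) := by
    refine (lift_casimir ρ _ _ _).symm.trans (LinearMap.ext fun v => ?_)
    have := hρ ⟨casimirFour 1, casimirFour_one_mem⟩ v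
    rw [(hc4_casimirFour _).1, sumDiff_add] at this
    exact this
  have cy : casimir (ρ (fourX (-1))) (ρ (fourY (-1))) (ρ (fourZ (-1)))
      = y ^ 2 • (1 : Module.End ℂ V) := by
    refine (lift_casimir ρ _ _ _).symm.trans (LinearMap.ext fun v => ?_)
    have := hρ ⟨casimirFour (-1), casimirFour_neg_one_mem⟩ v
    rw [(hc4_casimirFour _).2, sumDiff_sub] at this
    exact this
  have cν : UniversalEnvelopingAlgebra.lift ℂ η casimirThree
      = (2 * ν) ^ 2 • (1 : Module.End ℂ W) := by
    refine LinearMap.ext fun v => ?_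
    have := hη ⟨casimirThree, casimirThree_mem⟩ v
    rw [hc3_casimirThree ν] at this
    exact this
  have hid : ∀ c : ℂ, (c • (1 : Module.End ℂ V)).rTensor (Fin 4 → ℂ)
      = c • (1 : Module.End ℂ (V ⊗[ℂ] (Fin 4 → ℂ))) := by
    intro c
    rw [LinearMap.rTensor_smul]
    congr 1
    exact LinearMap.rTensor_id _ _
  have hA : coupling ρ 1 * coupling ρ 1 = x ^ 2 • 1 := by
    rw [coupling_mul_self ρ one_mul_one_complex, cx, hid]
  have hB : coupling ρ (-1) * coupling ρ (-1) = y ^ 2 • 1 := by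
    rw [coupling_mul_self ρ neg_one_mul_neg_one_complex, cy, hid]
  have hΩA : UniversalEnvelopingAlgebra.lift ℂ (tensorAction ρ (standardRep 4)) (casimirFour 1)
      = (x ^ 2 + 1) • (1 : Module.End ℂ (V ⊗[ℂ] (Fin 4 → ℂ))) + (2 : ℂ) • coupling ρ 1 := by
    rw [lift_tensorAction_casimirFour ρ one_mul_one_complex, cx, hid, add_smul, one_smul, two_mul,
      two_smul]
  have hΩB : UniversalEnvelopingAlgebra.lift ℂ (tensorAction ρ (standardRep 4)) (casimirFour (-1))
      = (y ^ 2 + 1) • (1 : Module.End ℂ (V ⊗[ℂ] (Fin 4 → ℂ))) + (2 : ℂ) • coupling ρ (-1) := by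
    rw [lift_tensorAction_casimirFour ρ neg_one_mul_neg_one_complex, cy, hid, add_smul, one_smul,
      two_mul, two_smul]
  -- Both couplings are affine in the actions of the Casimirs, and those commute because the
  -- Casimirs are central.
  have hAB : Commute (coupling ρ 1) (coupling ρ (-1)) := by
    have h := commute_centerAction (tensorAction ρ (standardRep 4))
      ⟨casimirFour 1, casimirFour_one_mem⟩ (casimirFour (-1))
    have h' : Commute (UniversalEnvelopingAlgebra.lift ℂ (tensorAction ρ (standardRep 4))
      (casimirFour 1)) (UniversalEnvelopingAlgebra.lift ℂ (tensorAction ρ (standardRep 4))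
      (casimirFour (-1))) := h
    have e : ∀ {C D : Module.End ℂ (V ⊗[ℂ] (Fin 4 → ℂ))} {c : ℂ}, D = c • 1 + (2 : ℂ) • C →
        C = (1 / 2 : ℂ) • (D - c • 1) := by
      intro C D c h
      rw [h]; module
    rw [e hΩA, e hΩB]
    exact (((h'.sub_right ((Commute.one_right _).smul_right _)).sub_left
      ((Commute.one_left _).smul_left _)).smul_left _).smul_right _
  obtain ⟨h1, h2⟩ := isCompl_primaryComponent (tensorAction ρ (standardRep 4)) hA hB hAB hx0 hy0
    hΩA hΩB hscalar hε hε'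
  refine ⟨h1, fun u => (congrArg (fun p => tensorPr T (p (u ⊗ₜ[ℂ] f0))) h2).trans ?_⟩
  exact tensorPr_spectralProjection ρ T _ _
    (tensorPr_coupling_coupling_eq ρ T η cx cy cν hX hY hZ u)

theorem signC_mul_self (δ : ℤˣ) : signC δ * signC δ = 1 := by
  rcases Int.units_eq_one_or δ with rfl | rfl <;> simp [signC]

theorem sumDiff_add_sub (lam : Fin 2 → ℂ) : sumDiff (lam 0 + lam 1) (lam 0 - lam 1) = lam := by
  ext j
  fin_cases j <;> simp [sumDiff]

theorem sumDiff_add_single_zero (x y c : ℂ) :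
    sumDiff x y + Pi.single 0 c = sumDiff (x + c) (y + c) := by
  ext j
  fin_cases j <;> simp [sumDiff] <;> ring

theorem sumDiff_add_single_one (x y c : ℂ) :
    sumDiff x y + Pi.single 1 c = sumDiff (x + c) (y + -c) := by
  ext j
  fin_cases j <;> simp [sumDiff] <;> ring

/-- Over the common denominator 8xy the numerator completes, by δ² = 1, to (x + y + δ)² - 4ν², and
λ₁² - λ₂² = xy. -/
theorem translationCoeff_zero_sumDiff {x y : ℂ} (hx : x ≠ 0) (hy : y ≠ 0) (ν : ℂ) (δ : ℤˣ) :
    translationCoeff 0 δ (sumDiff x y) ν = (1 + signC δ / x + signC δ / y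
      + signC δ / x * (signC δ / y) * ((x ^ 2 + y ^ 2 + 1) / 2 - 2 * ν ^ 2)) / 4 := by
  have hδ := signC_mul_self δ
  have e0 : sumDiff x y 0 = (x + y) / 2 := rfl
  have e1 : sumDiff x y 0 ^ 2 - sumDiff x y 1 ^ 2 = x * y := by
    change ((x + y) / 2) ^ 2 - ((x - y) / 2) ^ 2 = _
    ring
  have e2 : signC δ / x * (signC δ / y) = 1 / (x * y) := by rw [div_mul_div_comm, hδ]
  rw [translationCoeff, e1, e2, e0, Fin.val_zero, pow_zero, one_mul]
  field_simp
  linear_combination 4 * hδ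

/-- Here the second sign is -δ. The numerator over 8xy becomes -((x - y + δ)² - 4ν²), which is the
origin of the sign (-1)^(i-1). -/
theorem translationCoeff_one_sumDiff {x y : ℂ} (hx : x ≠ 0) (hy : y ≠ 0) (ν : ℂ) (δ : ℤˣ) :
    translationCoeff 1 δ (sumDiff x y) ν = (1 + signC δ / x + -signC δ / y
      + signC δ / x * (-signC δ / y) * ((x ^ 2 + y ^ 2 + 1) / 2 - 2 * ν ^ 2)) / 4 := by
  have hδ := signC_mul_self δ
  have e0 : sumDiff x y 1 = (x - y) / 2 := rfl
  have e1 : sumDiff x y 0 ^ 2 - sumDiff x y 1 ^ 2 = x * y := by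
    change ((x + y) / 2) ^ 2 - ((x - y) / 2) ^ 2 = _
    ring
  have e2 : signC δ / x * (-signC δ / y) = -1 / (x * y) := by
    rw [div_mul_div_comm, mul_neg, hδ]
  rw [translationCoeff, e1, e2, e0, Fin.val_one, pow_one]
  field_simp
  linear_combination -4 * hδ

/-- The translation formula for representations of `o(4)` and `o(3)`. -/
theorem translation_formula (lam : Fin 2 → ℂ) (ν : ℂ) (hρ : HasCentralCharacter ρ (hc4 lam))
    (hη : HasCentralCharacter η (hc3 ν)) (hreg : lam 0 ≠ lam 1) (hreg' : lam 0 ≠ -lam 1)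
    (hscalar : ∀ (τ : EnvelopeCenter (SO 4) → ℂ),
      ∀ v ∈ primaryComponent (tensorAction ρ (standardRep 4)) τ,
      ∀ z : EnvelopeCenter (SO 4),
        centerAction (tensorAction ρ (standardRep 4)) z v = τ z • v)
    (hX : ∀ u, T (ρ (fourX 1 + fourX (-1)) u) = η ((2 : ℂ) • elemSkew 0 1) (T u))
    (hY : ∀ u, T (ρ (fourY 1 + fourY (-1)) u) = η ((2 : ℂ) • elemSkew 0 2) (T u))
    (hZ : ∀ u, T (ρ (fourZ 1 + fourZ (-1)) u) = η ((2 : ℂ) • elemSkew 1 2) (T u))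
    (i : Fin 2) (δ : ℤˣ) :
    IsCompl (primaryComponent (tensorAction ρ (standardRep 4))
        (hc4 (lam + Pi.single i (signC δ))))
      (⨆ (σ : EnvelopeCenter (SO 4) → ℂ) (_ : σ ≠ hc4 (lam + Pi.single i (signC δ))),
        primaryComponent (tensorAction ρ (standardRep 4)) σ) ∧
    ∀ u : V, tensorPr T (primaryProjection (tensorAction ρ (standardRep 4))
        (hc4 (lam + Pi.single i (signC δ))) (u ⊗ₜ[ℂ] f0)) = translationCoeff i δ lam ν • T u := by
  -- In the coordinates x = λ₁ + λ₂, y = λ₁ - λ₂ the regularity conditions read x ≠ 0 and y ≠ 0.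
  -- Adding δe₁ shifts both by δ, and adding δe₂ shifts them by δ and -δ.
  obtain ⟨x, y, rfl⟩ : ∃ x y, lam = sumDiff x y := ⟨_, _, (sumDiff_add_sub lam).symm⟩
  have hx0 : x ≠ 0 := by
    rintro rfl
    refine hreg' ?_
    change (0 + y) / 2 = -((0 - y) / 2)
    ring
  have hy0 : y ≠ 0 := by
    rintro rfl
    refine hreg ?_
    change (x + 0) / 2 = (x - 0) / 2
    ring
  have hδ := signC_mul_self δ
  obtain rfl | rfl : i = 0 ∨ i = 1 := by omega
  · rw [sumDiff_add_single_zero, translationCoeff_zero_sumDiff hx0 hy0]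
    exact translation_formula_sumDiff ρ T η hx0 hy0 hρ hη hscalar hX hY hZ hδ hδ
  · rw [sumDiff_add_single_one, translationCoeff_one_sumDiff hx0 hy0]
    exact translation_formula_sumDiff ρ T η hx0 hy0 hρ hη hscalar hX hY hZ hδ
      ((neg_mul_neg _ _).trans hδ)

end Translation

/-! ### From group intertwiners to o(3)-intertwiners. -/

theorem extendByZero_zero : extendByZero (0 : Matrix (Fin 3) (Fin 3) ℂ) = 0 := by
  ext i j
  fin_cases i <;> fin_cases j <;> rfl

theorem extendByZero_add (A B : Matrix (Fin 3) (Fin 3) ℂ) :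
    extendByZero (A + B) = extendByZero A + extendByZero B := by
  ext i j
  fin_cases i <;> fin_cases j <;> first | rfl | exact (add_zero (0 : ℂ)).symm

theorem extendByZero_smul (c : ℂ) (A : Matrix (Fin 3) (Fin 3) ℂ) :
    extendByZero (c • A) = c • extendByZero A := by
  ext i j
  fin_cases i <;> fin_cases j <;> first | rfl | exact (smul_zero c).symm

theorem extendComplex_one_tmul {g V : Type*} [LieRing g] [LieAlgebra ℝ g] [AddCommGroup V]
    [Module ℂ V] (f : g →ₗ⁅ℝ⁆ Module.End ℂ V) (X : g) :
    extendComplex f ((1 : ℂ) ⊗ₜ[ℝ] X) = f X := by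
  change LinearMap.liftBaseChange ℂ (f : g →ₗ[ℝ] Module.End ℂ V) ((1 : ℂ) ⊗ₜ[ℝ] X) = f X
  simp

section Intertwining

variable {E E' G G' : Type*} [NormedAddCommGroup E] [NormedSpace ℝ E] [CompleteSpace E]
    [NormedAddCommGroup E'] [NormedSpace ℝ E'] [CompleteSpace E']
    [Group G] [TopologicalSpace G] [ChartedSpace E G] [LieGroup 𝓘(ℝ, E) ∞ G]
    [Group G'] [TopologicalSpace G'] [ChartedSpace E' G'] [LieGroup 𝓘(ℝ, E') ∞ G']
    [FiniteDimensional ℝ E] [FiniteDimensional ℝ E']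
    {V W : Type*} [AddCommGroup V] [Module ℂ V] [UniformSpace V] [FrechetSpace V]
    [AddCommGroup W] [Module ℂ W] [UniformSpace W] [FrechetSpace W]

/-- A continuous intertwining operator intertwines the differentiated representations. -/
theorem SmoothRep.intertwines_diff (ρ : SmoothRep E G V) (η : SmoothRep E' G' W) {j : G' →* G}
    (hj : ContMDiff 𝓘(ℝ, E') 𝓘(ℝ, E) ∞ j) (T : V →L[ℂ] W)
    (hT : ∀ (h : G') (u : V), T (ρ.toHom (j h) u) = η.toHom h (T u))
    (X : GroupLieAlgebra 𝓘(ℝ, E') G') (u : V) :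
    T (ρ.diff (lieDifferential j X) u) = η.diff X (T u) := by
  refine SeparatingDual.eq_iff_forall_dual_eq (R := ℝ) |>.2 fun φ => ?_
  -- Continuous functionals separate points. The matrix coefficient of T u on G' is the pullback
  -- under j of the one of u for ψ = φ ∘ T, and the chain rule at the identity gives the claim.
  let ψ : V →L[ℝ] ℝ := φ.comp (T.restrictScalars ℝ)
  have e1 : ρ.coeff ψ u ∘ j = η.coeff φ (T u) := by
    funext h
    simp [SmoothRep.coeff, ψ, hT]
  have hj1 : MDifferentiableAt 𝓘(ℝ, E') 𝓘(ℝ, E) j 1 :=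
    (hj 1).mdifferentiableAt (by simp)
  have hf : MDifferentiableAt 𝓘(ℝ, E) 𝓘(ℝ, ℝ) (ρ.coeff ψ u) (j 1) :=
    ((ρ.contMDiff_coeff ψ u) _).mdifferentiableAt (by norm_num)
  have h1 := mfderiv_comp (1 : G') hf hj1
  rw [e1] at h1
  have h2 := η.mfderiv_coeff_one φ (T u) X
  rw [h1] at h2
  have h3 := ρ.mfderiv_coeff_one ψ u (lieDifferential j X)
  have h4 : mfderiv 𝓘(ℝ, E) 𝓘(ℝ, ℝ) (ρ.coeff ψ u) (j 1) (lieDifferential j X)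
      = φ (η.diff X (T u)) := h2
  rw [map_one] at h4
  exact h3.symm.trans h4

/-- A symmetry breaking operator intertwines the actions of `o(3)`. -/
theorem O4O3Pair.IsSymmetryBreaking.action (P : O4O3Pair E E' G G') {ρ : SmoothRep E G V}
    {η : SmoothRep E' G' W} {T : V →L[ℂ] W} (hT : P.IsSymmetryBreaking ρ η T) (A : SO 3)
    (B : SO 4) (hB : B.1 = extendByZero A.1) (u : V) :
    T (P.action ρ B u) = P.action' η A (T u) := by
  -- Compatibility of the two isomorphisms is given only on the real form, that is for 1 ⊗ X, where
  -- the claim is the differentiated intertwining relation. It extends ℂ-linearly, and `iso'`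
  -- reaches every element of o(3); the partner in o(4) is then determined by its matrix.
  have key : ∀ (t : ℂ ⊗[ℝ] GroupLieAlgebra 𝓘(ℝ, E') G'), ∃ B : SO 4,
      B.1 = extendByZero (P.iso' t).1 ∧
      ∀ u, T (P.action ρ B u) = P.action' η (P.iso' t) (T u) := by
    intro t
    induction t with
    | zero =>
      refine ⟨0, ?_, fun u => ?_⟩
      · rw [map_zero]
        exact extendByZero_zero.symm
      · simp
    | add s t hs ht =>
      obtain ⟨B, hB, hB'⟩ := hs
      obtain ⟨C, hC, hC'⟩ := ht
      refine ⟨B + C, ?_, fun u => ?_⟩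
      · rw [map_add]
        change B.1 + C.1 = extendByZero ((P.iso' s).1 + (P.iso' t).1)
        rw [hB, hC, extendByZero_add]
      · simp only [map_add, LinearMap.add_apply, hB', hC']
    | tmul c X =>
      have e : c ⊗ₜ[ℝ] X = c • ((1 : ℂ) ⊗ₜ[ℝ] X) := by
        rw [TensorProduct.smul_tmul', smul_eq_mul, mul_one]
      refine ⟨c • P.iso ((1 : ℂ) ⊗ₜ[ℝ] lieDifferential P.j X), ?_, fun u => ?_⟩
      · rw [e, map_smul]
        change c • (P.iso ((1 : ℂ) ⊗ₜ[ℝ] lieDifferential P.j X)).1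
          = extendByZero (c • (P.iso' ((1 : ℂ) ⊗ₜ[ℝ] X)).1)
        rw [P.compatible, extendByZero_smul]
      · rw [e, map_smul, map_smul, map_smul, LinearMap.smul_apply, LinearMap.smul_apply, map_smul]
        congr 1
        have h1 : P.action ρ (P.iso ((1 : ℂ) ⊗ₜ[ℝ] lieDifferential P.j X)) u
            = ρ.diff (lieDifferential P.j X) u := by
          change extendComplex ρ.differential (P.iso.symm (P.iso _)) u = _
          rw [LieEquiv.symm_apply_apply]
          rw [extendComplex_one_tmul]
          rfl
        have h2 : P.action' η (P.iso' ((1 : ℂ) ⊗ₜ[ℝ] X)) (T u) = η.diff X (T u) := by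
          change extendComplex η.differential (P.iso'.symm (P.iso' _)) (T u) = _
          rw [LieEquiv.symm_apply_apply]
          rw [extendComplex_one_tmul]
          rfl
        rw [h1, h2]
        exact ρ.intertwines_diff η P.smooth T hT X u
  obtain ⟨C, hC, hC'⟩ := key (P.iso'.symm A)
  rw [LieEquiv.apply_symm_apply] at hC hC'
  have : B = C := Subtype.ext (hB.trans hC.symm)
  rw [this]
  exact hC' u

end Intertwining

/-- Adding the triples for s = 1 and s = -1 cancels all terms involving the last basis vector, so
the diagonal o(3) of the two ideals is the stabilizer of f₀. -/
theorem extendByZero_elemSkew : (fourX 1 + fourX (-1)).1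
      = extendByZero ((2 : ℂ) • elemSkew (n := 3) 0 1 : SO 3).1 ∧
    (fourY 1 + fourY (-1)).1 = extendByZero ((2 : ℂ) • elemSkew (n := 3) 0 2 : SO 3).1 ∧
    (fourZ 1 + fourZ (-1)).1 = extendByZero ((2 : ℂ) • elemSkew (n := 3) 1 2 : SO 3).1 := by
  have h : ∀ (B : SO 4) (A : SO 3), B.1 0 1 = A.1 0 1 → B.1 0 2 = A.1 0 2 → B.1 1 2 = A.1 1 2 →
      B.1 0 3 = 0 → B.1 1 3 = 0 → B.1 2 3 = 0 → B.1 = extendByZero A.1 := by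
    intro B A h01 h02 h12 h03 h13 h23
    have z : ∀ i j, B.1 i j = 0 → B.1 j i = 0 := fun i j h => by rw [SO.apply_swap B i j, h, neg_zero]
    have w : ∀ (i j : Fin 4) (i' j' : Fin 3), B.1 i j = A.1 i' j' → B.1 j i = A.1 j' i' :=
      fun i j i' j' h => by rw [SO.apply_swap B i j, h, ← SO.apply_swap]
    ext i j
    fin_cases i <;> fin_cases j
    exacts [(SO.apply_self B 0).trans (SO.apply_self A 0).symm, h01, h02, h03, w _ _ _ _ h01,
      (SO.apply_self B 1).trans (SO.apply_self A 1).symm, h12, h13, w _ _ _ _ h02, w _ _ _ _ h12,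
      (SO.apply_self B 2).trans (SO.apply_self A 2).symm, h23, z _ _ h03, z _ _ h13, z _ _ h23,
      SO.apply_self B 3]
  refine ⟨h _ _ ?_ ?_ ?_ ?_ ?_ ?_, h _ _ ?_ ?_ ?_ ?_ ?_ ?_, h _ _ ?_ ?_ ?_ ?_ ?_ ?_⟩ <;>
    simp [fourX, fourY, fourZ, SO.add_apply, SO.sub_apply, SO.smul_apply, elemSkew_apply] <;>
    norm_num

end

theorem mainTheorem5 {n n' : ℕ}
    {G : Type*} [Group G] [TopologicalSpace G] [ChartedSpace (EuclideanSpace ℝ (Fin n)) G]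
    [LieGroup 𝓘(ℝ, EuclideanSpace ℝ (Fin n)) ∞ G]
    {G' : Type*} [Group G'] [TopologicalSpace G'] [ChartedSpace (EuclideanSpace ℝ (Fin n')) G']
    [LieGroup 𝓘(ℝ, EuclideanSpace ℝ (Fin n')) ∞ G']
    (P : O4O3Pair (EuclideanSpace ℝ (Fin n)) (EuclideanSpace ℝ (Fin n')) G G')
    {V : Type*} [AddCommGroup V] [Module ℂ V] [UniformSpace V] [FrechetSpace V]
    {W : Type*} [AddCommGroup W] [Module ℂ W] [UniformSpace W] [FrechetSpace W]
    (ρ : SmoothRep (EuclideanSpace ℝ (Fin n)) G V)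
    (η : SmoothRep (EuclideanSpace ℝ (Fin n')) G' W)
    (lam : Fin 2 → ℂ) (ν : ℂ)
    (hρ : HasCentralCharacter (P.action ρ) (hc4 lam))
    (hη : HasCentralCharacter (P.action' η) (hc3 ν))
    (hreg : lam 0 ≠ lam 1) (hreg' : lam 0 ≠ -lam 1)
    (hscalar : ∀ (τ : EnvelopeCenter (SO 4) → ℂ), ∀ x ∈ primaryComponent (P.tensorFour ρ) τ,
      ∀ z : EnvelopeCenter (SO 4), centerAction (P.tensorFour ρ) z x = τ z • x)
    (T : V →L[ℂ] W) (hT : P.IsSymmetryBreaking ρ η T) (i : Fin 2) (δ : ℤˣ) :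
    IsCompl (primaryComponent (P.tensorFour ρ) (hc4 (lam + Pi.single i (signC δ))))
      (⨆ (σ : EnvelopeCenter (SO 4) → ℂ) (_ : σ ≠ hc4 (lam + Pi.single i (signC δ))),
        primaryComponent (P.tensorFour ρ) σ) ∧
    ∀ u : V,
      tensorPr (T : V →ₗ[ℂ] W)
          (primaryProjection (P.tensorFour ρ) (hc4 (lam + Pi.single i (signC δ))) (u ⊗ₜ[ℂ] f0))
        = translationCoeff i δ lam ν • T u := by
  obtain ⟨e1, e2, e3⟩ := extendByZero_elemSkew
  exact translation_formula (P.action ρ) (T : V →ₗ[ℂ] W) (P.action' η) lam ν hρ hη hreg hreg' hscalar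
    (fun u => hT.action P _ _ e1 u) (fun u => hT.action P _ _ e2 u)
    (fun u => hT.action P _ _ e3 u) i δ
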